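/- Let $E/F$ be a quadratic extension of non-archimedean local fields with $E=F(\alpha)$, $\alpha\notin F$, $\alpha^2\in F$; write $x=x_1+x_2\alpha$ ($x_1,x_2\in F$) for $x\in E$. For $k\in\{E,F\}$ let $\mathcal O_k$ be the ring of integers, $\varpi_k$ a uniformizer, $\nu_k$ the normalized valuation, $q_k$ the cardinality of the residue field and $|\cdot|_k=q_k^{-\nu_k(\cdot)}$. For a character $\chi$ of $\mathcal O_k^\times$ and $s\in\mathbb C$ put $\chi_s(x)=\chi(\varpi_k^{-\nu_k(x)}x)|x|_k^s$ ($x\in k^\times$). Let $dx$ be the Haar measure on $E$ with $\mathrm{vol}(\mathcal O_E)=1$, and let $\mathcal D'(E)$ be the space of linear functionals on the space $C_c^\infty(E)$ of locally constant compactly supported functions $E\to\mathbb C$. Put $$\backslash\!\backslash=\{(\chi,s,\eta,t)\in\widehat{\mathcal O_E^\times}\times\mathbb C\times\widehat{\mathcal O_F^\times}\times\mathbb C:\chi|_{\mathcal O_F^\times}\eta=1,\ 2s+t+\tfrac12\in\tfrac{2\pi i}{\ln q_F}\mathbb Z\},$$ $$/\!/=\{(\chi,s,\eta,t)\in\widehat{\mathcal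 O_E^\times}\times\mathbb C\times\widehat{\mathcal O_F^\times}\times\mathbb C:\chi|_{\mathcal O_F^\times}\eta^{-1}=1,\ 2s-t+\tfrac12\in\tfrac{2\pi i}{\ln q_F}\mathbb Z\}.$$ Let $L$ be the set of all $(\chi,s,\eta,t)$ with $\chi|_{\mathcal O_F^\times}\eta=\chi|_{\mathcal O_F^\times}\eta^{-1}=1$ such that, modulo $\frac{2\pi i}{\ln q_E}\mathbb Z\times\frac{2\pi i}{\ln q_F}\mathbb Z$, the pair $(s,t)$ belongs to - $\{(0,\frac12),(\frac{\pi i}{\ln q_E},\frac12+\frac{\pi i}{\ln q_F})\}$ if $\chi^2\ne1$ and $E/F$ is unramified ($q_E=q_F^2$), - $\{(0,\frac12),(\frac{\pi i}{\ln q_E},\frac12),(\frac{\pi i}{2\ln q_E},\frac12+\frac{\pi i}{\ln q_F}),(\frac{3\pi i}{2\ln q_E},\frac12+\frac{\pi i}{\ln q_F})\}$ if $\chi^2\ne1$ and $E/F$ is ramified ($q_E=q_F$), - $\{(-\frac12,-\frac12),(-\frac12+\frac{\pi i}{\ln q_E},-\frac12+\frac{\pi i}{\ln q_F})\}$ if $\chi^2=1$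 and $E/F$ is unramified, - $\{(-\frac12,-\frac12),(-\frac12+\frac{\pi i}{\ln q_E},-\frac12),(\frac{\pi i}{2\ln q_E},\frac12+\frac{\pi i}{\ln q_F}),(\frac{3\pi i}{2\ln q_E},\frac12+\frac{\pi i}{\ln q_F})\}$ if $\chi^2=1$ and $E/F$ is ramified. Then $L$ is a discrete subset of the parameter space, and $L\subseteq/\!/$. Let $\chi\in\widehat{\mathcal O_E^\times}$, $\eta\in\widehat{\mathcal O_F^\times}$, and assume that the uniformizers are compatible with $\chi$ in the sense that $\chi_0(\varpi_F)=1$ (for instance $\varpi_F=\varpi_E$ if $E/F$ is unramified, or $\varpi_F=\varpi_E^2$ if it is ramified). There is a unique family $(\widetilde K_{s,t}^{\chi,\eta})_{(s,t)\in\mathbb C^2}$ in $\mathcal D'(E)$ such that $(s,t)\mapsto\langle\widetilde K_{s,t}^{\chi,\eta},\varphi\rangle$ is holomorphic on $\mathbb C^2$ for every $\varphi\in C_c^\infty(E)$ and such that, for $\mathrm{Re}(2s\pm t+\frac12)>0$, the distribution $\widetilde K_{s,t}^{\chi,\eta}$ is given by the locally integrable function $$L(\tfrac12,\chi_s|_{F^\times}\eta_t)^{-1}\,L(\tfrac12,\chi_s|_{F^\times}\eta_t^{-1})^{-1}\,\chi_{s-\frac12}(x^2)\,(\chi_{s-\frac12}\eta_{t+\frac12})\Big(\frac{x_2}{x_1^2-x_2^2\alpha^2}\Big)\qquad(x\in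 E\setminus F),$$ where $L(\frac12,\chi_s|_{F^\times}\eta_t^{\pm1})^{-1}$ equals $1-q_F^{-(2s\pm t+\frac12)}$ if $\chi|_{\mathcal O_F^\times}\eta^{\pm1}=1$, and equals $1$ otherwise. For all $s,t\in\mathbb C$ one has $\widetilde K_{s,t}^{\chi,\eta}=0$ if and only if $(\chi,s,\eta,t)\in L$, and $$\operatorname{supp}\widetilde K_{s,t}^{\chi,\eta}=\begin{cases}\emptyset&\text{for }(\chi,s,\eta,t)\in L,\\\{0\}&\text{for }(\chi,s,\eta,t)\in/\!/\setminus L,\\F&\text{for }(\chi,s,\eta,t)\in\backslash\!\backslash\setminus/\!/,\\E&\text{else.}\end{cases}$$ -/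

import Mathlib

open ValuativeRel MeasureTheory

namespace SymBreak

noncomputable section

section LocalField

variable (K : Type*) [Field K] [ValuativeRel K] [TopologicalSpace K]
  [IsNonarchimedeanLocalField K]

/-- The cardinality `q_K` of the residue field. -/
def resCard : ℕ := Nat.card 𝓀[K]

/-- The group of (unitary) characters of the compact group of units `𝒪[K]ˣ`. -/
abbrev UnitChar := PontryaginDual 𝒪[K]ˣ

variable {K}

/-- The normalized additive valuation `ν_K : K → ℤ` (with the junk value `0` at `0`). -/
def ord (x : K) : ℤ :=
  -WithZero.log (IsNonarchimedeanLocalField.valueGroupWithZeroIsoInt K (valuation K x))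

open Classical in
/-- The normalized absolute value `|x| = q_K ^ (-ν_K x)`, `|0| = 0`. -/
def absv (x : K) : ℝ := if x = 0 then 0 else (resCard K : ℝ) ^ (-ord x)

open Classical in
/-- A character of `𝒪[K]ˣ`, viewed as a function on `K` vanishing outside the units. -/
def unitExt (χ : UnitChar K) (y : K) : ℂ :=
  if h : ∃ u : 𝒪[K]ˣ, ((u : 𝒪[K]) : K) = y then (χ h.choose : ℂ) else 0

/-- The quasi-character `χ_s(x) = χ(ϖ ^ (-ν(x)) x) |x| ^ s` of `Kˣ`; its value at `0` is `0`. -/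
def multChar (ϖ : 𝒪[K]) (χ : UnitChar K) (s : ℂ) (x : K) : ℂ :=
  unitExt χ ((ϖ : K) ^ (-ord x) * x) * (absv x : ℂ) ^ s

open Classical in
/-- The local `L`-factor `L(z, ξ_r)` of the quasi-character `ξ_r` of `Kˣ`. -/
def localL (z : ℂ) (ξ : UnitChar K) (r : ℂ) : ℂ :=
  if ξ = 1 then (1 - (resCard K : ℂ) ^ (-z - r))⁻¹ else 1

variable (K) in
/-- The period lattice `(2πi / ln q_K) ℤ ⊆ ℂ`. -/
def periods : Set ℂ :=
  {z | ∃ n : ℤ, z = n * (2 * Real.pi * Complex.I / Real.log (resCard K))}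

end LocalField

section Distributions

/-- The test functions `C_c^∞(X)`: locally constant functions `X → ℂ` with compact support. -/
def testFunctions (X : Type*) [TopologicalSpace X] : Submodule ℂ (X → ℂ) where
  carrier := {f | IsLocallyConstant f ∧ HasCompactSupport f}
  zero_mem' := ⟨IsLocallyConstant.const 0, HasCompactSupport.zero⟩
  add_mem' hf hg := ⟨hf.1.add hg.1, hf.2.add hg.2⟩
  smul_mem' c f hf := ⟨hf.1.comp (fun z => c * z), hf.2.smul_left⟩

instance (X : Type*) [TopologicalSpace X] : FunLike (testFunctions X) X ℂ where
  coe f := f.1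
  coe_injective := Subtype.val_injective

/-- The space `𝒟'(X)` of distributions: all linear functionals on `C_c^∞(X)`. -/
abbrev Distr (X : Type*) [TopologicalSpace X] := testFunctions X →ₗ[ℂ] ℂ

end Distributions

section Extension

variable (F E : Type*) [Field F] [ValuativeRel F] [TopologicalSpace F]
  [IsNonarchimedeanLocalField F] [Field E] [ValuativeRel E] [TopologicalSpace E]
  [IsNonarchimedeanLocalField E] [Algebra F E] [ValuativeExtension F E]

lemma continuous_algebraMap_localField : Continuous (algebraMap F E) := by
  refine continuous_of_continuousAt_zero (algebraMap F E).toAddMonoidHom ?_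
  rw [ContinuousAt, RingHom.toAddMonoidHom_eq_coe, AddMonoidHom.coe_coe, map_zero,
    (IsValuativeTopology.hasBasis_nhds_zero' F).tendsto_iff
      (IsValuativeTopology.hasBasis_nhds_zero' E)]
  intro γ hγ
  obtain ⟨r, hr0, hr1⟩ := Valuation.IsNontrivial.exists_lt_one (v := valuation F)
  have h1 : valuation E (algebraMap F E r) < 1 := by
    rw [← ValuativeExtension.mapValueGroupWithZero_valuation,
      ← map_one (ValuativeExtension.mapValueGroupWithZero F E)]
    exact ValuativeExtension.mapValueGroupWithZero_strictMono hr1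
  obtain ⟨n, hn⟩ := exists_pow_lt₀ h1 (Units.mk0 γ hγ)
  refine ⟨valuation F (r ^ n), by simpa using fun h => absurd h (by simpa using hr0),
    fun x hx => ?_⟩
  have h2 := ValuativeExtension.mapValueGroupWithZero_strictMono (A := F) (B := E) hx
  simp only [ValuativeExtension.mapValueGroupWithZero_valuation] at h2
  refine lt_trans h2 ?_
  simpa using hn

/-- The inclusion `𝒪[F] → 𝒪[E]`. -/
def integerMap : 𝒪[F] →+* 𝒪[E] :=
  ((algebraMap F E).comp (𝒪[F]).subtype).codRestrict 𝒪[E] fun x => by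
    have h := ValuativeExtension.mapValueGroupWithZero_strictMono (A := F) (B := E)
      |>.monotone (show valuation F x.1 ≤ 1 from x.2)
    rw [map_one, ValuativeExtension.mapValueGroupWithZero_valuation] at h
    exact h

lemma continuous_integerMap : Continuous (integerMap F E) :=
  ((continuous_algebraMap_localField F E).comp continuous_subtype_val).subtype_mk _

variable {F E}

/-- The restriction of a character of `𝒪[E]ˣ` to `𝒪[F]ˣ`. -/
def resChar (χ : UnitChar E) : UnitChar F :=
  PontryaginDual.map
    ⟨Units.map (integerMap F E : 𝒪[F] →* 𝒪[E]), (continuous_integerMap F E).units_map _⟩ χ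

variable (F E)

/-- The parameter space of all `(χ, s, η, t)`; the two character groups are discrete. -/
abbrev Param := UnitChar E × ℂ × UnitChar F × ℂ

/-- The set `\\`: `χ|·η = 1` and `2s + t + 1/2 ∈ (2πi / ln q_F) ℤ`. -/
def backslashSet : Set (Param F E) :=
  {p | match p with
    | (χ, s, η, t) => resChar χ * η = 1 ∧ 2 * s + t + 1 / 2 ∈ periods F}

/-- The set `//`: `χ|·η⁻¹ = 1` and `2s - t + 1/2 ∈ (2πi / ln q_F) ℤ`. -/
def slashSet : Set (Param F E) :=
  {p | match p with
    | (χ, s, η, t) => resChar χ * η⁻¹ = 1 ∧ 2 * s - t + 1 / 2 ∈ periods F}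

variable {E}

open Classical Real Complex in
/-- Representatives `(s, t)` of the zeros, modulo periods, when `χ|·η = χ|·η⁻¹ = 1`.
The extension is unramified if and only if `q_E = q_F ^ 2`. -/
def zeroReps (χ : UnitChar E) : Set (ℂ × ℂ) :=
  let lE : ℂ := Real.log (resCard E)
  let lF : ℂ := Real.log (resCard F)
  if χ ^ 2 ≠ 1 then
    if resCard E = resCard F ^ 2 then
      {(0, 1 / 2), (π * I / lE, 1 / 2 + π * I / lF)}
    else
      {(0, 1 / 2), (π * I / lE, 1 / 2),
        (π * I / (2 * lE), 1 / 2 + π * I / lF), (3 * π * I / (2 * lE), 1 / 2 + π * I / lF)}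
  else
    if resCard E = resCard F ^ 2 then
      {(-1 / 2, -1 / 2), (-1 / 2 + π * I / lE, -1 / 2 + π * I / lF)}
    else
      {(-1 / 2, -1 / 2), (-1 / 2 + π * I / lE, -1 / 2),
        (π * I / (2 * lE), 1 / 2 + π * I / lF), (3 * π * I / (2 * lE), 1 / 2 + π * I / lF)}

variable (E)

/-- The set `L`; `(s, t)` matters only modulo `(2πi / ln q_E) ℤ × (2πi / ln q_F) ℤ`. -/
def zeroSet : Set (Param F E) :=
  {p | match p with
    | (χ, s, η, t) => resChar χ * η = 1 ∧ resChar χ * η⁻¹ = 1 ∧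
        ∃ r ∈ zeroReps F χ, s - r.1 ∈ periods E ∧ t - r.2 ∈ periods F}

variable {F E}

/-- The function `K_{s,t}^{χ,η}` on `E`; here `x = x₁ + x₂ α` with respect to the basis
`b = (1, α)` and `d = α²`. On `F`, where the formula has no meaning, its value is `0`. -/
def kernelFun (b : Module.Basis (Fin 2) F E) (d : F) (ϖF : 𝒪[F]) (ϖE : 𝒪[E])
    (χ : UnitChar E) (η : UnitChar F) (s t : ℂ) (x : E) : ℂ :=
  let x₁ : F := b.repr x 0
  let x₂ : F := b.repr x 1
  let y : F := x₂ / (x₁ ^ 2 - x₂ ^ 2 * d)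
  multChar ϖE χ (s - 1 / 2) (x ^ 2) *
    (multChar ϖE χ (s - 1 / 2) (algebraMap F E y) * multChar ϖF η (t + 1 / 2) y)

/-- The normalizing factor `L(1/2, χ_s|·η_t)⁻¹ L(1/2, χ_s|·η_t⁻¹)⁻¹`, where the characters
`χ_s|·η_t` and `χ_s|·η_t⁻¹` of `Fˣ` are `(χ|·η)_{2s+t}` and `(χ|·η⁻¹)_{2s-t}`. -/
def normFactor (χ : UnitChar E) (η : UnitChar F) (s t : ℂ) : ℂ :=
  (localL (1 / 2) (resChar χ * η) (2 * s + t))⁻¹ *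
    (localL (1 / 2) (resChar χ * η⁻¹) (2 * s - t))⁻¹

/-- `Kt` is the holomorphic extension to `(s, t) ∈ ℂ²` of the family of distributions given by
the locally integrable functions `normFactor · K_{s,t}^{χ,η}` for `Re (2s ± t + 1/2) > 0`. -/
structure IsRenormalizedKernel (b : Module.Basis (Fin 2) F E) (d : F) (ϖF : 𝒪[F]) (ϖE : 𝒪[E])
    [MeasurableSpace E] (μ : Measure E) (χ : UnitChar E) (η : UnitChar F)
    (Kt : ℂ → ℂ → Distr E) : Prop where
  holomorphic : ∀ φ : testFunctions E, Differentiable ℂ fun p : ℂ × ℂ => Kt p.1 p.2 φ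
  locallyIntegrable : ∀ s t : ℂ, 0 < (2 * s + t + 1 / 2).re → 0 < (2 * s - t + 1 / 2).re →
    LocallyIntegrable (kernelFun b d ϖF ϖE χ η s t) μ
  eq_integral : ∀ s t : ℂ, 0 < (2 * s + t + 1 / 2).re → 0 < (2 * s - t + 1 / 2).re →
    ∀ φ : testFunctions E,
      Kt s t φ = normFactor χ η s t * ∫ x, kernelFun b d ϖF ϖE χ η s t x * φ x ∂μ

end Extension

end

end SymBreak

open SymBreak

/-! Put κ = (χ|·η)_{2s+t-1/2}, a quasi-character of Fˣ. By `kernelFun_eq` the kernel is g(x) κ(x₂),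
where g (`smoothFactor`) is locally constant away from 0. So it is singular only along F = {x₂ = 0}
and at the origin, and homogeneous at both places: the scaling σ of x₂ by l multiplies κ by κ(l) and
Haar measure by |l|, and dilation by m ∈ Fˣ multiplies the kernel by `dilationChar` and Haar measure
by |m|². Replacing gφ by gφ - gφ∘σ⁻¹, and φ by φ - φ(m⁻¹·), therefore multiplies the integral by 1 -
(χ|·η)_{2s+t+1/2}(l) and 1 - (χ|·η⁻¹)_{2s-t+1/2}(m). For l and m a uniformizer, or a unit at which
the character is nontrivial, these are the inverse L-factors up to constants
(`exists_inv_localL_eq`). The differences vanish near the singularities, so the integrand is locally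
constant with compact support, uniformly in (s, t), and its integral is a finite sum of entire
functions (`exists_renormalization`). Uniqueness is the identity theorem.

Supports. The kernel vanishes nowhere off F, so the support is E when the normalizing factor is
nonzero and lies in F otherwise. On `\\` minus `//`, a small box around a point of Fˣ detects the
distribution (`range_subset_dsupport`). On `//` the distribution kills every φ with φ(0) = 0, so it
is a multiple of the Dirac mass at 0, and it remains to decide when that multiple vanishes. There η
= χ|, and t = 2s + 1/2 up to periods.

If χ|² = 1, the multiple is the value at the indicator of 𝒪[E], that is, the continuation of an
explicit integral of (χ²)_{-2s-1}(x) |x₂|^{4s} over a compact shell. In an integral basis (1, θ) it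
telescopes over the groups (𝒪[F] + 𝔭ʲ𝒪[E])ˣ and gives, up to nowhere vanishing factors, q^{-4s} - 1
if χ² ≠ 1, 1 - q^{-4s-2} if χ² = 1 and E/F is unramified, and (1 + q^{2s})(1 - q^{-2s-1}) if χ² = 1
and E/F is ramified, with q = q_F. The zeros are the points of L (`mem_zeroSet_iff`).

If χ|² ≠ 1, the multiple never vanishes. Tested on a long box it becomes a nonzero multiple of the
integral of P(x + α) over |x| ≤ R, where P is a ramified multiplicative function on E. Were these
integrals zero for all large R, then integrating fibre by fibre would annihilate a Gauss integral of
P against an additive character of x₂, and such Gauss integrals are nonzero by Fourier inversion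
(`IsRamifiedChar.exists_setIntegral_ne_zero`). -/

namespace SymBreak

noncomputable section

open Topology

set_option linter.unusedSectionVars false

/-! ### The normalized absolute value of a local field and its topology. -/

section LocalField

variable {K : Type*} [Field K] [ValuativeRel K] [TopologicalSpace K]
  [IsNonarchimedeanLocalField K]

lemma one_lt_resCard : 1 < resCard K := Finite.one_lt_card

lemma one_lt_resCard_real : (1 : ℝ) < resCard K := by exact_mod_cast one_lt_resCard

lemma resCard_pos_real : (0 : ℝ) < resCard K := zero_lt_one.trans one_lt_resCard_real

lemma valueIso_ne_zero {x : K} (hx : x ≠ 0) :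
    IsNonarchimedeanLocalField.valueGroupWithZeroIsoInt K (valuation K x) ≠ 0 := by
  simpa using hx

lemma ord_mul {x y : K} (hx : x ≠ 0) (hy : y ≠ 0) : ord (x * y) = ord x + ord y := by
  rw [ord, map_mul, map_mul, WithZero.log_mul (valueIso_ne_zero hx) (valueIso_ne_zero hy)]
  simp only [ord]; ring

lemma ord_one : ord (1 : K) = 0 := by simp [ord]

lemma ord_zero : ord (0 : K) = 0 := by simp [ord]

lemma ord_le_ord_iff {x y : K} (hx : x ≠ 0) (hy : y ≠ 0) :
    ord x ≤ ord y ↔ valuation K y ≤ valuation K x := by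
  rw [ord, ord, neg_le_neg_iff, WithZero.log_le_log (valueIso_ne_zero hy) (valueIso_ne_zero hx),
    map_le_map_iff]

lemma absv_zero : absv (0 : K) = 0 := by simp [absv]

lemma absv_of_ne_zero {x : K} (hx : x ≠ 0) : absv x = (resCard K : ℝ) ^ (-ord x) := by
  simp [absv, hx]

lemma absv_pos {x : K} (hx : x ≠ 0) : 0 < absv x := by
  rw [absv_of_ne_zero hx]; exact zpow_pos resCard_pos_real _

lemma absv_nonneg (x : K) : 0 ≤ absv x := by
  by_cases hx : x = 0
  · simp [hx, absv_zero]
  · exact (absv_pos hx).le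

lemma absv_eq_zero {x : K} : absv x = 0 ↔ x = 0 :=
  ⟨fun h => by_contra fun hx => (absv_pos hx).ne' h, fun h => by simp [h, absv_zero]⟩

lemma absv_mul (x y : K) : absv (x * y) = absv x * absv y := by
  by_cases hx : x = 0
  · simp [hx, absv_zero]
  by_cases hy : y = 0
  · simp [hy, absv_zero]
  rw [absv_of_ne_zero hx, absv_of_ne_zero hy, absv_of_ne_zero (mul_ne_zero hx hy), ord_mul hx hy,
    neg_add, zpow_add₀ resCard_pos_real.ne']

lemma absv_one : absv (1 : K) = 1 := by simp [absv, ord_one]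

variable (K) in
/-- The normalized absolute value as a homomorphism. -/
def absvHom : K →*₀ ℝ where
  toFun := absv
  map_zero' := absv_zero
  map_one' := absv_one
  map_mul' := absv_mul

lemma absv_inv (x : K) : absv x⁻¹ = (absv x)⁻¹ := map_inv₀ (absvHom K) x

lemma absv_div (x y : K) : absv (x / y) = absv x / absv y := map_div₀ (absvHom K) x y

lemma absv_pow (x : K) (n : ℕ) : absv (x ^ n) = absv x ^ n := map_pow (absvHom K) x n

lemma absv_zpow (x : K) (n : ℤ) : absv (x ^ n) = absv x ^ n := map_zpow₀ (absvHom K) x n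

lemma absv_le_absv_iff {x y : K} : absv x ≤ absv y ↔ valuation K x ≤ valuation K y := by
  by_cases hx : x = 0
  · simp [hx, absv_zero, absv_nonneg]
  by_cases hy : y = 0
  · subst hy
    simp only [absv_zero, map_zero, le_zero_iff, map_eq_zero, hx, iff_false, not_le]
    exact absv_pos hx
  rw [absv_of_ne_zero hx, absv_of_ne_zero hy, zpow_le_zpow_iff_right₀ one_lt_resCard_real,
    neg_le_neg_iff, ord_le_ord_iff hy hx]

lemma absv_lt_absv_iff {x y : K} : absv x < absv y ↔ valuation K x < valuation K y :=
  lt_iff_lt_of_le_iff_le absv_le_absv_iff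

lemma absv_neg (x : K) : absv (-x) = absv x :=
  le_antisymm (absv_le_absv_iff.2 (Valuation.map_neg _ x).le)
    (absv_le_absv_iff.2 (Valuation.map_neg _ x).ge)

lemma absv_add_le (x y : K) : absv (x + y) ≤ max (absv x) (absv y) := by
  rcases Valuation.map_add' (valuation K) x y with h | h
  · exact (absv_le_absv_iff.2 h).trans (le_max_left _ _)
  · exact (absv_le_absv_iff.2 h).trans (le_max_right _ _)

lemma absv_sub_le (x y : K) : absv (x - y) ≤ max (absv x) (absv y) := by
  simpa [sub_eq_add_neg, absv_neg] using absv_add_le x (-y)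

lemma absv_sub_comm (x y : K) : absv (x - y) = absv (y - x) := by rw [← absv_neg, neg_sub]

lemma absv_eq_of_sub_lt {x y : K} (h : absv (y - x) < absv x) : absv y = absv x := by
  apply le_antisymm
  · simpa [h.le] using absv_add_le (y - x) x
  · by_contra! h2
    have := absv_sub_le y (y - x)
    rw [sub_sub_cancel] at this
    exact absurd this (not_le.2 (max_lt h2 h))

lemma absv_add_eq_max {x y : K} (h : absv x ≠ absv y) :
    absv (x + y) = max (absv x) (absv y) := by
  rcases lt_or_gt_of_ne h with h | h
  · rw [max_eq_right h.le]
    exact absv_eq_of_sub_lt (by simpa using h)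
  · rw [max_eq_left h.le]
    exact absv_eq_of_sub_lt (by simpa using h)

lemma mem_integer_iff_absv {x : K} : x ∈ 𝒪[K] ↔ absv x ≤ 1 := by
  rw [← absv_one (K := K), absv_le_absv_iff, map_one]; rfl

lemma absv_integer_le (x : 𝒪[K]) : absv (x : K) ≤ 1 := mem_integer_iff_absv.1 x.2

lemma isUnit_integer_iff {x : 𝒪[K]} : IsUnit x ↔ absv (x : K) = 1 := by
  constructor
  · rintro ⟨u, rfl⟩
    have h : absv ((u : 𝒪[K]) : K) * absv ((↑u⁻¹ : 𝒪[K]) : K) = 1 := by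
      rw [← absv_mul, ← absv_one (K := K)]
      congr 1
      exact_mod_cast congrArg Subtype.val u.mul_inv
    nlinarith [absv_integer_le (u : 𝒪[K]), absv_integer_le (↑u⁻¹ : 𝒪[K]),
      absv_nonneg ((u : 𝒪[K]) : K), absv_nonneg ((↑u⁻¹ : 𝒪[K]) : K)]
  · intro h
    have h0 : (x : K) ≠ 0 := fun h0 => by simp [h0, absv_zero] at h
    have h1 : absv (x : K)⁻¹ ≤ 1 := by rw [absv_inv, h, inv_one]
    exact IsUnit.of_mul_eq_one ⟨(x : K)⁻¹, mem_integer_iff_absv.2 h1⟩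
      (Subtype.ext (mul_inv_cancel₀ h0))

lemma absv_unit (u : 𝒪[K]ˣ) : absv ((u : 𝒪[K]) : K) = 1 := isUnit_integer_iff.1 u.isUnit

lemma exists_unit_eq {y : K} (hy : absv y = 1) : ∃ u : 𝒪[K]ˣ, ((u : 𝒪[K]) : K) = y := by
  obtain ⟨u, hu⟩ := isUnit_integer_iff (x := (⟨y, mem_integer_iff_absv.2 hy.le⟩ : 𝒪[K])).2 hy
  exact ⟨u, by rw [hu]⟩

lemma ord_eq_zero_iff {x : K} (hx : x ≠ 0) : ord x = 0 ↔ absv x = 1 := by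
  rw [absv_of_ne_zero hx]
  constructor
  · intro h; simp [h]
  · intro h
    have := (zpow_eq_one_iff_right₀ resCard_pos_real.le one_lt_resCard_real.ne').1 h
    omega

/-- `ord` comes from an abstract isomorphism of the value group with ℤ, so some y has order 1. It is
a nonunit, hence a multiple of ϖ, and nonnegativity of orders leaves no other value for ϖ. -/
lemma ord_uniformizer {ϖ : 𝒪[K]} (hϖ : Irreducible ϖ) : ord (ϖ : K) = 1 := by
  have h0 : (ϖ : K) ≠ 0 := by
    simpa using hϖ.ne_zero
  obtain ⟨y, hy⟩ := valuation_surjective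
    ((IsNonarchimedeanLocalField.valueGroupWithZeroIsoInt K).symm (WithZero.exp (-1 : ℤ)))
  have hy1 : ord y = 1 := by simp [ord, hy]
  have hy0 : y ≠ 0 := fun h => by simp [h, ord_zero] at hy1
  have ey : absv y = (resCard K : ℝ)⁻¹ := by rw [absv_of_ne_zero hy0, hy1]; simp
  have hq := one_lt_resCard_real (K := K)
  have hylt : absv y < 1 := by rw [ey]; exact inv_lt_one_of_one_lt₀ hq
  let Y : 𝒪[K] := ⟨y, mem_integer_iff_absv.2 hylt.le⟩
  have hmem : Y ∈ IsLocalRing.maximalIdeal 𝒪[K] := by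
    rw [IsLocalRing.mem_maximalIdeal, mem_nonunits_iff, isUnit_integer_iff]
    exact hylt.ne
  rw [hϖ.maximalIdeal_eq, Ideal.mem_span_singleton] at hmem
  obtain ⟨z, hz⟩ := hmem
  have hyz : y = (ϖ : K) * z := congrArg Subtype.val hz
  have hz0 : (z : K) ≠ 0 := fun h => hy0 (by simp [hyz, h])
  have h1 := ord_mul h0 hz0
  rw [← hyz, hy1] at h1
  have hn : ∀ w : 𝒪[K], (w : K) ≠ 0 → 0 ≤ ord (w : K) := fun w hw => by
    by_contra! h
    have := absv_integer_le w
    rw [absv_of_ne_zero hw] at this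
    exact absurd this (not_le.2 (one_lt_zpow₀ hq (by omega)))
  have hne : ord (ϖ : K) ≠ 0 := fun h =>
    hϖ.not_isUnit (isUnit_integer_iff.2 ((ord_eq_zero_iff h0).1 h))
  have := hn z hz0
  have := hn ϖ h0
  omega


lemma uniformizer_ne_zero {ϖ : 𝒪[K]} (hϖ : Irreducible ϖ) : (ϖ : K) ≠ 0 := by
  simpa using hϖ.ne_zero

lemma absv_uniformizer {ϖ : 𝒪[K]} (hϖ : Irreducible ϖ) : absv (ϖ : K) = (resCard K : ℝ)⁻¹ := by
  rw [absv_of_ne_zero (uniformizer_ne_zero hϖ), ord_uniformizer hϖ]; simp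

lemma absv_uniformizer_zpow {ϖ : 𝒪[K]} (hϖ : Irreducible ϖ) (n : ℤ) :
    absv ((ϖ : K) ^ n) = (resCard K : ℝ) ^ (-n) := by
  rw [absv_zpow, absv_uniformizer hϖ, inv_zpow, zpow_neg]

/-- Discreteness of the value group: no absolute value lies strictly between consecutive powers of
q. This is what turns strict inequalities into non-strict ones later on. -/
lemma absv_le_zpow_or {x : K} {n : ℤ} (h : (resCard K : ℝ) ^ n < absv x) :
    (resCard K : ℝ) ^ (n + 1) ≤ absv x := by
  have hx : x ≠ 0 := fun h0 => by
    rw [h0, absv_zero] at h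
    exact absurd h (not_lt.2 (zpow_pos resCard_pos_real _).le)
  rw [absv_of_ne_zero hx] at h ⊢
  rw [zpow_lt_zpow_iff_right₀ one_lt_resCard_real] at h
  exact zpow_le_zpow_right₀ one_lt_resCard_real.le (by omega)

lemma absv_lt_one_iff {x : K} : absv x < 1 ↔ absv x ≤ (resCard K : ℝ)⁻¹ := by
  constructor
  · intro h
    by_contra! h2
    have := absv_le_zpow_or (x := x) (n := -1) (by simpa using h2)
    norm_num at this
    linarith
  · intro h
    exact h.trans_lt (inv_lt_one_of_one_lt₀ one_lt_resCard_real)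

lemma absv_unit_part {ϖ : 𝒪[K]} (hϖ : Irreducible ϖ) {x : K} (hx : x ≠ 0) :
    absv ((ϖ : K) ^ (-ord x) * x) = 1 := by
  rw [absv_mul, absv_uniformizer_zpow hϖ, absv_of_ne_zero hx, ← zpow_add₀ resCard_pos_real.ne']
  simp

/-! ### Topology -/

lemma hasBasis_nhds_zero_absv :
    (𝓝 (0 : K)).HasBasis (fun _ : ℤ => True) fun n => {x | absv x ≤ (resCard K : ℝ) ^ (-n)} := by
  obtain ⟨ϖ, hϖ⟩ := IsDiscreteValuationRing.exists_irreducible 𝒪[K]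
  refine (IsValuativeTopology.hasBasis_nhds_zero' K).to_hasBasis ?_ ?_
  · intro γ hγ
    obtain ⟨r, rfl⟩ := valuation_surjective γ
    have hr : r ≠ 0 := by simpa using hγ
    refine ⟨ord r + 1, trivial, fun x hx => absv_lt_absv_iff.1 (lt_of_le_of_lt hx ?_)⟩
    rw [absv_of_ne_zero hr]
    exact zpow_lt_zpow_right₀ one_lt_resCard_real (by omega)
  · intro n _
    refine ⟨valuation K ((ϖ : K) ^ n), ?_, fun x hx => ?_⟩
    · exact (map_ne_zero _).2 (zpow_ne_zero n (uniformizer_ne_zero hϖ))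
    · have := (absv_lt_absv_iff.2 hx).le
      rwa [absv_uniformizer_zpow hϖ] at this

lemma hasBasis_nhds_absv (a : K) :
    (𝓝 a).HasBasis (fun _ : ℤ => True)
      fun n => {x | absv (x - a) ≤ (resCard K : ℝ) ^ (-n)} := by
  have h : 𝓝 a = Filter.comap (fun x => x - a) (𝓝 0) := by
    have := (Homeomorph.subRight a).isInducing.nhds_eq_comap a
    simpa using this
  rw [h]
  exact hasBasis_nhds_zero_absv.comap _

lemma eventually_absv_sub_lt (a : K) {r : ℝ} (hr : 0 < r) : ∀ᶠ x in 𝓝 a, absv (x - a) < r := by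
  obtain ⟨n, hn⟩ := exists_pow_lt_of_lt_one hr
    (inv_lt_one_of_one_lt₀ (one_lt_resCard_real (K := K)))
  filter_upwards [(hasBasis_nhds_absv a).mem_of_mem (i := (n : ℤ)) trivial] with x hx
  refine lt_of_le_of_lt hx ?_
  simpa using hn

lemma isLocallyConstant_of_absv {Y : Type*} {f : K → Y} (h : ∀ x, ∃ r > 0, ∀ y,
    absv (y - x) < r → f y = f x) : IsLocallyConstant f := by
  rw [IsLocallyConstant.iff_eventually_eq]
  intro x
  obtain ⟨r, hr, H⟩ := h x
  filter_upwards [eventually_absv_sub_lt x hr] with y hy using H y hy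

lemma eventually_absv_eq {a : K} (ha : a ≠ 0) : ∀ᶠ x in 𝓝 a, absv x = absv a := by
  filter_upwards [eventually_absv_sub_lt a (absv_pos ha)] with x hx
  exact absv_eq_of_sub_lt hx

lemma isClopen_absv_sub_le (a : K) {r : ℝ} (hr : 0 < r) : IsClopen {x : K | absv (x - a) ≤ r} := by
  have : IsLocallyConstant fun x : K => absv (x - a) ≤ r := by
    refine isLocallyConstant_of_absv fun x => ⟨r, hr, fun y hy => ?_⟩
    rw [eq_iff_iff]
    constructor
    · intro h
      have := absv_sub_le (y - a) (y - x)
      rw [sub_sub_sub_cancel_left] at this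
      exact this.trans (max_le h hy.le)
    · intro h
      have := absv_add_le (y - x) (x - a)
      rw [sub_add_sub_cancel] at this
      exact this.trans (max_le hy.le h)
  simpa using this.isClopen_fiber True

lemma isClopen_absv_le {r : ℝ} (hr : 0 < r) : IsClopen {x : K | absv x ≤ r} := by
  simpa using isClopen_absv_sub_le (0 : K) hr

lemma isClopen_absv_eq {r : ℝ} (hr : 0 < r) : IsClopen {x : K | absv x = r} := by
  have : IsLocallyConstant fun x : K => absv x = r := by
    refine isLocallyConstant_of_absv fun x => ?_
    by_cases hx : x = 0
    · refine ⟨r, hr, fun y hy => ?_⟩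
      subst hx
      rw [sub_zero] at hy
      simp [absv_zero, hy.ne, hr.ne]
    · exact ⟨absv x, absv_pos hx, fun y hy => by rw [absv_eq_of_sub_lt hy]⟩
  simpa using this.isClopen_fiber True

lemma isClosed_absv_le (r : ℝ) : IsClosed {x : K | absv x ≤ r} := by
  rcases lt_trichotomy r 0 with h | h | h
  · convert! isClosed_empty
    ext x
    simpa using lt_of_lt_of_le h (absv_nonneg x)
  · have : {x : K | absv x ≤ r} = ⋂ n : ℕ, {x : K | absv x ≤ (resCard K : ℝ)⁻¹ ^ n} := by
      ext x
      simp only [Set.mem_ofPred_eq, Set.mem_iInter, h]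
      refine ⟨fun h n => h.trans (by positivity), fun h => ?_⟩
      exact ge_of_tendsto' (tendsto_pow_atTop_nhds_zero_of_lt_one
        (by positivity) (inv_lt_one_of_one_lt₀ (one_lt_resCard_real (K := K)))) h
    rw [this]
    exact isClosed_iInter fun n =>
      (isClopen_absv_le (pow_pos (inv_pos.2 resCard_pos_real) n)).isClosed
  · exact (isClopen_absv_le h).isClosed

lemma isCompact_absv_le (r : ℝ) : IsCompact {x : K | absv x ≤ r} := by
  obtain ⟨ϖ, hϖ⟩ := IsDiscreteValuationRing.exists_irreducible 𝒪[K]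
  obtain ⟨n, hn⟩ := pow_unbounded_of_one_lt (max r 1) (one_lt_resCard_real (K := K))
  have h1 := IsNonarchimedeanLocalField.isCompact_closedBall K (valuation K ((ϖ : K) ^ (-n : ℤ)))
  refine h1.of_isClosed_subset (isClosed_absv_le r) fun x hx => absv_le_absv_iff.1 ?_
  rw [absv_uniformizer_zpow hϖ]
  simpa using (show absv x ≤ r from hx).trans ((le_max_left r 1).trans hn.le)

lemma isCompact_absv_sub_le (a : K) (r : ℝ) : IsCompact {x : K | absv (x - a) ≤ r} := by
  have := (isCompact_absv_le (K := K) r).image (Homeomorph.addRight a).continuous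
  convert! this
  ext x
  simp only [Set.mem_ofPred_eq, Homeomorph.coe_addRight, Set.mem_image]
  exact ⟨fun h => ⟨x - a, h, by simp⟩, by rintro ⟨y, hy, rfl⟩; simpa using hy⟩

instance : T2Space K := by
  have : T1Space K := by
    have h0 : IsClosed ({0} : Set K) := by
      convert! isClosed_absv_le (K := K) 0
      ext x
      simp only [Set.mem_singleton_iff, Set.mem_ofPred_eq, ← absv_eq_zero]
      exact ⟨fun h => h.le, fun h => le_antisymm h (absv_nonneg x)⟩
    refine ⟨fun a => ?_⟩
    have := h0.preimage (f := fun x => x - a) (by fun_prop)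
    convert! this
    ext x
    simp [sub_eq_zero]
  infer_instance

end LocalField

/-! ### Countability, and quasi-characters of the multiplicative group. -/

section LocalField

variable {K : Type*} [Field K] [ValuativeRel K] [TopologicalSpace K]
  [IsNonarchimedeanLocalField K]

instance : SigmaCompactSpace K := by
  refine ⟨⟨fun n => {x : K | absv x ≤ n}, fun n => isCompact_absv_le _, ?_⟩⟩
  ext x
  simpa using exists_nat_ge (absv x)

instance : SecondCountableTopology K := by
  let := IsTopologicalAddGroup.rightUniformSpace K
  have := isUniformAddGroup_of_addCommGroup (G := K)
  have : (uniformity K).IsCountablyGenerated := by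
    have := (hasBasis_nhds_zero_absv (K := K)).isCountablyGenerated
    exact IsUniformAddGroup.uniformity_countably_generated
  have : TopologicalSpace.MetrizableSpace K := UniformSpace.metrizableSpace
  let := TopologicalSpace.metrizableSpaceMetric K
  exact EMetric.secondCountable_of_sigmaCompact K

instance : CompactSpace 𝒪[K]ˣ :=
  Units.isClosedEmbedding_embedProduct.compactSpace

/-! ### Characters -/

lemma unitExt_unit (χ : UnitChar K) (u : 𝒪[K]ˣ) : unitExt χ ((u : 𝒪[K]) : K) = χ u := by
  have h : ∃ v : 𝒪[K]ˣ, ((v : 𝒪[K]) : K) = ((u : 𝒪[K]) : K) := ⟨u, rfl⟩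
  rw [unitExt, dif_pos h]
  have : h.choose = u := Units.ext (Subtype.ext h.choose_spec)
  rw [this]

lemma unitExt_eq_zero (χ : UnitChar K) {y : K} (hy : absv y ≠ 1) : unitExt χ y = 0 := by
  rw [unitExt, dif_neg]
  rintro ⟨u, rfl⟩
  exact hy (absv_unit u)

lemma unitExt_mul (χ : UnitChar K) {x y : K} (hx : absv x = 1) (hy : absv y = 1) :
    unitExt χ (x * y) = unitExt χ x * unitExt χ y := by
  obtain ⟨u, rfl⟩ := exists_unit_eq hx
  obtain ⟨v, rfl⟩ := exists_unit_eq hy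
  have := unitExt_unit χ (u * v)
  rw [map_mul] at this
  push_cast at this
  rw [this, unitExt_unit, unitExt_unit]

lemma norm_unitExt (χ : UnitChar K) {x : K} (hx : absv x = 1) : ‖unitExt χ x‖ = 1 := by
  obtain ⟨u, rfl⟩ := exists_unit_eq hx
  rw [unitExt_unit]
  exact Circle.norm_coe _

lemma unitExt_mul_char (χ η : UnitChar K) (x : K) :
    unitExt (χ * η) x = unitExt χ x * unitExt η x := by
  by_cases hx : absv x = 1
  · obtain ⟨u, rfl⟩ := exists_unit_eq hx
    rw [unitExt_unit, unitExt_unit, unitExt_unit]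
    rw [← Circle.coe_mul]; rfl
  · simp [unitExt_eq_zero _ hx]

lemma unitExt_one_char {x : K} (hx : absv x = 1) : unitExt (1 : UnitChar K) x = 1 := by
  obtain ⟨u, rfl⟩ := exists_unit_eq hx
  rw [unitExt_unit]; simp

lemma multChar_zero (ϖ : 𝒪[K]) (χ : UnitChar K) (s : ℂ) : multChar ϖ χ s 0 = 0 := by
  rw [multChar, mul_zero, unitExt_eq_zero _ (by simp [absv_zero]), zero_mul]

lemma multChar_mul {ϖ : 𝒪[K]} (hϖ : Irreducible ϖ) (χ : UnitChar K) (s : ℂ) (x y : K) :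
    multChar ϖ χ s (x * y) = multChar ϖ χ s x * multChar ϖ χ s y := by
  by_cases hx : x = 0
  · simp [hx, multChar_zero]
  by_cases hy : y = 0
  · simp [hy, multChar_zero]
  have h : (ϖ : K) ^ (-ord (x * y)) * (x * y) =
      ((ϖ : K) ^ (-ord x) * x) * ((ϖ : K) ^ (-ord y) * y) := by
    rw [ord_mul hx hy, neg_add, zpow_add₀ (uniformizer_ne_zero hϖ)]
    ring
  rw [multChar, h, unitExt_mul _ (absv_unit_part hϖ hx) (absv_unit_part hϖ hy), absv_mul,
    Complex.ofReal_mul, Complex.mul_cpow_ofReal_nonneg (absv_nonneg _) (absv_nonneg _), multChar,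
    multChar]
  ring

lemma multChar_one {ϖ : 𝒪[K]} (χ : UnitChar K) (s : ℂ) : multChar ϖ χ s 1 = 1 := by
  have := unitExt_unit χ 1
  rw [map_one] at this
  simpa [multChar, ord_one, absv_one] using this

/-- The quasi-character `multChar ϖ χ s` as a homomorphism. -/
def multCharHom {ϖ : 𝒪[K]} (hϖ : Irreducible ϖ) (χ : UnitChar K) (s : ℂ) : K →*₀ ℂ where
  toFun := multChar ϖ χ s
  map_zero' := multChar_zero ϖ χ s
  map_one' := multChar_one χ s
  map_mul' := multChar_mul hϖ χ s

lemma multChar_inv {ϖ : 𝒪[K]} (hϖ : Irreducible ϖ) (χ : UnitChar K) (s : ℂ) (x : K) :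
    multChar ϖ χ s x⁻¹ = (multChar ϖ χ s x)⁻¹ := map_inv₀ (multCharHom hϖ χ s) x

lemma multChar_pow {ϖ : 𝒪[K]} (hϖ : Irreducible ϖ) (χ : UnitChar K) (s : ℂ) (x : K) (n : ℕ) :
    multChar ϖ χ s (x ^ n) = multChar ϖ χ s x ^ n := map_pow (multCharHom hϖ χ s) x n

lemma multChar_ne_zero {ϖ : 𝒪[K]} (hϖ : Irreducible ϖ) (χ : UnitChar K) (s : ℂ) {x : K}
    (hx : x ≠ 0) : multChar ϖ χ s x ≠ 0 := (map_ne_zero (multCharHom hϖ χ s)).2 hx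

lemma norm_multChar {ϖ : 𝒪[K]} (hϖ : Irreducible ϖ) (χ : UnitChar K) (s : ℂ) {x : K}
    (hx : x ≠ 0) : ‖multChar ϖ χ s x‖ = absv x ^ s.re := by
  rw [multChar, norm_mul, norm_unitExt _ (absv_unit_part hϖ hx), one_mul,
    Complex.norm_cpow_eq_rpow_re_of_pos (absv_pos hx)]

lemma multChar_mul_multChar (ϖ : 𝒪[K]) (χ η : UnitChar K) (s t : ℂ) {x : K} (hx : x ≠ 0) :
    multChar ϖ χ s x * multChar ϖ η t x = multChar ϖ (χ * η) (s + t) x := by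
  have : ((absv x : ℝ) : ℂ) ≠ 0 := by exact_mod_cast (absv_pos hx).ne'
  rw [multChar, multChar, multChar, unitExt_mul_char, Complex.cpow_add _ _ this]
  ring

lemma multChar_one_char {ϖ : 𝒪[K]} (hϖ : Irreducible ϖ) (s : ℂ) {x : K} (hx : x ≠ 0) :
    multChar ϖ 1 s x = (absv x : ℂ) ^ s := by
  rw [multChar, unitExt_one_char (absv_unit_part hϖ hx), one_mul]

lemma multChar_of_absv_one (ϖ : 𝒪[K]) (χ : UnitChar K) (s : ℂ) {x : K} (hx : absv x = 1) :
    multChar ϖ χ s x = unitExt χ x := by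
  have h0 : x ≠ 0 := fun h => by simp [h, absv_zero] at hx
  rw [multChar, (ord_eq_zero_iff h0).2 hx, hx]; simp

/-- A character of the units is trivial near `1`. -/
lemma exists_conductor (χ : UnitChar K) : ∃ m : ℕ, 1 ≤ m ∧ ∀ x : K,
    absv (x - 1) ≤ (resCard K : ℝ) ^ (-(m : ℤ)) → unitExt χ x = 1 := by
  have hq := one_lt_resCard_real (K := K)
  have hone : ∀ m : ℕ, 1 ≤ m → (resCard K : ℝ) ^ (-(m : ℤ)) < 1 := fun m hm =>
    zpow_lt_one_of_neg₀ hq (by omega)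
  have hab : ∀ m : ℕ, 1 ≤ m → ∀ x : K, absv (x - 1) ≤ (resCard K : ℝ) ^ (-(m : ℤ)) →
      absv x = 1 := fun m hm x hx => by
    rw [← absv_one (K := K)]
    refine absv_eq_of_sub_lt ?_
    rw [absv_one]
    exact hx.trans_lt (hone m hm)
  -- This arc about 1 contains no nontrivial subgroup of the circle, so it suffices that all powers
  -- of u stay in a neighbourhood of 1 which χ maps into the arc.
  have hV : {u : 𝒪[K]ˣ | χ u ∈ Circle.centeredArc (Real.pi / 2)} ∈ 𝓝 (1 : 𝒪[K]ˣ) := by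
    refine (map_continuous χ).continuousAt.preimage_mem_nhds ?_
    rw [map_one]
    refine (Circle.isOpen_centeredArc _).mem_nhds ?_
    rw [Circle.mem_centeredArc (by linarith [Real.pi_pos])]
    simp [Real.pi_pos]
  -- The topology of the units is induced by u and u⁻¹ jointly, so closeness of the inverse to 1 has
  -- to be checked as well.
  have hind : Topology.IsInducing (fun u : 𝒪[K]ˣ => (((u : 𝒪[K]) : K), ((↑u⁻¹ : 𝒪[K]) : K))) := by
    refine (Topology.IsInducing.subtypeVal.prodMap Topology.IsInducing.subtypeVal).comp
      (g := Prod.map ((↑) : 𝒪[K] → K) ((↑) : 𝒪[K] → K))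
      (f := fun u : 𝒪[K]ˣ => ((u : 𝒪[K]), (↑u⁻¹ : 𝒪[K]))) ?_
    exact ((Homeomorph.refl 𝒪[K]).prodCongr MulOpposite.opHomeomorph.symm).isInducing.comp
      Units.isEmbedding_embedProduct.isInducing
  rw [hind.nhds_eq_comap, Filter.mem_comap] at hV
  obtain ⟨t, ht, htV⟩ := hV
  rw [nhds_prod_eq] at ht
  simp only [Units.val_one, OneMemClass.coe_one, inv_one] at ht
  obtain ⟨⟨n, n'⟩, -, hn⟩ :=
    ((hasBasis_nhds_absv (1 : K)).prod (hasBasis_nhds_absv (1 : K))).mem_iff.1 ht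
  obtain ⟨m, hm⟩ : ∃ m : ℕ, 1 ≤ m ∧ n ≤ m ∧ n' ≤ m :=
    ⟨max 1 (max n.toNat n'.toNat), by omega, by omega, by omega⟩
  refine ⟨m, hm.1, fun x hx => ?_⟩
  obtain ⟨u, rfl⟩ := exists_unit_eq (hab m hm.1 x hx)
  have key : ∀ v : 𝒪[K]ˣ, absv (((v : 𝒪[K]) : K) - 1) ≤ (resCard K : ℝ) ^ (-(m : ℤ)) →
      χ v ∈ Circle.centeredArc (Real.pi / 2) := by
    intro v hv
    refine htV (hn ⟨hv.trans (zpow_le_zpow_right₀ hq.le (by omega)), ?_⟩)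
    refine le_trans ?_ (hv.trans (zpow_le_zpow_right₀ hq.le (show -(m : ℤ) ≤ -n' by omega)))
    have e : ((↑v⁻¹ : 𝒪[K]) : K) - 1 = ((↑v⁻¹ : 𝒪[K]) : K) * (1 - ((v : 𝒪[K]) : K)) := by
      rw [mul_sub, mul_one]
      congr 1
      exact_mod_cast (congrArg Subtype.val v.inv_mul).symm
    simp only [e]
    rw [absv_mul, absv_unit, one_mul, absv_sub_comm]
  have hpow : ∀ k : ℕ, absv ((((u ^ k : 𝒪[K]ˣ) : 𝒪[K]) : K) - 1) ≤
      (resCard K : ℝ) ^ (-(m : ℤ)) := by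
    intro k
    induction k with
    | zero => simp [absv_zero]
    | succ k ih =>
      have e : (((u ^ (k + 1) : 𝒪[K]ˣ) : 𝒪[K]) : K) - 1 =
          ((u ^ k : 𝒪[K]ˣ) : 𝒪[K]) * (((u : 𝒪[K]) : K) - 1) +
            ((((u ^ k : 𝒪[K]ˣ) : 𝒪[K]) : K) - 1) := by
        push_cast; ring
      rw [e]
      refine (absv_add_le _ _).trans (max_le ?_ ih)
      rw [absv_mul, absv_unit, one_mul]
      exact hx
  rw [unitExt_unit, Circle.eq_one_of_forall_pow_mem_centeredArc_pi_div_two (z := χ u)]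
  · simp
  · intro k _
    rw [← map_pow]
    exact key _ (hpow k)

/-- A quasi-character is invariant under small relative perturbations, uniformly in `s`. -/
lemma exists_multChar_add_eq {ϖ : 𝒪[K]} (hϖ : Irreducible ϖ) (χ : UnitChar K) :
    ∃ r : ℝ, 0 < r ∧ r < 1 ∧ ∀ (s : ℂ) (x v : K), absv v ≤ r * absv x →
      multChar ϖ χ s (x + v) = multChar ϖ χ s x := by
  obtain ⟨m, hm, H⟩ := exists_conductor χ
  refine ⟨(resCard K : ℝ) ^ (-(m : ℤ)), zpow_pos resCard_pos_real _,
    zpow_lt_one_of_neg₀ one_lt_resCard_real (by omega), fun s x v h => ?_⟩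
  by_cases hx : x = 0
  · subst hx
    rw [absv_zero, mul_zero] at h
    rw [absv_eq_zero.1 (le_antisymm h (absv_nonneg v)), add_zero]
  have hx' := absv_pos hx
  have h1 : absv ((1 + v / x) - 1) ≤ (resCard K : ℝ) ^ (-(m : ℤ)) := by
    rw [add_sub_cancel_left, absv_div]
    exact (div_le_iff₀ hx').2 h
  have h2 : absv (1 + v / x) = 1 := by
    rw [← absv_one (K := K)]
    refine absv_eq_of_sub_lt (h1.trans_lt ?_)
    rw [absv_one]
    exact zpow_lt_one_of_neg₀ one_lt_resCard_real (by omega)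
  have e : x + v = x * (1 + v / x) := by field_simp
  rw [e, multChar_mul hϖ, multChar_of_absv_one _ _ _ h2, H _ h1, mul_one]

lemma eventually_multChar_eq {ϖ : 𝒪[K]} (hϖ : Irreducible ϖ) (χ : UnitChar K) {x : K}
    (hx : x ≠ 0) : ∀ᶠ y in 𝓝 x, ∀ s, multChar ϖ χ s y = multChar ϖ χ s x := by
  obtain ⟨r, hr, -, H⟩ := exists_multChar_add_eq hϖ χ
  filter_upwards [eventually_absv_sub_lt x (mul_pos hr (absv_pos hx))] with y hy s
  have := H s x (y - x) hy.le
  rwa [add_sub_cancel] at this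

lemma differentiable_multChar (ϖ : 𝒪[K]) (χ : UnitChar K) (x : K) :
    Differentiable ℂ fun s => multChar ϖ χ s x := by
  by_cases hx : x = 0
  · simp only [hx, multChar_zero]; fun_prop
  · have h : ((absv x : ℝ) : ℂ) ≠ 0 := by exact_mod_cast (absv_pos hx).ne'
    unfold multChar
    intro s
    exact (differentiableAt_id.const_cpow (Or.inl h)).const_mul _

/-- The inverse `L`-factor is obtained from the value of the quasi-character at one point. -/
lemma exists_inv_localL_eq {ϖ : 𝒪[K]} (hϖ : Irreducible ϖ) (ξ : UnitChar K) :
    ∃ (l : K) (c : ℂ), l ≠ 0 ∧ c ≠ 0 ∧ (ξ = 1 → l = ϖ ∧ c = 1) ∧ (ξ ≠ 1 → absv l = 1) ∧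
      ∀ z r : ℂ, (localL z ξ r)⁻¹ = c * (1 - multChar ϖ ξ (z + r) l) := by
  by_cases h : ξ = 1
  · refine ⟨ϖ, 1, uniformizer_ne_zero hϖ, one_ne_zero, fun _ => ⟨rfl, rfl⟩, fun h' => absurd h h',
      fun z r => ?_⟩
    rw [localL, if_pos h, inv_inv, one_mul, h, multChar_one_char hϖ _ (uniformizer_ne_zero hϖ),
      absv_uniformizer hϖ]
    push_cast
    rw [← Complex.cpow_neg_one, ← Complex.ofReal_natCast,
      ← Complex.ofReal_one, ← Complex.ofReal_neg, ← Complex.ofReal_cpow (Nat.cast_nonneg _),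
      Complex.ofReal_cpow (Nat.cast_nonneg _)]
    congr 1
    have hq : ((resCard K : ℝ) : ℂ) ≠ 0 := by exact_mod_cast resCard_pos_real.ne'
    rw [Complex.cpow_def_of_ne_zero hq, Complex.cpow_def_of_ne_zero, Complex.cpow_def_of_ne_zero hq]
    · rw [← Complex.ofReal_log (Nat.cast_nonneg _), ← Complex.ofReal_mul, ← Complex.ofReal_exp,
        ← Complex.ofReal_log (Real.exp_pos _).le, Real.log_exp]
      push_cast
      congr 1
      ring
    · exact (Complex.cpow_ne_zero_iff_of_exponent_ne_zero (by simp)).2 hq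
  -- Here the L-factor is 1; a unit u with ξ(u) ≠ 1 and c = (1 - ξ(u))⁻¹ give it the same shape as
  -- in the case ξ = 1, so that one regularization serves both.
  · obtain ⟨u, hu⟩ : ∃ u, ξ u ≠ 1 := by
      by_contra! h'
      exact h (PontryaginDual.ext h')
    have hne : (1 : ℂ) - ξ u ≠ 0 := fun h0 => hu (by
      rw [sub_eq_zero] at h0
      exact (Circle.coe_eq_one.1 h0.symm))
    refine ⟨((u : 𝒪[K]) : K), (1 - ξ u)⁻¹, fun h0 => ?_, inv_ne_zero hne, fun h' => absurd h' h,
      fun _ => absv_unit u, fun z r => ?_⟩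
    · have := absv_unit u
      rw [h0, absv_zero] at this
      norm_num at this
    · rw [localL, if_neg h, multChar_of_absv_one _ _ _ (absv_unit u), unitExt_unit,
        inv_mul_cancel₀ hne, inv_one]

end LocalField

/-! ### How automorphisms scale Haar measure. -/

section HaarScaling

lemma measure_image_continuousAddEquiv {G : Type*} [AddGroup G] [TopologicalSpace G]
    [MeasurableSpace G] [BorelSpace G] [IsTopologicalAddGroup G] [LocallyCompactSpace G]
    (μ : Measure G) [μ.IsAddHaarMeasure] [μ.Regular] (φ : G ≃ₜ+ G) (A : Set G) :
    μ (φ '' A) = addEquivAddHaarChar φ • μ A := by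
  have := addEquivAddHaarChar_smul_preimage μ (X := φ '' A) φ
  rw [← this, Set.preimage_image_eq _ φ.injective]

/-- A is the disjoint union of `Nat.card ι` translates of φ(A), all of the same measure, and its own
measure is positive and finite. -/
lemma haarChar_eq_inv_card_of_cosets {G : Type*} [AddCommGroup G] [TopologicalSpace G]
    [MeasurableSpace G] [BorelSpace G] [IsTopologicalAddGroup G] [LocallyCompactSpace G]
    (μ : Measure G) [μ.IsAddHaarMeasure] [μ.Regular] (φ : G ≃ₜ+ G) {A : Set G}
    (hA : IsCompact A) (hA' : IsOpen A) (hne : A.Nonempty) {ι : Type*} [Finite ι] (r : ι → G)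
    (hr : ∀ x, x ∈ A ↔ ∃ i, x - r i ∈ φ '' A)
    (hr' : ∀ x i j, x - r i ∈ φ '' A → x - r j ∈ φ '' A → i = j) :
    (addEquivAddHaarChar φ : ℝ) = (Nat.card ι : ℝ)⁻¹ := by
  cases nonempty_fintype ι
  have hφ : IsOpen (φ '' A) := φ.toHomeomorph.isOpenMap _ hA'
  have h1 : A = ⋃ i, (fun x => x - r i) ⁻¹' (φ '' A) := by
    ext x; simpa using hr x
  have h2 : μ A = Nat.card ι * (addEquivAddHaarChar φ • μ A) := by
    conv_lhs => rw [h1]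
    rw [measure_iUnion]
    · have hi : ∀ i, μ ((fun x => x - r i) ⁻¹' (φ '' A)) = μ (φ '' A) := fun i => by
        simpa [sub_eq_add_neg] using measure_preimage_add_right μ (-r i) (φ '' A)
      simp [tsum_fintype, hi, measure_image_continuousAddEquiv]
    · intro i j hij
      rw [Function.onFun, Set.disjoint_left]
      exact fun x hx hy => hij (hr' x i j hx hy)
    · exact fun i => (hφ.preimage (by fun_prop : Continuous fun x => x - r i)).measurableSet
  have h3 : μ.real A = Nat.card ι * ((addEquivAddHaarChar φ : ℝ) * μ.real A) := by
    have := congrArg ENNReal.toReal h2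
    rw [ENNReal.toReal_mul, ENNReal.toReal_smul] at this
    simpa [Measure.real, NNReal.smul_def] using this
  have h4 : μ.real A ≠ 0 :=
    (ENNReal.toReal_pos (hA'.measure_pos μ hne).ne' hA.measure_lt_top.ne).ne'
  have h5 : (Nat.card ι : ℝ) * (addEquivAddHaarChar φ : ℝ) = 1 := by
    have : (Nat.card ι * (addEquivAddHaarChar φ : ℝ) - 1) * μ.real A = 0 := by linarith
    rcases mul_eq_zero.1 this with h | h
    · linarith
    · exact absurd h h4
  exact eq_inv_of_mul_eq_one_right h5

lemma integral_comp_continuousAddEquiv {G : Type*} [AddGroup G] [TopologicalSpace G]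
    [MeasurableSpace G] [BorelSpace G] [IsTopologicalAddGroup G] [LocallyCompactSpace G]
    (μ : Measure G) [μ.IsAddHaarMeasure] [μ.Regular] (φ : G ≃ₜ+ G) (f : G → ℂ) :
    ∫ x, f x ∂μ = (addEquivAddHaarChar φ : ℝ) * ∫ x, f (φ x) ∂μ := by
  conv_lhs => rw [← addEquivAddHaarChar_smul_map μ φ]
  have h := φ.toHomeomorph.toMeasurableEquiv.measurableEmbedding.integral_map (μ := μ) f
  rw [integral_smul_nnreal_measure, show μ.map φ = μ.map φ.toHomeomorph.toMeasurableEquiv from rfl,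
    h, NNReal.smul_def, Complex.real_smul]
  rfl

lemma integrable_comp_continuousAddEquiv {G : Type*} [AddGroup G] [TopologicalSpace G]
    [MeasurableSpace G] [BorelSpace G] [IsTopologicalAddGroup G] [LocallyCompactSpace G]
    (μ : Measure G) [μ.IsAddHaarMeasure] [μ.Regular] (φ : G ≃ₜ+ G) {f : G → ℂ}
    (hf : Integrable f μ) : Integrable (fun x => f (φ x)) μ := by
  rw [← addEquivAddHaarChar_smul_map μ φ] at hf
  have hc : (addEquivAddHaarChar φ : ENNReal) ≠ 0 := by
    exact_mod_cast (addEquivAddHaarChar_pos φ).ne'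
  have hf' : Integrable f ((addEquivAddHaarChar φ : ENNReal) • μ.map φ) := hf
  rw [integrable_smul_measure hc ENNReal.coe_ne_top] at hf'
  exact (φ.toHomeomorph.toMeasurableEquiv.measurableEmbedding.integrable_map_iff).1 hf'

end HaarScaling

/-! ### The module of a multiplication is the normalized absolute value. -/

section LocalField

variable {K : Type*} [Field K] [ValuativeRel K] [TopologicalSpace K]
  [IsNonarchimedeanLocalField K]

lemma residue_eq_iff (x y : 𝒪[K]) :
    IsLocalRing.residue 𝒪[K] x = IsLocalRing.residue 𝒪[K] y ↔ absv ((x : K) - y) < 1 := by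
  rw [← sub_eq_zero, ← map_sub, IsLocalRing.residue_eq_zero_iff, IsLocalRing.mem_maximalIdeal,
    mem_nonunits_iff, isUnit_integer_iff]
  exact ⟨fun h => lt_of_le_of_ne (absv_integer_le (x - y)) h, fun h => h.ne⟩

variable (K) in
lemma exists_residue_reps : ∃ r : 𝓀[K] → K, (∀ i, absv (r i) ≤ 1) ∧
    (∀ x, absv x ≤ 1 → ∃ i, absv (x - r i) < 1) ∧ ∀ i j, absv (r i - r j) < 1 → i = j := by
  have hs : Function.Surjective (IsLocalRing.residue 𝒪[K]) := IsLocalRing.residue_surjective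
  refine ⟨fun i => (Function.surjInv hs i : 𝒪[K]), fun i => absv_integer_le _, fun x hx => ?_,
    fun i j h => ?_⟩
  · refine ⟨IsLocalRing.residue 𝒪[K] ⟨x, mem_integer_iff_absv.2 hx⟩, ?_⟩
    have := (residue_eq_iff ⟨x, mem_integer_iff_absv.2 hx⟩ (Function.surjInv hs
      (IsLocalRing.residue 𝒪[K] ⟨x, mem_integer_iff_absv.2 hx⟩))).1
    exact this (Function.surjInv_eq hs _).symm
  · have := (residue_eq_iff (Function.surjInv hs i) (Function.surjInv hs j)).2 h
    rwa [Function.surjInv_eq hs, Function.surjInv_eq hs] at this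

lemma exists_uniformizer_zpow_mul {x : Kˣ} {ϖ : Kˣ} (hϖ : absv (ϖ : K) = (resCard K : ℝ)⁻¹) :
    ∃ (n : ℤ) (u : Kˣ), absv (u : K) = 1 ∧ x = ϖ ^ n * u := by
  refine ⟨ord (x : K), ϖ ^ (-ord (x : K)) * x, ?_, by simp⟩
  push_cast
  rw [absv_mul, absv_zpow, hϖ, absv_of_ne_zero x.ne_zero, inv_zpow, ← zpow_neg,
    ← zpow_add₀ resCard_pos_real.ne']
  simp

/-- Kˣ is generated by the units and one uniformizer. Modules thus need only be computed for maps
that preserve the integers or contract them with index q. -/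
lemma unitsHom_ext_of_uniformizer {G : Type*} [DivisionMonoid G] {f g : Kˣ →* G}
    (h1 : ∀ u : Kˣ, absv (u : K) = 1 → f u = g u)
    (h2 : ∀ u : Kˣ, absv (u : K) = (resCard K : ℝ)⁻¹ → f u = g u) : f = g := by
  obtain ⟨ϖ, hϖ⟩ := IsDiscreteValuationRing.exists_irreducible 𝒪[K]
  let w : Kˣ := Units.mk0 (ϖ : K) (uniformizer_ne_zero hϖ)
  have hw : absv (w : K) = (resCard K : ℝ)⁻¹ := absv_uniformizer hϖ
  ext x
  obtain ⟨n, u, hu, rfl⟩ := exists_uniformizer_zpow_mul (x := x) hw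
  rw [map_mul, map_mul, map_zpow, map_zpow, h1 u hu, h2 w hw]

/-- Multiplication by a nonzero element, as an automorphism of the additive group. -/
def mulAut (u : Kˣ) : K ≃ₜ+ K where
  toFun x := u * x
  invFun x := (↑u⁻¹ : K) * x
  left_inv x := by simp
  right_inv x := by simp
  map_add' x y := mul_add _ _ _
  continuous_toFun := by fun_prop
  continuous_invFun := by fun_prop

lemma mulAut_apply (u : Kˣ) (x : K) : mulAut u x = u * x := rfl

lemma image_mulAut_absv_le (u : Kˣ) (r : ℝ) :
    mulAut u '' {x | absv x ≤ r} = {x : K | absv x ≤ absv (u : K) * r} := by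
  ext x
  simp only [Set.mem_image, Set.mem_ofPred_eq, mulAut_apply]
  constructor
  · rintro ⟨y, hy, rfl⟩
    rw [absv_mul]
    exact mul_le_mul_of_nonneg_left hy (absv_nonneg _)
  · intro h
    refine ⟨(↑u⁻¹ : K) * x, ?_, by simp⟩
    rw [Units.val_inv_eq_inv_val, absv_mul, absv_inv, inv_mul_le_iff₀ (absv_pos u.ne_zero)]
    exact h

lemma haarChar_eq_one_of_image_eq {G : Type*} [AddCommGroup G] [TopologicalSpace G]
    [MeasurableSpace G] [BorelSpace G] [IsTopologicalAddGroup G] [LocallyCompactSpace G]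
    (μ : Measure G) [μ.IsAddHaarMeasure] [μ.Regular] (φ : G ≃ₜ+ G) {A : Set G}
    (hA : IsCompact A) (hA' : IsOpen A) (hne : A.Nonempty) (h : φ '' A = A) :
    (addEquivAddHaarChar φ : ℝ) = 1 := by
  obtain ⟨a, ha⟩ := hne
  have := haarChar_eq_inv_card_of_cosets μ φ hA hA' ⟨a, ha⟩ (ι := Unit) (fun _ => 0)
    (fun x => by simp [h]) (fun x i j _ _ => rfl)
  simpa using this

/-- Units preserve the ring of integers, and a uniformizer maps it onto the maximal ideal, whose
cosets are indexed by the residue field. -/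
theorem haarChar_mulAut [MeasurableSpace K] [BorelSpace K] (u : Kˣ) :
    (addEquivAddHaarChar (mulAut u) : ℝ) = absv (u : K) := by
  let f : Kˣ →* ℝ :=
    { toFun := fun u => (addEquivAddHaarChar (mulAut u) : ℝ)
      map_one' := by
        have : mulAut (1 : Kˣ) = ContinuousAddEquiv.refl K := by ext x; simp [mulAut_apply]
        simp [this]
      map_mul' := fun u v => by
        have : mulAut (u * v) = (mulAut v).trans (mulAut u) := by
          ext x; simp [mulAut_apply, mul_assoc]
        rw [this, addEquivAddHaarChar_trans, NNReal.coe_mul, mul_comm] }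
  let g : Kˣ →* ℝ := (absvHom K : K →* ℝ).comp (Units.coeHom K)
  suffices f = g from DFunLike.congr_fun this u
  have hA : IsCompact {x : K | absv x ≤ 1} := isCompact_absv_le 1
  have hA' : IsOpen {x : K | absv x ≤ 1} := (isClopen_absv_le one_pos).isOpen
  have hne : {x : K | absv x ≤ 1}.Nonempty := ⟨0, by simp [absv_zero]⟩
  refine unitsHom_ext_of_uniformizer (fun u hu => ?_) fun u hu => ?_
  · change (addEquivAddHaarChar (mulAut u) : ℝ) = absv (u : K)
    rw [hu]
    refine haarChar_eq_one_of_image_eq Measure.addHaar _ hA hA' hne ?_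
    rw [image_mulAut_absv_le, hu, one_mul]
  · change (addEquivAddHaarChar (mulAut u) : ℝ) = absv (u : K)
    rw [hu]
    obtain ⟨r, hr1, hr2, hr3⟩ := exists_residue_reps K
    refine haarChar_eq_inv_card_of_cosets Measure.addHaar _ hA hA' hne r ?_ ?_
    all_goals
      simp only [image_mulAut_absv_le, hu, mul_one, Set.mem_ofPred_eq, ← absv_lt_one_iff]
    · refine fun x => ⟨hr2 x, ?_⟩
      rintro ⟨i, hi⟩
      have := absv_add_le (x - r i) (r i)
      rw [sub_add_cancel] at this
      exact this.trans (max_le hi.le (hr1 i))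
    · intro x i j hi hj
      apply hr3
      have := absv_sub_le (x - r j) (x - r i)
      rw [sub_sub_sub_cancel_left] at this
      exact this.trans_lt (max_lt hj hi)

end LocalField

/-! ### Coordinates on E and their scalings. -/

section Extension

variable {F E : Type*} [Field F] [ValuativeRel F] [TopologicalSpace F]
  [IsNonarchimedeanLocalField F] [Field E] [ValuativeRel E] [TopologicalSpace E]
  [IsNonarchimedeanLocalField E] [Algebra F E] [ValuativeExtension F E]

instance : ContinuousSMul F E := by
  refine ⟨?_⟩
  simp only [Algebra.smul_def]
  exact ((continuous_algebraMap_localField F E).comp continuous_fst).mul continuous_snd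

/-- The coordinates with respect to a basis, as an isomorphism of topological groups. -/
def coordEquiv (b : Module.Basis (Fin 2) F E) : F × F ≃ₜ+ E := by
  let e : F × F ≃+ E :=
    ((LinearEquiv.finTwoArrow F F).symm.trans b.equivFun.symm).toAddEquiv
  have he : ∀ x, e x = x.1 • b 0 + x.2 • b 1 := fun x => by
    change b.equivFun.symm ![x.1, x.2] = _
    rw [Module.Basis.equivFun_symm_apply]
    simp
  have hc : Continuous e := by
    rw [show (e : F × F → E) = fun x => x.1 • b 0 + x.2 • b 1 from funext he]
    fun_prop
  -- Continuity of the inverse comes from the open mapping theorem for σ-compact groups.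
  have ho : IsOpenMap e := AddMonoidHom.isOpenMap_of_sigmaCompact e.toAddMonoidHom e.surjective hc
  exact { e with
    continuous_toFun := hc
    continuous_invFun := (e.toEquiv.toHomeomorphOfContinuousOpen hc ho).continuous_invFun }

lemma coordEquiv_apply (b : Module.Basis (Fin 2) F E) (x : F × F) :
    coordEquiv b x = x.1 • b 0 + x.2 • b 1 := by
  change b.equivFun.symm ![x.1, x.2] = _
  rw [Module.Basis.equivFun_symm_apply]
  simp

lemma continuous_repr (b : Module.Basis (Fin 2) F E) (i : Fin 2) :
    Continuous fun x => b.repr x i := by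
  have h : Continuous fun x => ((b.repr x 0, b.repr x 1) : F × F) :=
    (coordEquiv b).symm.continuous_toFun
  fin_cases i
  · exact continuous_fst.comp h
  · exact continuous_snd.comp h

lemma repr_sum_eq (b : Module.Basis (Fin 2) F E) (x : E) :
    b.repr x 0 • b 0 + b.repr x 1 • b 1 = x := by
  have := b.sum_repr x
  rwa [Fin.sum_univ_two] at this

/-- The automorphism scaling the two coordinates. -/
def scaleAut (b : Module.Basis (Fin 2) F E) (a c : Fˣ) : E ≃ₜ+ E :=
  ((coordEquiv b).symm.trans
    { toFun := fun x => (a * x.1, c * x.2)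
      invFun := fun x => (↑a⁻¹ * x.1, ↑c⁻¹ * x.2)
      left_inv := fun x => by simp
      right_inv := fun x => by simp
      map_add' := fun x y => by simp [mul_add]
      continuous_toFun := by fun_prop
      continuous_invFun := by fun_prop }).trans (coordEquiv b)

lemma scaleAut_apply (b : Module.Basis (Fin 2) F E) (a c : Fˣ) (x : E) :
    scaleAut b a c x = (a * b.repr x 0) • b 0 + (c * b.repr x 1) • b 1 :=
  coordEquiv_apply b _

lemma repr_scaleAut_zero (b : Module.Basis (Fin 2) F E) (a c : Fˣ) (x : E) :
    b.repr (scaleAut b a c x) 0 = a * b.repr x 0 := by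
  rw [scaleAut_apply]; simp

lemma repr_scaleAut_one (b : Module.Basis (Fin 2) F E) (a c : Fˣ) (x : E) :
    b.repr (scaleAut b a c x) 1 = c * b.repr x 1 := by
  rw [scaleAut_apply]; simp

lemma repr_ext (b : Module.Basis (Fin 2) F E) {x y : E} (h0 : b.repr x 0 = b.repr y 0)
    (h1 : b.repr x 1 = b.repr y 1) : x = y := by
  rw [← repr_sum_eq b x, ← repr_sum_eq b y, h0, h1]

lemma scaleAut_mul (b : Module.Basis (Fin 2) F E) (a c a' c' : Fˣ) :
    scaleAut b (a * a') (c * c') = (scaleAut b a' c').trans (scaleAut b a c) := by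
  ext x
  refine repr_ext b ?_ ?_ <;>
  simp [repr_scaleAut_zero, repr_scaleAut_one, mul_assoc]

lemma scaleAut_symm (b : Module.Basis (Fin 2) F E) (a c : Fˣ) :
    (scaleAut b a c).symm = scaleAut b a⁻¹ c⁻¹ := by
  ext x
  rw [ContinuousAddEquiv.symm_apply_eq]
  refine repr_ext b ?_ ?_ <;>
  simp [repr_scaleAut_zero, repr_scaleAut_one]

/-- The elements whose coordinates are bounded by `r` and `r'`. -/
def box (b : Module.Basis (Fin 2) F E) (r r' : ℝ) : Set E :=
  {x | absv (b.repr x 0) ≤ r ∧ absv (b.repr x 1) ≤ r'}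

lemma isClopen_box (b : Module.Basis (Fin 2) F E) {r r' : ℝ} (hr : 0 < r) (hr' : 0 < r') :
    IsClopen (box b r r') :=
  ((isClopen_absv_le hr).preimage (continuous_repr b 0)).inter
    ((isClopen_absv_le hr').preimage (continuous_repr b 1))

lemma isCompact_box (b : Module.Basis (Fin 2) F E) (r r' : ℝ) : IsCompact (box b r r') := by
  have := ((isCompact_absv_le (K := F) r).prod (isCompact_absv_le (K := F) r')).image
    (coordEquiv b).continuous_toFun
  convert! this
  ext x
  constructor
  · intro hx
    exact ⟨(b.repr x 0, b.repr x 1), hx, (coordEquiv_apply b _).trans (repr_sum_eq b x)⟩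
  · rintro ⟨y, hy, rfl⟩
    have h : (coordEquiv b).toFun y = y.1 • b 0 + y.2 • b 1 := coordEquiv_apply b y
    rw [h]
    simpa [box] using hy

lemma zero_mem_box (b : Module.Basis (Fin 2) F E) {r r' : ℝ} (hr : 0 ≤ r) (hr' : 0 ≤ r') :
    (0 : E) ∈ box b r r' := by simp [box, absv_zero, hr, hr']

lemma image_scaleAut_box (b : Module.Basis (Fin 2) F E) (a c : Fˣ) (r r' : ℝ) :
    scaleAut b a c '' box b r r' = box b (absv (a : F) * r) (absv (c : F) * r') := by
  ext x
  constructor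
  · rintro ⟨y, hy, rfl⟩
    simp only [box, Set.mem_ofPred_eq, repr_scaleAut_zero, repr_scaleAut_one, absv_mul] at hy ⊢
    exact ⟨mul_le_mul_of_nonneg_left hy.1 (absv_nonneg _),
      mul_le_mul_of_nonneg_left hy.2 (absv_nonneg _)⟩
  · intro h
    refine ⟨(scaleAut b a c).symm x, ?_, by simp⟩
    rw [scaleAut_symm]
    simp only [box, Set.mem_ofPred_eq, repr_scaleAut_zero, repr_scaleAut_one, absv_mul,
      Units.val_inv_eq_inv_val, absv_inv] at h ⊢
    rw [inv_mul_le_iff₀ (absv_pos a.ne_zero), inv_mul_le_iff₀ (absv_pos c.ne_zero)]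
    exact h

variable [MeasurableSpace E] [BorelSpace E]

/-- The coset count of `haarChar_mulAut`, on the unit box and for one coordinate at a time. -/
theorem haarChar_scaleAut (b : Module.Basis (Fin 2) F E) (a c : Fˣ) :
    (addEquivAddHaarChar (scaleAut b a c) : ℝ) = absv (a : F) * absv (c : F) := by
  have hA : IsCompact (box b 1 1) := isCompact_box b _ _
  have hA' : IsOpen (box b 1 1) := (isClopen_box b one_pos one_pos).isOpen
  have hne : (box b 1 1).Nonempty := ⟨0, zero_mem_box b zero_le_one zero_le_one⟩
  have hone : scaleAut b (1 : Fˣ) 1 = ContinuousAddEquiv.refl E := by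
    ext x
    refine repr_ext b ?_ ?_ <;> simp [repr_scaleAut_zero, repr_scaleAut_one]
  obtain ⟨r, hr1, hr2, hr3⟩ := exists_residue_reps F
  let f : Fˣ →* ℝ :=
    { toFun := fun u => (addEquivAddHaarChar (scaleAut b u 1) : ℝ)
      map_one' := by simp [hone]
      map_mul' := fun u v => by
        have := scaleAut_mul b u 1 v 1
        rw [one_mul] at this
        rw [this, addEquivAddHaarChar_trans, NNReal.coe_mul, mul_comm] }
  let f' : Fˣ →* ℝ :=
    { toFun := fun u => (addEquivAddHaarChar (scaleAut b 1 u) : ℝ)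
      map_one' := by simp [hone]
      map_mul' := fun u v => by
        have := scaleAut_mul b 1 u 1 v
        rw [one_mul] at this
        rw [this, addEquivAddHaarChar_trans, NNReal.coe_mul, mul_comm] }
  let g : Fˣ →* ℝ := (absvHom F : F →* ℝ).comp (Units.coeHom F)
  have hbd : ∀ x i, absv (x - r i) < 1 → absv x ≤ 1 := fun x i hi => by
    have := absv_add_le (x - r i) (r i)
    rw [sub_add_cancel] at this
    exact this.trans (max_le hi.le (hr1 i))
  have huniq : ∀ x i j, absv (x - r i) < 1 → absv (x - r j) < 1 → i = j := fun x i j hi hj => by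
    apply hr3
    have := absv_sub_le (x - r j) (x - r i)
    rw [sub_sub_sub_cancel_left] at this
    exact this.trans_lt (max_lt hj hi)
  have hf : f = g := by
    refine unitsHom_ext_of_uniformizer (fun u hu => ?_) fun u hu => ?_
    · change (addEquivAddHaarChar (scaleAut b u 1) : ℝ) = absv (u : F)
      rw [hu]
      refine haarChar_eq_one_of_image_eq Measure.addHaar _ hA hA' hne ?_
      rw [image_scaleAut_box, hu, Units.val_one, absv_one, one_mul]
    · change (addEquivAddHaarChar (scaleAut b u 1) : ℝ) = absv (u : F)
      rw [hu]
      have him : scaleAut b u 1 '' box b 1 1 = box b (resCard F : ℝ)⁻¹ 1 := by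
        rw [image_scaleAut_box, hu, Units.val_one, absv_one, one_mul, mul_one]
      refine haarChar_eq_inv_card_of_cosets Measure.addHaar _ hA hA' hne (fun i => r i • b 0) ?_ ?_
      all_goals
        rw [him]
        simp only [box, Set.mem_ofPred_eq, ← absv_lt_one_iff, map_sub, map_smul,
          Module.Basis.repr_self, Finsupp.sub_apply, Finsupp.smul_apply]
        simp
      · exact fun x _ => ⟨fun h => hr2 _ h, fun ⟨_, h⟩ => hbd _ _ h⟩
      · exact fun x i j hi _ hj _ => huniq _ i j hi hj
  have hf' : f' = g := by
    refine unitsHom_ext_of_uniformizer (fun u hu => ?_) fun u hu => ?_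
    · change (addEquivAddHaarChar (scaleAut b 1 u) : ℝ) = absv (u : F)
      rw [hu]
      refine haarChar_eq_one_of_image_eq Measure.addHaar _ hA hA' hne ?_
      rw [image_scaleAut_box, hu, Units.val_one, absv_one, one_mul]
    · change (addEquivAddHaarChar (scaleAut b 1 u) : ℝ) = absv (u : F)
      rw [hu]
      have him : scaleAut b 1 u '' box b 1 1 = box b 1 (resCard F : ℝ)⁻¹ := by
        rw [image_scaleAut_box, hu, Units.val_one, absv_one, one_mul, mul_one]
      refine haarChar_eq_inv_card_of_cosets Measure.addHaar _ hA hA' hne (fun i => r i • b 1) ?_ ?_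
      all_goals
        rw [him]
        simp only [box, Set.mem_ofPred_eq, ← absv_lt_one_iff, map_sub, map_smul,
          Module.Basis.repr_self, Finsupp.sub_apply, Finsupp.smul_apply]
        simp
      · exact fun x _ => ⟨fun h => hr2 _ h, fun ⟨_, h⟩ => hbd _ _ h⟩
      · exact fun x i j _ hi _ hj => huniq _ i j hi hj
  have h := scaleAut_mul b a 1 1 c
  rw [one_mul, mul_one] at h
  rw [h, addEquivAddHaarChar_trans, NNReal.coe_mul, mul_comm]
  exact congrArg₂ (· * ·) (DFunLike.congr_fun hf a) (DFunLike.congr_fun hf' c)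

end Extension

/-! ### Comparison of the absolute values of F and E. -/

section Extension

variable {F E : Type*} [Field F] [ValuativeRel F] [TopologicalSpace F]
  [IsNonarchimedeanLocalField F] [Field E] [ValuativeRel E] [TopologicalSpace E]
  [IsNonarchimedeanLocalField E] [Algebra F E] [ValuativeExtension F E]

/-- Multiplication by a on E scales both coordinates by a, so its module can be computed in E and in
F × F. No ramification theory enters. -/
theorem absv_algebraMap (b : Module.Basis (Fin 2) F E) (a : F) :
    absv (algebraMap F E a) = absv a ^ 2 := by
  by_cases ha : a = 0
  · simp [ha, absv_zero]
  borelize E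
  let u : Fˣ := Units.mk0 a ha
  have h : mulAut (Units.map (algebraMap F E : F →* E) u) = scaleAut b u u := by
    ext x
    rw [scaleAut_apply, mul_smul, mul_smul, ← smul_add, repr_sum_eq, mulAut_apply,
      Algebra.smul_def]
    rfl
  have h1 := haarChar_mulAut (Units.map (algebraMap F E : F →* E) u)
  rw [h, haarChar_scaleAut] at h1
  rw [sq]
  exact h1.symm

end Extension

/-! ### Further identities for quasi-characters. -/

section LocalField

variable {K : Type*} [Field K] [ValuativeRel K] [TopologicalSpace K]
  [IsNonarchimedeanLocalField K]

lemma multChar_add_nat (ϖ : 𝒪[K]) (χ : UnitChar K) (s : ℂ) (n : ℕ) (x : K) :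
    multChar ϖ χ (s + n) x = multChar ϖ χ s x * (absv x : ℂ) ^ n := by
  by_cases hx : x = 0
  · simp [hx, multChar_zero]
  have : ((absv x : ℝ) : ℂ) ≠ 0 := by exact_mod_cast (absv_pos hx).ne'
  rw [multChar, multChar, Complex.cpow_add _ _ this, Complex.cpow_natCast, mul_assoc]

lemma multChar_uniformizer {ϖ : 𝒪[K]} (hϖ : Irreducible ϖ) (χ : UnitChar K) :
    multChar ϖ χ 0 (ϖ : K) = 1 := by
  have := unitExt_unit χ 1
  rw [map_one] at this
  have h0 := uniformizer_ne_zero hϖ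
  simpa [multChar, ord_uniformizer hϖ, h0] using this

lemma multChar_pow_char {ϖ : 𝒪[K]} (χ : UnitChar K) (s : ℂ) {x : K} (hx : x ≠ 0) :
    multChar ϖ χ s x ^ 2 = multChar ϖ (χ ^ 2) (2 * s) x := by
  rw [sq, multChar_mul_multChar ϖ χ χ s s hx, ← sq, two_mul]

end LocalField

/-! ### Restriction of characters to F, conjugation and norm, factorization of the kernel. -/

section Extension

variable {F E : Type*} [Field F] [ValuativeRel F] [TopologicalSpace F]
  [IsNonarchimedeanLocalField F] [Field E] [ValuativeRel E] [TopologicalSpace E]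
  [IsNonarchimedeanLocalField E] [Algebra F E] [ValuativeExtension F E]

lemma unitExt_algebraMap (χ : UnitChar E) {y : F}
    (hy : absv y = 1) : unitExt χ (algebraMap F E y) = unitExt (resChar χ) y := by
  obtain ⟨u, rfl⟩ := exists_unit_eq hy
  rw [unitExt_unit]
  have := unitExt_unit χ (Units.map (integerMap F E : 𝒪[F] →* 𝒪[E]) u)
  exact this

/-- The compatibility χ₀(ϖF) = 1 makes both sides agree at ϖF for exponent 0, and they agree on
units by definition. The exponent doubles because |y|_E = |y|_F². -/
lemma multChar_algebraMap (b : Module.Basis (Fin 2) F E) {ϖF : 𝒪[F]} (hϖF : Irreducible ϖF)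
    {ϖE : 𝒪[E]} (hϖE : Irreducible ϖE) {χ : UnitChar E}
    (hχ : multChar ϖE χ 0 (algebraMap F E ϖF) = 1) (s : ℂ) (y : F) :
    multChar ϖE χ s (algebraMap F E y) = multChar ϖF (resChar χ) (2 * s) y := by
  by_cases hy : y = 0
  · simp [hy, multChar_zero]
  have hy' : algebraMap F E y ≠ 0 := by simpa using hy
  have h0 : multChar ϖE χ 0 (algebraMap F E y) = multChar ϖF (resChar χ) 0 y := by
    obtain ⟨n, u, hu, h⟩ := exists_uniformizer_zpow_mul (x := Units.mk0 y hy)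
      (ϖ := Units.mk0 (ϖF : F) (uniformizer_ne_zero hϖF)) (absv_uniformizer hϖF)
    have h' : y = (ϖF : F) ^ n * u := by simpa using congrArg Units.val h
    have e1 : multChar ϖE χ 0 ((algebraMap F E ϖF) ^ n) = 1 := by
      have := map_zpow₀ (multCharHom hϖE χ 0) (algebraMap F E ϖF) n
      rw [show multCharHom hϖE χ 0 (algebraMap F E ϖF) = 1 from hχ, one_zpow] at this
      exact this
    have e2 : multChar ϖF (resChar χ) 0 ((ϖF : F) ^ n) = 1 := by
      have := map_zpow₀ (multCharHom hϖF (resChar χ) 0) (ϖF : F) n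
      rw [show multCharHom hϖF (resChar χ) 0 (ϖF : F) = 1 from multChar_uniformizer hϖF _,
        one_zpow] at this
      exact this
    rw [h', map_mul, map_zpow₀, multChar_mul hϖE, multChar_mul hϖF, e1, e2,
      multChar_of_absv_one _ _ _ hu, multChar_of_absv_one, unitExt_algebraMap χ hu]
    rw [absv_algebraMap b, hu, one_pow]
  have h1 := multChar_mul_multChar ϖE χ 1 0 s hy'
  have h2 := multChar_mul_multChar ϖF (resChar χ) 1 0 (2 * s) hy
  rw [mul_one, zero_add] at h1 h2
  rw [← h1, ← h2, h0, multChar_one_char hϖE _ hy', multChar_one_char hϖF _ hy, absv_algebraMap b]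
  congr 1
  have hpos := absv_pos hy
  have hc : ((absv y : ℝ) : ℂ) ≠ 0 := by exact_mod_cast hpos.ne'
  rw [sq, Complex.ofReal_mul, Complex.mul_cpow_ofReal_nonneg hpos.le hpos.le,
    ← Complex.cpow_add _ _ hc, two_mul]

/-! ### Conjugation and norm -/

/-- The conjugation `x₁ + x₂ α ↦ x₁ - x₂ α`. -/
def conj (b : Module.Basis (Fin 2) F E) : E ≃ₜ+ E := scaleAut b 1 (-1)

/-- The norm form `x₁² - x₂² d`. -/
def normForm (b : Module.Basis (Fin 2) F E) (d : F) (x : E) : F :=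
  b.repr x 0 ^ 2 - b.repr x 1 ^ 2 * d

variable {b : Module.Basis (Fin 2) F E} {d : F}

lemma eq_coords (hb : b 0 = 1) (x : E) :
    x = algebraMap F E (b.repr x 0) + algebraMap F E (b.repr x 1) * b 1 := by
  conv_lhs => rw [← repr_sum_eq b x]
  rw [hb, Algebra.smul_def, Algebra.smul_def, mul_one]

lemma conj_eq (hb : b 0 = 1) (x : E) :
    conj b x = algebraMap F E (b.repr x 0) - algebraMap F E (b.repr x 1) * b 1 := by
  rw [conj, scaleAut_apply, hb, Algebra.smul_def, Algebra.smul_def]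
  simp [sub_eq_add_neg]

lemma repr_of_coords (hb : b 0 = 1) (x y : F) (i : Fin 2) :
    b.repr (algebraMap F E x + algebraMap F E y * b 1) i = ![x, y] i := by
  have : algebraMap F E x + algebraMap F E y * b 1 = x • b 0 + y • b 1 := by
    rw [hb, Algebra.smul_def, Algebra.smul_def, mul_one]
  rw [this]
  fin_cases i <;> simp

lemma repr_algebraMap_zero (hb : b 0 = 1) (a : F) : b.repr (algebraMap F E a) 0 = a := by
  simpa using repr_of_coords hb a 0 0

lemma repr_algebraMap_one (hb : b 0 = 1) (a : F) : b.repr (algebraMap F E a) 1 = 0 := by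
  simpa using repr_of_coords hb a 0 1

lemma repr_algebraMap_mul (a : F) (x : E) (i : Fin 2) :
    b.repr (algebraMap F E a * x) i = a * b.repr x i := by
  rw [← Algebra.smul_def]; simp

lemma conj_mul (hb : b 0 = 1) (hd : b 1 ^ 2 = algebraMap F E d) (x y : E) :
    conj b (x * y) = conj b x * conj b y := by
  have h : x * y =
      algebraMap F E (b.repr x 0 * b.repr y 0 + b.repr x 1 * b.repr y 1 * d) +
      algebraMap F E (b.repr x 0 * b.repr y 1 + b.repr x 1 * b.repr y 0) * b 1 := by
    conv_lhs => rw [eq_coords hb x, eq_coords hb y]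
    simp only [map_add, map_mul, ← hd]
    ring
  rw [conj_eq hb, conj_eq hb x, conj_eq hb y, h, repr_of_coords hb, repr_of_coords hb]
  simp only [Matrix.cons_val_zero, Matrix.cons_val_one, map_add, map_mul, ← hd]
  ring

lemma mul_conj (hb : b 0 = 1) (hd : b 1 ^ 2 = algebraMap F E d) (x : E) :
    x * conj b x = algebraMap F E (normForm b d x) := by
  conv_lhs => rw [conj_eq hb]; enter [1]; rw [eq_coords hb x]
  simp only [normForm, map_sub, map_mul, map_pow, ← hd]
  ring

lemma conj_conj (x : E) : conj b (conj b x) = x := by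
  refine repr_ext b ?_ ?_ <;> simp [conj, repr_scaleAut_zero, repr_scaleAut_one]

lemma conj_algebraMap (hb : b 0 = 1) (a : F) : conj b (algebraMap F E a) = algebraMap F E a := by
  rw [conj_eq hb, repr_algebraMap_zero hb, repr_algebraMap_one hb]; simp

lemma normForm_ne_zero (hb : b 0 = 1) (hd : b 1 ^ 2 = algebraMap F E d) {x : E} (hx : x ≠ 0) :
    normForm b d x ≠ 0 := by
  intro h
  have := mul_conj hb hd x
  rw [h, map_zero, mul_eq_zero] at this
  rcases this with h | h
  · exact hx h
  · exact hx ((map_eq_zero_iff (conj b) (conj b).injective).1 h)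

lemma normForm_mul (hb : b 0 = 1) (hd : b 1 ^ 2 = algebraMap F E d) (x y : E) :
    normForm b d (x * y) = normForm b d x * normForm b d y := by
  apply (algebraMap F E).injective
  rw [map_mul, ← mul_conj hb hd, ← mul_conj hb hd, ← mul_conj hb hd, conj_mul hb hd]
  ring

lemma normForm_algebraMap (hb : b 0 = 1) (a : F) : normForm b d (algebraMap F E a) = a ^ 2 := by
  rw [normForm, repr_algebraMap_zero hb, repr_algebraMap_one hb]; ring

lemma continuous_normForm : Continuous (normForm b d) := by
  unfold normForm
  exact ((continuous_repr b 0).pow 2).sub (((continuous_repr b 1).pow 2).mul continuous_const)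

/-- Multiplication by the conjugate of x is multiplication by x, transported by an involution of
module 1; hence the two modules agree. -/
lemma absv_conj (hb : b 0 = 1) (hd : b 1 ^ 2 = algebraMap F E d) (x : E) :
    absv (conj b x) = absv x := by
  by_cases hx : x = 0
  · simp [hx]
  borelize E
  have hcx : conj b x ≠ 0 := (map_ne_zero_iff (conj b) (conj b).injective).2 hx
  have h : mulAut (Units.mk0 (conj b x) hcx) =
      ((conj b).trans (mulAut (Units.mk0 x hx))).trans (conj b) := by
    ext y
    simp [mulAut_apply, conj_mul hb hd, conj_conj]
  have h1 := haarChar_mulAut (Units.mk0 (conj b x) hcx)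
  have h2 := haarChar_mulAut (Units.mk0 x hx)
  have h3 := haarChar_scaleAut b 1 (-1)
  simp only [Units.val_one, Units.val_neg, absv_neg, absv_one, mul_one] at h3
  rw [h, addEquivAddHaarChar_trans, addEquivAddHaarChar_trans] at h1
  push_cast at h1
  have h3' : (addEquivAddHaarChar (conj b) : ℝ) = 1 := h3
  rw [h2, h3'] at h1
  simpa using h1.symm

lemma absv_normForm (hb : b 0 = 1) (hd : b 1 ^ 2 = algebraMap F E d) (x : E) :
    absv (normForm b d x) = absv x := by
  have := congrArg absv (mul_conj hb hd x)
  rw [absv_mul, absv_conj hb hd, absv_algebraMap b, ← sq] at this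
  exact ((pow_left_inj₀ (absv_nonneg _) (absv_nonneg _) two_ne_zero).1 this).symm

/-! ### The kernel as a product -/

/-- The factor of the kernel which depends on `x₂` only. -/
def fiberChar (ϖF : 𝒪[F]) (χ : UnitChar E) (η : UnitChar F) (s t : ℂ) (w : F) : ℂ :=
  multChar ϖF (resChar χ * η) (2 * s + t - 1 / 2) w

variable (b d) in
/-- The factor of the kernel which is smooth away from the origin. -/
def smoothFactor (ϖF : 𝒪[F]) (ϖE : 𝒪[E]) (χ : UnitChar E) (η : UnitChar F) (s t : ℂ) (x : E) : ℂ :=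
  multChar ϖE χ (s - 1 / 2) x ^ 2 * (fiberChar ϖF χ η s t (normForm b d x))⁻¹

/-- The quasi-character through which dilations by `F` act on the kernel. -/
def dilationChar (ϖF : 𝒪[F]) (χ : UnitChar E) (η : UnitChar F) (s t : ℂ) (l : F) : ℂ :=
  multChar ϖF (resChar χ * η⁻¹) (2 * s - t - 3 / 2) l

variable {ϖF : 𝒪[F]} {ϖE : 𝒪[E]} {χ : UnitChar E} {η : UnitChar F} {s t : ℂ}

lemma fiberChar_mul (hϖF : Irreducible ϖF) (x y : F) :
    fiberChar ϖF χ η s t (x * y) = fiberChar ϖF χ η s t x * fiberChar ϖF χ η s t y :=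
  multChar_mul hϖF _ _ _ _

lemma fiberChar_zero : fiberChar ϖF χ η s t 0 = 0 := multChar_zero _ _ _

lemma fiberChar_ne_zero (hϖF : Irreducible ϖF) {x : F} (hx : x ≠ 0) :
    fiberChar ϖF χ η s t x ≠ 0 := multChar_ne_zero hϖF _ _ hx

/-- Since the kernel depends on x₂/N(x) through the multiplicative κ, the two singularities
separate: one factor is singular only on the line x₂ = 0, the other only at the origin. -/
lemma kernelFun_eq (hb : b 0 = 1) (hd : b 1 ^ 2 = algebraMap F E d) (hϖF : Irreducible ϖF)
    (hϖE : Irreducible ϖE) (hχ : multChar ϖE χ 0 (algebraMap F E ϖF) = 1) (s t : ℂ) (x : E) :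
    kernelFun b d ϖF ϖE χ η s t x =
      smoothFactor b d ϖF ϖE χ η s t x * fiberChar ϖF χ η s t (b.repr x 1) := by
  have hk : kernelFun b d ϖF ϖE χ η s t x = multChar ϖE χ (s - 1 / 2) (x ^ 2) *
      (multChar ϖE χ (s - 1 / 2) (algebraMap F E (b.repr x 1 / normForm b d x)) *
        multChar ϖF η (t + 1 / 2) (b.repr x 1 / normForm b d x)) := rfl
  by_cases hx : b.repr x 1 = 0
  · rw [hk, hx]; simp [multChar_zero, fiberChar_zero]
  have hx0 : x ≠ 0 := fun h => hx (by simp [h])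
  have hy : b.repr x 1 / normForm b d x ≠ 0 := div_ne_zero hx (normForm_ne_zero hb hd hx0)
  rw [hk, multChar_pow hϖE, multChar_algebraMap b hϖF hϖE hχ, multChar_mul_multChar _ _ _ _ _ hy,
    show 2 * (s - 1 / 2) + (t + 1 / 2) = 2 * s + t - 1 / 2 by ring,
    div_eq_mul_inv (b.repr x 1), multChar_mul hϖF, multChar_inv hϖF, smoothFactor, fiberChar, fiberChar]
  ring

lemma smoothFactor_ne_zero (hb : b 0 = 1) (hd : b 1 ^ 2 = algebraMap F E d)
    (hϖF : Irreducible ϖF) (hϖE : Irreducible ϖE) {x : E} (hx : x ≠ 0) :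
    smoothFactor b d ϖF ϖE χ η s t x ≠ 0 :=
  mul_ne_zero (pow_ne_zero _ (multChar_ne_zero hϖE _ _ hx))
    (inv_ne_zero (fiberChar_ne_zero hϖF (normForm_ne_zero hb hd hx)))

lemma eventually_smoothFactor_eq (hb : b 0 = 1) (hd : b 1 ^ 2 = algebraMap F E d)
    (hϖF : Irreducible ϖF) (hϖE : Irreducible ϖE) {x : E} (hx : x ≠ 0) :
    ∀ᶠ y in 𝓝 x, ∀ s t,
      smoothFactor b d ϖF ϖE χ η s t y = smoothFactor b d ϖF ϖE χ η s t x := by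
  filter_upwards [eventually_multChar_eq hϖE χ hx, continuous_normForm.continuousAt.eventually
    (eventually_multChar_eq hϖF (resChar χ * η) (normForm_ne_zero hb hd hx))] with y h1 h2 s t
  rw [smoothFactor, smoothFactor, fiberChar, fiberChar, h1, h2]

lemma eventually_fiberChar_eq (hϖF : Irreducible ϖF) {x : E} (hx : b.repr x 1 ≠ 0) :
    ∀ᶠ y in 𝓝 x, ∀ s t,
      fiberChar ϖF χ η s t (b.repr y 1) = fiberChar ϖF χ η s t (b.repr x 1) := by
  filter_upwards [(continuous_repr b 1).continuousAt.eventually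
    (eventually_multChar_eq hϖF (resChar χ * η) hx)] with y h1 s t
  exact h1 _

lemma differentiable_fiberChar (w : F) :
    Differentiable ℂ fun p : ℂ × ℂ => fiberChar ϖF χ η p.1 p.2 w :=
  (differentiable_multChar ϖF (resChar χ * η) w).comp
    (f := fun p : ℂ × ℂ => 2 * p.1 + p.2 - 1 / 2) (by fun_prop)

lemma differentiable_smoothFactor (hb : b 0 = 1) (hd : b 1 ^ 2 = algebraMap F E d)
    (hϖF : Irreducible ϖF) (hϖE : Irreducible ϖE) (x : E) :
    Differentiable ℂ fun p : ℂ × ℂ => smoothFactor b d ϖF ϖE χ η p.1 p.2 x := by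
  unfold smoothFactor
  by_cases hx : x = 0
  · simp only [hx, multChar_zero]; simp
  refine Differentiable.mul (Differentiable.pow ?_ 2) (Differentiable.inv (differentiable_fiberChar _)
    fun p => fiberChar_ne_zero hϖF (normForm_ne_zero hb hd hx))
  exact (differentiable_multChar ϖE χ x).comp (f := fun p : ℂ × ℂ => p.1 - 1 / 2) (by fun_prop)

/-- Both sides are the quasi-character of Fˣ with unit part χ|² and exponent 4s - 2; η and t cancel.
-/
lemma dilationChar_mul_fiberChar (b : Module.Basis (Fin 2) F E)
    (hϖF : Irreducible ϖF) (hϖE : Irreducible ϖE)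
    (hχ : multChar ϖE χ 0 (algebraMap F E ϖF) = 1) {l : F} (hl : l ≠ 0) :
    dilationChar ϖF χ η s t l * fiberChar ϖF χ η s t l =
      multChar ϖE χ (s - 1 / 2) (algebraMap F E l) ^ 2 := by
  rw [dilationChar, fiberChar, multChar_mul_multChar _ _ _ _ _ hl, multChar_algebraMap b hϖF hϖE hχ,
    multChar_pow_char _ _ hl]
  congr 1
  · rw [sq, mul_mul_mul_comm, inv_mul_cancel, mul_one]
  · ring

lemma smoothFactor_algebraMap_mul (hb : b 0 = 1) (hd : b 1 ^ 2 = algebraMap F E d)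
    (hϖF : Irreducible ϖF) (hϖE : Irreducible ϖE)
    (hχ : multChar ϖE χ 0 (algebraMap F E ϖF) = 1) {l : F} (hl : l ≠ 0) (x : E) :
    smoothFactor b d ϖF ϖE χ η s t (algebraMap F E l * x) * fiberChar ϖF χ η s t l =
      dilationChar ϖF χ η s t l * smoothFactor b d ϖF ϖE χ η s t x := by
  have h := dilationChar_mul_fiberChar (η := η) (s := s) (t := t) b hϖF hϖE hχ hl
  have h0 : fiberChar ϖF χ η s t l ≠ 0 := fiberChar_ne_zero hϖF hl
  rw [smoothFactor, smoothFactor, multChar_mul hϖE, normForm_mul hb hd, normForm_algebraMap hb, sq l,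
    fiberChar_mul hϖF, fiberChar_mul hϖF, mul_pow, ← h]
  field_simp

lemma kernelFun_algebraMap_mul (hb : b 0 = 1) (hd : b 1 ^ 2 = algebraMap F E d)
    (hϖF : Irreducible ϖF) (hϖE : Irreducible ϖE)
    (hχ : multChar ϖE χ 0 (algebraMap F E ϖF) = 1) {l : F} (hl : l ≠ 0) (x : E) :
    kernelFun b d ϖF ϖE χ η s t (algebraMap F E l * x) =
      dilationChar ϖF χ η s t l * kernelFun b d ϖF ϖE χ η s t x := by
  rw [kernelFun_eq hb hd hϖF hϖE hχ, kernelFun_eq hb hd hϖF hϖE hχ, repr_algebraMap_mul,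
    fiberChar_mul hϖF, ← mul_assoc, ← mul_assoc, smoothFactor_algebraMap_mul hb hd hϖF hϖE hχ hl]

end Extension

/-! ### Integrals of locally constant families of holomorphic functions. -/

section LocallyConstantFamilies

lemma finite_range_of_hasCompactSupport {X Y : Type*} [TopologicalSpace X] [Zero Y] {f : X → Y}
    (hf : IsLocallyConstant f) (hc : HasCompactSupport f) : (Set.range f).Finite := by
  have h1 : (f '' tsupport f).Finite := by
    let _ : TopologicalSpace Y := ⊥
    have _ : DiscreteTopology Y := ⟨rfl⟩
    exact (hc.image hf.continuous).finite_of_discrete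
  refine (h1.union (Set.finite_singleton 0)).subset ?_
  rintro _ ⟨x, rfl⟩
  by_cases hx : x ∈ tsupport f
  · exact Or.inl ⟨x, hx, rfl⟩
  · exact Or.inr (image_eq_zero_of_notMem_tsupport hx)

variable {X : Type*} [TopologicalSpace X] [MeasurableSpace X] [OpensMeasurableSpace X]
  {μ : Measure X} [IsFiniteMeasureOnCompacts μ]

lemma integrable_of_isLocallyConstant {f : X → ℂ} (hf : IsLocallyConstant f)
    (hc : HasCompactSupport f) : Integrable f μ :=
  hf.continuous.integrable_of_hasCompactSupport hc

/-- The family takes finitely many values, each a differentiable function of p, so the integral is a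
finite sum of such functions. Letting f take values in functions of p makes its level sets
independent of p. -/
lemma differentiable_integral_of_isLocallyConstant {P : Type*} [NormedAddCommGroup P]
    [NormedSpace ℂ P] {f : X → P → ℂ} (hf : IsLocallyConstant f) (hc : HasCompactSupport f)
    (hd : ∀ x, Differentiable ℂ (f x)) : Differentiable ℂ fun p => ∫ x, f x p ∂μ := by
  classical
  have hfin := finite_range_of_hasCompactSupport hf hc
  have hint : ∀ (i : P → ℂ) (p : P), Integrable ((f ⁻¹' {i}).indicator fun _ => i p) μ := by
    intro i p
    by_cases hi : i = 0
    · simp [hi]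
    refine (integrable_indicator_iff (hf.isOpen_fiber i).measurableSet).2 ?_
    refine integrableOn_const ((lt_of_le_of_lt (measure_mono ?_) hc.measure_lt_top).ne)
    intro x hx
    refine subset_tsupport _ ?_
    simpa [show f x = i from hx] using hi
  have key : ∀ p, ∫ x, f x p ∂μ = ∑ i ∈ hfin.toFinset, μ.real (f ⁻¹' {i}) * i p := by
    intro p
    have h1 : ∀ x, f x p = ∑ i ∈ hfin.toFinset, (f ⁻¹' {i}).indicator (fun _ => i p) x := by
      intro x
      rw [Finset.sum_eq_single (f x)]
      · simp
      · intro i _ hi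
        simp [Ne.symm hi]
      · simp
    simp_rw [h1]
    rw [integral_finsetSum _ fun i _ => hint i p]
    refine Finset.sum_congr rfl fun i _ => ?_
    have hm : MeasurableSet (f ⁻¹' {i}) := (hf.isOpen_fiber i).measurableSet
    rw [integral_indicator hm, setIntegral_const, Complex.real_smul]
  simp_rw [key]
  refine Differentiable.fun_sum fun i hi => ?_
  obtain ⟨x, rfl⟩ := hfin.mem_toFinset.1 hi
  exact (hd x).const_mul _

end LocallyConstantFamilies

/-! ### Regularization of the kernel across F. -/

section Regularization

variable {F E : Type*} [Field F] [ValuativeRel F] [TopologicalSpace F]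
  [IsNonarchimedeanLocalField F] [Field E] [ValuativeRel E] [TopologicalSpace E]
  [IsNonarchimedeanLocalField E] [Algebra F E] [ValuativeExtension F E]

variable {b : Module.Basis (Fin 2) F E} {d : F} {ϖF : 𝒪[F]} {ϖE : 𝒪[E]} {χ : UnitChar E}
  {η : UnitChar F} {s t : ℂ}

variable (E) in
/-- Dilation of `E` by an element of `Fˣ`. -/
def dil (l : Fˣ) : E ≃ₜ+ E := mulAut (Units.map (algebraMap F E : F →* E) l)

lemma dil_apply (l : Fˣ) (x : E) : dil E l x = algebraMap F E l * x := rfl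

lemma dil_symm_apply (l : Fˣ) (x : E) : (dil E l).symm x = algebraMap F E ↑l⁻¹ * x := by
  rw [ContinuousAddEquiv.symm_apply_eq, dil_apply, ← mul_assoc, ← map_mul]
  simp

variable (b d) in
/-- The regularized integrand `κ(x₂) (gφ(x) - gφ(σ⁻¹ x))`. -/
def regIntegrand (ϖF : 𝒪[F]) (ϖE : 𝒪[E]) (χ : UnitChar E) (η : UnitChar F) (l : Fˣ) (φ : E → ℂ)
    (s t : ℂ) (x : E) : ℂ :=
  fiberChar ϖF χ η s t (b.repr x 1) * (smoothFactor b d ϖF ϖE χ η s t x * φ x -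
    smoothFactor b d ϖF ϖE χ η s t ((scaleAut b 1 l).symm x) * φ ((scaleAut b 1 l).symm x))

lemma scaleAut_symm_eq_self (l : Fˣ) {x : E} (hx : b.repr x 1 = 0) :
    (scaleAut b 1 l).symm x = x := by
  rw [scaleAut_symm]
  refine repr_ext b ?_ ?_ <;> simp [repr_scaleAut_zero, repr_scaleAut_one, hx]

/-- The origin is the only point where `smoothFactor` may fail to be locally constant, and φ
vanishes on a neighbourhood of it. -/
lemma eventually_smoothFactor_mul_eq (hb : b 0 = 1) (hd : b 1 ^ 2 = algebraMap F E d)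
    (hϖF : Irreducible ϖF) (hϖE : Irreducible ϖE) {φ : E → ℂ} (hφ : IsLocallyConstant φ)
    (h0 : φ 0 = 0) (x : E) :
    ∀ᶠ y in 𝓝 x, ∀ s t, smoothFactor b d ϖF ϖE χ η s t y * φ y =
      smoothFactor b d ϖF ϖE χ η s t x * φ x := by
  by_cases hx : x = 0
  · filter_upwards [hφ.eventually_eq x] with y hy s t
    rw [hy, hx, h0, mul_zero, mul_zero]
  · filter_upwards [hφ.eventually_eq x, eventually_smoothFactor_eq hb hd hϖF hϖE hx]
      with y hy h s t
    rw [hy, h]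

/-- The scaling fixes the points of the line x₂ = 0, so near them the two terms of the bracket
cancel and the singular factor κ is multiplied by zero. Elsewhere κ itself is locally constant. -/
lemma isLocallyConstant_regIntegrand (hb : b 0 = 1) (hd : b 1 ^ 2 = algebraMap F E d)
    (hϖF : Irreducible ϖF) (hϖE : Irreducible ϖE) (l : Fˣ) {φ : E → ℂ} (hφ : IsLocallyConstant φ)
    (h0 : φ 0 = 0) :
    IsLocallyConstant fun x (p : ℂ × ℂ) => regIntegrand b d ϖF ϖE χ η l φ p.1 p.2 x := by
  rw [IsLocallyConstant.iff_eventually_eq]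
  intro x
  have h1 := eventually_smoothFactor_mul_eq (χ := χ) (η := η) hb hd hϖF hϖE hφ h0 x
  have h2 := (scaleAut b 1 l).symm.continuous_toFun.continuousAt.eventually
    (eventually_smoothFactor_mul_eq (χ := χ) (η := η) hb hd hϖF hϖE hφ h0
      ((scaleAut b 1 l).symm x))
  by_cases hx : b.repr x 1 = 0
  · filter_upwards [h1, h2] with y h1 h2
    funext p
    have h2' := h2 p.1 p.2
    change smoothFactor b d ϖF ϖE χ η p.1 p.2 ((scaleAut b 1 l).symm y) *
      φ ((scaleAut b 1 l).symm y) = _ at h2'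
    rw [regIntegrand, regIntegrand, h1, h2', scaleAut_symm_eq_self l hx, sub_self, mul_zero,
      mul_zero]
  · filter_upwards [h1, h2, eventually_fiberChar_eq hϖF hx] with y h1 h2 h3
    funext p
    have h2' := h2 p.1 p.2
    change smoothFactor b d ϖF ϖE χ η p.1 p.2 ((scaleAut b 1 l).symm y) *
      φ ((scaleAut b 1 l).symm y) = _ at h2'
    rw [regIntegrand, regIntegrand, h1, h2', h3]

lemma hasCompactSupport_regIntegrand (l : Fˣ) {φ : E → ℂ} (hφ : HasCompactSupport φ) :
    HasCompactSupport fun x (p : ℂ × ℂ) => regIntegrand b d ϖF ϖE χ η l φ p.1 p.2 x := by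
  have h1 : HasCompactSupport fun x => φ ((scaleAut b 1 l).symm x) :=
    hφ.comp_homeomorph (scaleAut b 1 l).symm.toHomeomorph
  refine HasCompactSupport.intro (hφ.union h1) fun x hx => ?_
  rw [Set.mem_union, not_or] at hx
  funext p
  have e1 := image_eq_zero_of_notMem_tsupport hx.1
  have e2 := image_eq_zero_of_notMem_tsupport hx.2
  rw [regIntegrand, e1, e2]
  simp

variable [MeasurableSpace E] [BorelSpace E]

variable (b d) in
/-- The regularized integral of the kernel against a function vanishing near the origin. -/
def regInt (ϖF : 𝒪[F]) (ϖE : 𝒪[E]) (μ : Measure E) (χ : UnitChar E) (η : UnitChar F) (l : Fˣ)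
    (c : ℂ) (s t : ℂ) (φ : E → ℂ) : ℂ :=
  c * ∫ x, regIntegrand b d ϖF ϖE χ η l φ s t x ∂μ

lemma integral_scaleAut_symm (μ : Measure E) [μ.IsAddHaarMeasure] (l : Fˣ) (f : E → ℂ) :
    ∫ x, f ((scaleAut b 1 l).symm x) ∂μ = absv (l : F) * ∫ x, f x ∂μ := by
  have := integral_comp_continuousAddEquiv μ (scaleAut b 1 l)
    fun x => f ((scaleAut b 1 l).symm x)
  rw [this, haarChar_scaleAut, Units.val_one, absv_one, one_mul]
  simp

lemma haarChar_dil (b : Module.Basis (Fin 2) F E) (l : Fˣ) :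
    (addEquivAddHaarChar (dil E l) : ℝ) = absv (l : F) ^ 2 := by
  rw [dil, haarChar_mulAut]
  exact absv_algebraMap b _

lemma integral_dil_symm (b : Module.Basis (Fin 2) F E) (μ : Measure E) [μ.IsAddHaarMeasure]
    (l : Fˣ) (f : E → ℂ) :
    ∫ x, f ((dil E l).symm x) ∂μ = (absv (l : F) : ℂ) ^ 2 * ∫ x, f x ∂μ := by
  have := integral_comp_continuousAddEquiv μ (dil E l) fun x => f ((dil E l).symm x)
  rw [this, haarChar_dil b]
  simp

variable {μ : Measure E} [μ.IsAddHaarMeasure]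

section

variable (hb : b 0 = 1) (hd : b 1 ^ 2 = algebraMap F E d) (hϖF : Irreducible ϖF)
  (hϖE : Irreducible ϖE)

include hb hd hϖF hϖE

lemma integrable_regIntegrand (l : Fˣ) {φ : E → ℂ} (hφ : IsLocallyConstant φ)
    (hc : HasCompactSupport φ) (h0 : φ 0 = 0) (s t : ℂ) :
    Integrable (regIntegrand b d ϖF ϖE χ η l φ s t) μ := by
  refine integrable_of_isLocallyConstant ?_ ?_
  · exact (isLocallyConstant_regIntegrand (χ := χ) (η := η) hb hd hϖF hϖE l hφ h0).comp
      fun f : ℂ × ℂ → ℂ => f (s, t)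
  · exact (hasCompactSupport_regIntegrand (b := b) (d := d) (ϖF := ϖF) (ϖE := ϖE) (χ := χ) (η := η)
      l hc).comp_left (g := fun f : ℂ × ℂ → ℂ => f (s, t)) rfl

lemma differentiable_regInt (l : Fˣ) (c : ℂ) {φ : E → ℂ} (hφ : IsLocallyConstant φ)
    (hc : HasCompactSupport φ) (h0 : φ 0 = 0) :
    Differentiable ℂ fun p : ℂ × ℂ => regInt b d ϖF ϖE μ χ η l c p.1 p.2 φ := by
  refine (differentiable_integral_of_isLocallyConstant
    (isLocallyConstant_regIntegrand hb hd hϖF hϖE l hφ h0)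
    (hasCompactSupport_regIntegrand l hc) fun x => ?_).const_mul c
  unfold regIntegrand
  exact (differentiable_fiberChar _).mul
    (((differentiable_smoothFactor hb hd hϖF hϖE _).mul_const _).sub
      ((differentiable_smoothFactor hb hd hϖF hϖE _).mul_const _))

lemma regInt_add (l : Fˣ) (c : ℂ) {φ ψ : E → ℂ} (hφ : IsLocallyConstant φ)
    (hc : HasCompactSupport φ) (h0 : φ 0 = 0) (hψ : IsLocallyConstant ψ)
    (hc' : HasCompactSupport ψ) (h0' : ψ 0 = 0) :
    regInt b d ϖF ϖE μ χ η l c s t (fun x => φ x + ψ x) =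
      regInt b d ϖF ϖE μ χ η l c s t φ + regInt b d ϖF ϖE μ χ η l c s t ψ := by
  rw [regInt, regInt, regInt, ← mul_add, ← integral_add
    (integrable_regIntegrand hb hd hϖF hϖE l hφ hc h0 s t)
    (integrable_regIntegrand hb hd hϖF hϖE l hψ hc' h0' s t)]
  congr 2
  funext x
  simp only [regIntegrand]
  ring

omit hb hd hϖF hϖE in
lemma regInt_smul (l : Fˣ) (c a : ℂ) (φ : E → ℂ) :
    regInt b d ϖF ϖE μ χ η l c s t (fun x => a * φ x) =
      a * regInt b d ϖF ϖE μ χ η l c s t φ := by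
  have h : ∀ x, regIntegrand b d ϖF ϖE χ η l (fun x => a * φ x) s t x =
      a * regIntegrand b d ϖF ϖE χ η l φ s t x := fun x => by
    simp only [regIntegrand]
    ring
  rw [regInt, regInt, integral_congr_ae (Filter.Eventually.of_forall h), integral_const_mul]
  ring

variable (hχ : multChar ϖE χ 0 (algebraMap F E ϖF) = 1)

include hχ

/-- Substituting the scaling in the second term costs κ(l) from the kernel and |l| from the measure,
whence the factor 1 - κ(l)|l|, which with c is the inverse L-factor. -/
lemma regInt_eq_of_integrable {l : Fˣ} {c : ℂ}
    (hl : ∀ z r, (localL z (resChar χ * η) r)⁻¹ = c * (1 - multChar ϖF (resChar χ * η) (z + r) l))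
    {φ : E → ℂ} (hi : Integrable (fun x => kernelFun b d ϖF ϖE χ η s t x * φ x) μ) :
    regInt b d ϖF ϖE μ χ η l c s t φ = (localL (1 / 2) (resChar χ * η) (2 * s + t))⁻¹ *
      ∫ x, kernelFun b d ϖF ϖE χ η s t x * φ x ∂μ := by
  set k := fun x => kernelFun b d ϖF ϖE χ η s t x * φ x with hk
  have h1 : ∀ x, regIntegrand b d ϖF ϖE χ η l φ s t x =
      k x - fiberChar ϖF χ η s t l * k ((scaleAut b 1 l).symm x) := by
    intro x
    have e : b.repr x 1 = l * b.repr ((scaleAut b 1 l).symm x) 1 := by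
      rw [← repr_scaleAut_one b 1]; simp
    simp only [hk, kernelFun_eq hb hd hϖF hϖE hχ, regIntegrand]
    rw [mul_sub]
    congr 1
    · ring
    · rw [e, fiberChar_mul hϖF]; ring
  have hi' := integrable_comp_continuousAddEquiv μ (scaleAut b 1 l).symm hi
  rw [regInt, integral_congr_ae (Filter.Eventually.of_forall h1), integral_sub hi (hi'.const_mul _),
    integral_const_mul, integral_scaleAut_symm, hl]
  have e2 : multChar ϖF (resChar χ * η) (1 / 2 + (2 * s + t)) l =
      fiberChar ϖF χ η s t l * absv (l : F) := by
    have := multChar_add_nat ϖF (resChar χ * η) (2 * s + t - 1 / 2) 1 (l : F)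
    rw [pow_one] at this
    rw [fiberChar, ← this]
    congr 1
    push_cast
    ring
  rw [e2]
  ring

lemma dilationChar_mul_absv_sq (l : F) :
    multChar ϖF (resChar χ * η⁻¹) (1 / 2 + (2 * s - t)) l =
      dilationChar ϖF χ η s t l * (absv l : ℂ) ^ 2 := by
  have := multChar_add_nat ϖF (resChar χ * η⁻¹) (2 * s - t - 3 / 2) 2 l
  rw [dilationChar, ← this]
  congr 1
  push_cast
  ring

/-- Dilations commute with the scaling of x₂, so homogeneity of the kernel passes to the regularized
integral for all (s, t), outside the domain of convergence too. -/
lemma regInt_comp_dil_symm (l m : Fˣ) (c : ℂ) (φ : E → ℂ) :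
    regInt b d ϖF ϖE μ χ η l c s t (fun x => φ ((dil E m).symm x)) =
      multChar ϖF (resChar χ * η⁻¹) (1 / 2 + (2 * s - t)) m *
        regInt b d ϖF ϖE μ χ η l c s t φ := by
  have h : ∀ x, regIntegrand b d ϖF ϖE χ η l (fun x => φ ((dil E m).symm x)) s t x =
      dilationChar ϖF χ η s t m * regIntegrand b d ϖF ϖE χ η l φ s t ((dil E m).symm x) := by
    intro x
    obtain ⟨y, rfl⟩ := (dil E m).surjective x
    have e1 : (scaleAut b 1 l).symm (dil E m y) = dil E m ((scaleAut b 1 l).symm y) := by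
      rw [scaleAut_symm]
      refine repr_ext b ?_ ?_ <;>
      simp only [dil_apply, repr_algebraMap_mul, repr_scaleAut_zero, repr_scaleAut_one] <;> ring
    have e2 := fun y => smoothFactor_algebraMap_mul (η := η) (s := s) (t := t) hb hd hϖF hϖE hχ
      m.ne_zero y
    simp only [regIntegrand, e1, ContinuousAddEquiv.symm_apply_apply]
    rw [dil_apply, dil_apply, repr_algebraMap_mul, fiberChar_mul hϖF]
    linear_combination fiberChar ϖF χ η s t (b.repr y 1) *
      (φ y * e2 y - φ ((scaleAut b 1 l).symm y) * e2 ((scaleAut b 1 l).symm y))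
  rw [regInt, integral_congr_ae (Filter.Eventually.of_forall h), integral_const_mul,
    integral_dil_symm b, dilationChar_mul_absv_sq hb hd hϖF hϖE hχ, regInt]
  ring

end

end Regularization

lemma eq_of_eq_on_halfPlane {f g : ℂ → ℂ} (hf : Differentiable ℂ f) (hg : Differentiable ℂ g)
    (R : ℝ) (h : ∀ z : ℂ, R < z.re → f z = g z) : f = g := by
  have hf' : AnalyticOnNhd ℂ f Set.univ := fun z _ => hf.analyticAt z
  have hg' : AnalyticOnNhd ℂ g Set.univ := fun z _ => hg.analyticAt z
  refine hf'.eq_of_eventuallyEq hg' (z₀ := ((R + 1 : ℝ) : ℂ)) ?_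
  have : {z : ℂ | R < z.re} ∈ 𝓝 ((R + 1 : ℝ) : ℂ) :=
    (isOpen_lt continuous_const Complex.continuous_re).mem_nhds (by simp)
  filter_upwards [this] with z hz using h z hz

/-! ### Integrability of self-similar functions. -/

section SelfSimilar

variable {G : Type*} [AddCommGroup G] [TopologicalSpace G]
  [MeasurableSpace G] [BorelSpace G] [IsTopologicalAddGroup G] [LocallyCompactSpace G]
  (μ : Measure G) [μ.IsAddHaarMeasure] [μ.Regular]

lemma setLIntegral_image_continuousAddEquiv (φ : G ≃ₜ+ G) (f : G → ENNReal) (A : Set G) :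
    ∫⁻ x in φ '' A, f x ∂μ = addEquivAddHaarChar φ * ∫⁻ x in A, f (φ x) ∂μ := by
  let e := φ.toHomeomorph.toMeasurableEquiv
  have h : μ = (addEquivAddHaarChar φ : ENNReal) • μ.map e := (addEquivAddHaarChar_smul_map μ φ).symm
  conv_lhs => rw [h]
  rw [Measure.restrict_smul, lintegral_smul_measure, e.measurableEmbedding.restrict_map,
    e.measurableEmbedding.lintegral_map, smul_eq_mul]
  have : e ⁻¹' (φ '' A) = A := Set.preimage_image_eq _ φ.injective
  rw [this]
  rfl

/-- A function which an automorphism contracting the measure multiplies by a constant is integrable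
as soon as it is so on a fundamental domain. -/
lemma integrableOn_of_selfSimilar (φ : G ≃ₜ+ G) {U D : Set G} {f : G → ℂ} (hf : Measurable f)
    (hU : ∀ x ∈ U, f x ≠ 0 → ∃ n : ℕ, ∃ y ∈ D, φ^[n] y = x) (hD : IntegrableOn f D μ)
    {r : ℝ} (hr : ∀ x, ‖f (φ x)‖ = r * ‖f x‖) (hr0 : 0 ≤ r)
    (hlt : (addEquivAddHaarChar φ : ℝ) * r < 1) : IntegrableOn f U μ := by
  set q : ENNReal := addEquivAddHaarChar φ * ENNReal.ofReal r with hq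
  have hq1 : q < 1 := by
    have h1 : q = ENNReal.ofReal ((addEquivAddHaarChar φ : ℝ) * r) := by
      rw [ENNReal.ofReal_mul (NNReal.coe_nonneg _), ENNReal.ofReal_coe_nnreal]
    rw [h1, ← ENNReal.ofReal_one]
    exact (ENNReal.ofReal_lt_ofReal_iff one_pos).2 hlt
  have hr' : ∀ x, ‖f (φ x)‖ₑ = ENNReal.ofReal r * ‖f x‖ₑ := fun x => by
    rw [← ofReal_norm, hr, ENNReal.ofReal_mul hr0, ofReal_norm]
  -- The images of D contribute a geometric series of ratio q < 1. They need only cover the points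
  -- where f is nonzero; the zero set is added separately.
  have hn : ∀ n : ℕ, ∫⁻ x in φ^[n] '' D, ‖f x‖ₑ ∂μ = q ^ n * ∫⁻ x in D, ‖f x‖ₑ ∂μ := by
    intro n
    induction n with
    | zero => simp
    | succ n ih =>
      have : φ^[n + 1] '' D = φ '' (φ^[n] '' D) := by
        rw [Function.iterate_succ', Set.image_comp]
      rw [this, setLIntegral_image_continuousAddEquiv]
      simp_rw [hr']
      rw [lintegral_const_mul _ hf.enorm, ih, hq]
      ring
  have hsub : U ⊆ {x | f x = 0} ∪ ⋃ n : ℕ, φ^[n] '' D := by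
    intro x hx
    by_cases h : f x = 0
    · exact Or.inl h
    · obtain ⟨n, y, hy, e⟩ := hU x hx h
      exact Or.inr (Set.mem_iUnion.2 ⟨n, y, hy, e⟩)
  refine ⟨hf.aestronglyMeasurable, ?_⟩
  rw [hasFiniteIntegral_iff_enorm]
  have h0 : ∫⁻ x in {x | f x = 0}, ‖f x‖ₑ ∂μ = 0 := by
    have hm : MeasurableSet {x | f x = 0} := hf (measurableSet_singleton 0)
    rw [setLIntegral_congr_fun (g := fun _ => 0) hm fun x hx => by
      simp [show f x = 0 from hx]]
    simp
  calc ∫⁻ x in U, ‖f x‖ₑ ∂μ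
      ≤ ∫⁻ x in {x | f x = 0} ∪ ⋃ n : ℕ, φ^[n] '' D, ‖f x‖ₑ ∂μ := lintegral_mono_set hsub
    _ ≤ ∫⁻ x in {x | f x = 0}, ‖f x‖ₑ ∂μ + ∫⁻ x in ⋃ n : ℕ, φ^[n] '' D, ‖f x‖ₑ ∂μ :=
        lintegral_union_le _ _ _
    _ ≤ 0 + ∑' n : ℕ, ∫⁻ x in φ^[n] '' D, ‖f x‖ₑ ∂μ := by
        gcongr
        · exact h0.le
        · exact lintegral_iUnion_le _ _
    _ = (1 - q)⁻¹ * ∫⁻ x in D, ‖f x‖ₑ ∂μ := by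
        simp_rw [hn, zero_add]
        rw [ENNReal.tsum_mul_right, ENNReal.tsum_geometric]
    _ < ⊤ := by
        refine ENNReal.mul_lt_top (ENNReal.inv_lt_top.2 (tsub_pos_of_lt hq1)) ?_
        exact (hasFiniteIntegral_iff_enorm).1 hD.2

end SelfSimilar

/-! ### Local integrability of the kernel. -/

section LocalIntegrability

variable {F E : Type*} [Field F] [ValuativeRel F] [TopologicalSpace F]
  [IsNonarchimedeanLocalField F] [Field E] [ValuativeRel E] [TopologicalSpace E]
  [IsNonarchimedeanLocalField E] [Algebra F E] [ValuativeExtension F E]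

variable {b : Module.Basis (Fin 2) F E} {d : F} {ϖF : 𝒪[F]} {ϖE : 𝒪[E]} {χ : UnitChar E}
  {η : UnitChar F} {s t : ℂ} [MeasurableSpace E] [BorelSpace E]

lemma measurable_of_eventuallyEq_off_line (b : Module.Basis (Fin 2) F E) {f : E → ℂ}
    (h0 : ∀ x, b.repr x 1 = 0 → f x = 0) (h1 : ∀ x, b.repr x 1 ≠ 0 → ∀ᶠ y in 𝓝 x, f y = f x) :
    Measurable f := by
  classical
  have hm : IsClosed {x : E | b.repr x 1 = 0} :=
    isClosed_singleton.preimage (continuous_repr b 1)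
  have e : f = Set.piecewise {x : E | b.repr x 1 = 0} (fun _ => 0) f := by
    funext x
    by_cases hx : b.repr x 1 = 0
    · simp [Set.piecewise, hx, h0 x hx]
    · simp [Set.piecewise, hx]
  rw [e]
  refine ContinuousOn.measurable_piecewise continuousOn_const (fun x hx => ?_) hm.measurableSet
  exact (continuousAt_const.congr (Filter.EventuallyEq.symm (h1 x hx))).continuousWithinAt

lemma measurable_fiberChar (hϖF : Irreducible ϖF) :
    Measurable fun x : E => fiberChar ϖF χ η s t (b.repr x 1) :=
  measurable_of_eventuallyEq_off_line b (fun x hx => by simp only [hx, fiberChar_zero])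
    fun x hx => (eventually_fiberChar_eq hϖF hx).mono fun y hy => hy s t

variable {μ : Measure E} [μ.IsAddHaarMeasure]

lemma norm_fiberChar_mul_uniformizer (hϖF : Irreducible ϖF) (hs : 0 < (2 * s + t + 1 / 2).re) :
    (resCard F : ℝ)⁻¹ * ‖fiberChar ϖF χ η s t (ϖF : F)‖ < 1 := by
  rw [fiberChar, norm_multChar hϖF _ _ (uniformizer_ne_zero hϖF), absv_uniformizer hϖF]
  have hq := one_lt_resCard_real (K := F)
  have hq0 : (0 : ℝ) < (resCard F : ℝ)⁻¹ := inv_pos.2 resCard_pos_real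
  conv_lhs => enter [1]; rw [← Real.rpow_one (resCard F : ℝ)⁻¹]
  rw [← Real.rpow_add hq0]
  refine Real.rpow_lt_one hq0.le (inv_lt_one_of_one_lt₀ hq) ?_
  simp at hs ⊢
  linarith

/-- Scaling x₂ by ϖF contracts measure by q⁻¹ and multiplies κ by κ(ϖF), and the part of the box
with |x₂| maximal is a fundamental domain. The condition on (s, t) says exactly that the product of
the two factors has absolute value less than 1. -/
lemma integrableOn_fiberChar_box (hϖF : Irreducible ϖF) (hs : 0 < (2 * s + t + 1 / 2).re)
    (r : ℝ) (j : ℤ) :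
    IntegrableOn (fun x : E => fiberChar ϖF χ η s t (b.repr x 1))
      (box b r ((resCard F : ℝ) ^ j)) μ := by
  let w : Fˣ := Units.mk0 (ϖF : F) (uniformizer_ne_zero hϖF)
  have hq := one_lt_resCard_real (K := F)
  refine integrableOn_of_selfSimilar μ (scaleAut b 1 w)
    (D := {x | x ∈ box b r ((resCard F : ℝ) ^ j) ∧ absv (b.repr x 1) = (resCard F : ℝ) ^ j})
    (measurable_fiberChar hϖF) (fun x hx h0 => ?_) ?_
    (r := ‖fiberChar ϖF χ η s t (ϖF : F)‖) (fun x => ?_) (norm_nonneg _) ?_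
  · have hx1 : b.repr x 1 ≠ 0 := fun h => h0 (by simp only [h, fiberChar_zero])
    have h2 := hx.2
    rw [absv_of_ne_zero hx1, zpow_le_zpow_iff_right₀ hq] at h2
    obtain ⟨n, hn⟩ : ∃ n : ℕ, (n : ℤ) = ord (b.repr x 1) + j := ⟨(ord (b.repr x 1) + j).toNat, by omega⟩
    have hit : ∀ (n : ℕ) (y : E), (scaleAut b 1 w)^[n] y = scaleAut b 1 (w ^ n) y := by
      intro n
      induction n with
      | zero => intro y; exact repr_ext b (by simp [repr_scaleAut_zero]) (by simp [repr_scaleAut_one])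
      | succ n ih =>
        intro y
        rw [Function.iterate_succ_apply', ih]
        refine repr_ext b ?_ ?_
        · simp [repr_scaleAut_zero]
        · simp [repr_scaleAut_one, pow_succ', mul_assoc]
    refine ⟨n, (scaleAut b 1 (w ^ n)).symm x, ?_, by rw [hit]; simp⟩
    have e : absv (b.repr ((scaleAut b 1 (w ^ n)).symm x) 1) = (resCard F : ℝ) ^ j := by
      rw [scaleAut_symm, repr_scaleAut_one, absv_mul, Units.val_inv_eq_inv_val, absv_inv,
        Units.val_pow_eq_pow_val, absv_pow, absv_of_ne_zero hx1]
      change ((absv (ϖF : F)) ^ n)⁻¹ * _ = _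
      rw [absv_uniformizer hϖF, inv_pow, inv_inv, ← zpow_natCast, hn,
        ← zpow_add₀ resCard_pos_real.ne']
      congr 1; ring
    refine ⟨⟨?_, e.le⟩, e⟩
    rw [scaleAut_symm, repr_scaleAut_zero]
    simpa using hx.1
  · refine ContinuousOn.integrableOn_compact ?_ ?_
    · exact (isCompact_box b _ _).inter_right
        ((isClopen_absv_eq (zpow_pos resCard_pos_real j)).isClosed.preimage (continuous_repr b 1))
    · intro x hx
      have hx1 : b.repr x 1 ≠ 0 := fun h => by
        have := hx.2
        rw [h, absv_zero] at this
        exact (zpow_pos resCard_pos_real j).ne this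
      refine ContinuousAt.continuousWithinAt ?_
      have h : (fun y : E => fiberChar ϖF χ η s t (b.repr y 1)) =ᶠ[𝓝 x]
          fun _ => fiberChar ϖF χ η s t (b.repr x 1) :=
        (eventually_fiberChar_eq hϖF hx1).mono fun y hy => hy s t
      exact continuousAt_const.congr h.symm
  · rw [repr_scaleAut_one, fiberChar_mul hϖF, norm_mul]
    rfl
  · rw [haarChar_scaleAut, Units.val_one, absv_one, one_mul]
    change absv (ϖF : F) * _ < 1
    rw [absv_uniformizer hϖF]
    exact norm_fiberChar_mul_uniformizer hϖF hs

variable (hb : b 0 = 1) (hd : b 1 ^ 2 = algebraMap F E d) (hϖF : Irreducible ϖF)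
  (hϖE : Irreducible ϖE) (hχ : multChar ϖE χ 0 (algebraMap F E ϖF) = 1)

include hb hd hϖF hϖE hχ

lemma kernelFun_eq_zero_of_repr {x : E} (hx : b.repr x 1 = 0) :
    kernelFun b d ϖF ϖE χ η s t x = 0 := by
  rw [kernelFun_eq hb hd hϖF hϖE hχ, hx, fiberChar_zero, mul_zero]

lemma kernelFun_ne_zero {x : E} (hx : b.repr x 1 ≠ 0) :
    kernelFun b d ϖF ϖE χ η s t x ≠ 0 := by
  rw [kernelFun_eq hb hd hϖF hϖE hχ]
  exact mul_ne_zero (smoothFactor_ne_zero hb hd hϖF hϖE fun h => hx (by simp [h]))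
    (fiberChar_ne_zero hϖF hx)

lemma eventually_kernelFun_eq {x : E} (hx : b.repr x 1 ≠ 0) :
    ∀ᶠ y in 𝓝 x, kernelFun b d ϖF ϖE χ η s t y = kernelFun b d ϖF ϖE χ η s t x := by
  filter_upwards [eventually_fiberChar_eq hϖF hx, eventually_smoothFactor_eq hb hd hϖF hϖE
    (show x ≠ 0 from fun h => hx (by simp [h]))] with y h1 h2
  rw [kernelFun_eq hb hd hϖF hϖE hχ, kernelFun_eq hb hd hϖF hϖE hχ, h1, h2]

lemma measurable_kernelFun : Measurable (kernelFun b d ϖF ϖE χ η s t) :=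
  measurable_of_eventuallyEq_off_line b (fun _ => kernelFun_eq_zero_of_repr hb hd hϖF hϖE hχ)
    fun _ => eventually_kernelFun_eq hb hd hϖF hϖE hχ

lemma integrableAt_kernelFun (hs : 0 < (2 * s + t + 1 / 2).re) {x : E} (hx : x ≠ 0) :
    IntegrableAtFilter (kernelFun b d ϖF ϖE χ η s t) (𝓝 x) μ := by
  obtain ⟨n, hn⟩ := pow_unbounded_of_one_lt (absv (b.repr x 1)) (one_lt_resCard_real (K := F))
  have h1 := eventually_smoothFactor_eq (χ := χ) (η := η) hb hd hϖF hϖE hx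
  obtain ⟨V, hV, hVo, hxV⟩ := eventually_nhds_iff.1 h1
  let B := box b (absv (b.repr x 0) + 1) ((resCard F : ℝ) ^ (n : ℤ))
  have hB : IsClopen B := isClopen_box b (by linarith [absv_nonneg (b.repr x 0)])
    (zpow_pos resCard_pos_real _)
  have hxB : x ∈ B := ⟨by linarith, by rw [zpow_natCast]; exact hn.le⟩
  refine ⟨V ∩ B, (hVo.inter hB.isOpen).mem_nhds ⟨hxV, hxB⟩, ?_⟩
  have h2 := (integrableOn_fiberChar_box (χ := χ) (η := η) (b := b) (μ := μ) hϖF hs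
    (absv (b.repr x 0) + 1) (n : ℤ)).mono_set (Set.inter_subset_right (s := V))
  refine IntegrableOn.congr_fun (h2.const_mul (smoothFactor b d ϖF ϖE χ η s t x)) (fun y hy => ?_)
    (hVo.inter hB.isOpen).measurableSet
  rw [kernelFun_eq hb hd hϖF hϖE hχ, hV y hy.1]

lemma integrableOn_kernelFun_of_isCompact (hs : 0 < (2 * s + t + 1 / 2).re) {S : Set E}
    (hS : IsCompact S) (h0 : (0 : E) ∉ S) : IntegrableOn (kernelFun b d ϖF ϖE χ η s t) S μ := by
  refine LocallyIntegrableOn.integrableOn_isCompact (fun x hx => ?_) hS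
  exact (integrableAt_kernelFun hb hd hϖF hϖE hχ hs fun h => h0 (h ▸ hx)).filter_mono
    nhdsWithin_le_nhds

/-- At the origin the contraction is dilation by ϖF, with measure factor q⁻² and a kernel factor
such that the product has size q^{-Re(2s-t+1/2)}. Away from the origin only the first condition
matters. -/
lemma locallyIntegrable_kernelFun (hs : 0 < (2 * s + t + 1 / 2).re)
    (hs' : 0 < (2 * s - t + 1 / 2).re) : LocallyIntegrable (kernelFun b d ϖF ϖE χ η s t) μ := by
  intro x
  by_cases hx : x ≠ 0
  · exact integrableAt_kernelFun hb hd hϖF hϖE hχ hs hx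
  rw [not_not] at hx
  subst hx
  have hq := one_lt_resCard_real (K := F)
  have hq2 : (1 : ℝ) < (resCard F : ℝ) ^ 2 := by nlinarith
  have hw : absv (algebraMap F E ϖF) = ((resCard F : ℝ) ^ 2)⁻¹ := by
    rw [absv_algebraMap b, absv_uniformizer hϖF, inv_pow]
  let w : Fˣ := Units.mk0 (ϖF : F) (uniformizer_ne_zero hϖF)
  refine ⟨{x | absv x ≤ 1}, (isClopen_absv_le one_pos).isOpen.mem_nhds (by simp [absv_zero]), ?_⟩
  refine integrableOn_of_selfSimilar μ (dil E w)
    (D := {x | absv x ≤ 1} ∩ {x | absv x ≤ ((resCard F : ℝ) ^ 2)⁻¹}ᶜ)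
    (measurable_kernelFun hb hd hϖF hϖE hχ) (fun x hx h0 => ?_) ?_
    (r := ‖dilationChar ϖF χ η s t (ϖF : F)‖) (fun x => ?_) (norm_nonneg _) ?_
  · have hx0 : x ≠ 0 := fun h => h0 (kernelFun_eq_zero_of_repr hb hd hϖF hϖE hχ (by simp [h]))
    have hxp := absv_pos hx0
    obtain ⟨n, hn1, hn2⟩ := exists_nat_pow_near ((one_le_inv₀ hxp).2 hx) hq2
    have hit : ∀ (n : ℕ) (y : E), (dil E w)^[n] y = algebraMap F E ϖF ^ n * y := by
      intro n
      induction n with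
      | zero => intro y; simp
      | succ n ih =>
        intro y
        rw [Function.iterate_succ_apply', ih, dil_apply, pow_succ', mul_assoc]
        rfl
    have hw0 : algebraMap F E ϖF ≠ 0 := by
      intro h; rw [h, absv_zero] at hw; exact absurd hw (by positivity)
    refine ⟨n, (algebraMap F E ϖF ^ n)⁻¹ * x, ?_, ?_⟩
    · simp only [Set.mem_inter_iff, Set.mem_compl_iff, Set.mem_ofPred_eq, not_le, absv_mul, absv_inv,
        absv_pow, hw, inv_pow, inv_inv]
      constructor
      · have := mul_le_mul_of_nonneg_right hn1 hxp.le
        rwa [inv_mul_cancel₀ hxp.ne'] at this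
      · have := mul_lt_mul_of_pos_right hn2 hxp
        rw [inv_mul_cancel₀ hxp.ne', pow_succ] at this
        rw [inv_lt_iff_one_lt_mul₀ (by positivity)]
        linarith
    · rw [hit, ← mul_assoc, mul_inv_cancel₀ (pow_ne_zero _ hw0), one_mul]
  · refine integrableOn_kernelFun_of_isCompact hb hd hϖF hϖE hχ hs ?_ ?_
    · exact (isCompact_absv_le 1).inter_right (isClopen_absv_le (by positivity)).compl.isClosed
    · simp only [Set.mem_inter_iff, Set.mem_compl_iff, Set.mem_ofPred_eq, not_and, not_not, absv_zero]
      intro; positivity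
  · rw [dil_apply, ← norm_mul]
    congr 1
    exact kernelFun_algebraMap_mul hb hd hϖF hϖE hχ (uniformizer_ne_zero hϖF) x
  · rw [haarChar_dil b]
    change absv (ϖF : F) ^ 2 * _ < 1
    rw [dilationChar, norm_multChar hϖF _ _ (uniformizer_ne_zero hϖF), absv_uniformizer hϖF]
    have hq0 : (0 : ℝ) < (resCard F : ℝ)⁻¹ := inv_pos.2 resCard_pos_real
    rw [← Real.rpow_natCast, ← Real.rpow_add hq0]
    refine Real.rpow_lt_one hq0.le (inv_lt_one_of_one_lt₀ hq) ?_
    simp at hs' ⊢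
    linarith

end LocalIntegrability

/-! ### Existence and uniqueness of the holomorphic family. -/

section Renormalization

variable {F E : Type*} [Field F] [ValuativeRel F] [TopologicalSpace F]
  [IsNonarchimedeanLocalField F] [Field E] [ValuativeRel E] [TopologicalSpace E]
  [IsNonarchimedeanLocalField E] [Algebra F E] [ValuativeExtension F E]

variable {b : Module.Basis (Fin 2) F E} {d : F} {ϖF : 𝒪[F]} {ϖE : 𝒪[E]} {χ : UnitChar E}
  {η : UnitChar F} [MeasurableSpace E] [BorelSpace E] {μ : Measure E} [μ.IsAddHaarMeasure]

lemma testFunctions_isLocallyConstant (φ : testFunctions E) : IsLocallyConstant (φ : E → ℂ) := φ.2.1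

lemma testFunctions_hasCompactSupport (φ : testFunctions E) : HasCompactSupport (φ : E → ℂ) := φ.2.2

lemma isLocallyConstant_sub_dil {φ : E → ℂ} (hφ : IsLocallyConstant φ) (m : Fˣ) :
    IsLocallyConstant fun x => φ x - φ ((dil E m).symm x) :=
  hφ.sub (hφ.comp_continuous (dil E m).symm.continuous_toFun)

lemma hasCompactSupport_comp_dil {φ : E → ℂ} (hφ : HasCompactSupport φ) (m : Fˣ) :
    HasCompactSupport fun x => φ ((dil E m).symm x) :=
  hφ.comp_homeomorph (dil E m).symm.toHomeomorph

lemma hasCompactSupport_sub_dil {φ : E → ℂ} (hφ : HasCompactSupport φ) (m : Fˣ) :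
    HasCompactSupport fun x => φ x - φ ((dil E m).symm x) := by
  refine HasCompactSupport.intro (hφ.union (hasCompactSupport_comp_dil hφ m)) fun x hx => ?_
  rw [Set.mem_union, not_or] at hx
  have e1 := image_eq_zero_of_notMem_tsupport hx.1
  have e2 := image_eq_zero_of_notMem_tsupport hx.2
  rw [e1, e2, sub_zero]

lemma sub_dil_zero (φ : E → ℂ) (m : Fˣ) : φ 0 - φ ((dil E m).symm 0) = 0 := by simp

variable (hb : b 0 = 1) (hd : b 1 ^ 2 = algebraMap F E d) (hϖF : Irreducible ϖF)
  (hϖE : Irreducible ϖE)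

variable (χ η μ) in
/-- The renormalized kernel, by regularization along `F` (with `l`) and at the origin (with `m`). -/
def renormKernel (l m : Fˣ) (c c' : ℂ) (s t : ℂ) : Distr E where
  toFun φ := c' * regInt b d ϖF ϖE μ χ η l c s t fun x => φ x - φ ((dil E m).symm x)
  map_add' φ ψ := by
    have h : (fun x => (φ + ψ) x - (φ + ψ) ((dil E m).symm x)) = fun x =>
        (φ x - φ ((dil E m).symm x)) + (ψ x - ψ ((dil E m).symm x)) := by
      funext x
      change (φ x + ψ x) - (φ _ + ψ _) = _
      ring
    rw [h, regInt_add hb hd hϖF hϖE l c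
      (isLocallyConstant_sub_dil (testFunctions_isLocallyConstant φ) m)
      (hasCompactSupport_sub_dil (testFunctions_hasCompactSupport φ) m) (sub_dil_zero _ m)
      (isLocallyConstant_sub_dil (testFunctions_isLocallyConstant ψ) m)
      (hasCompactSupport_sub_dil (testFunctions_hasCompactSupport ψ) m) (sub_dil_zero _ m), mul_add]
  map_smul' a φ := by
    have h : (fun x => (a • φ) x - (a • φ) ((dil E m).symm x)) = fun x =>
        a * (φ x - φ ((dil E m).symm x)) := by
      funext x
      change a * φ x - a * φ _ = _
      ring
    rw [h, regInt_smul]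
    simp only [RingHom.id_apply, smul_eq_mul]
    ring

variable (hχ : multChar ϖE χ 0 (algebraMap F E ϖF) = 1)

include hb hd hϖF hϖE hχ

lemma integrable_kernelFun_mul_testFunction {s t : ℂ} (hs : 0 < (2 * s + t + 1 / 2).re)
    (hs' : 0 < (2 * s - t + 1 / 2).re) (φ : testFunctions E) :
    Integrable (fun x => kernelFun b d ϖF ϖE χ η s t x * φ x) μ := by
  have := (locallyIntegrable_kernelFun (μ := μ) hb hd hϖF hϖE hχ (η := η) hs hs')
  have h2 := this.integrable_smul_right_of_hasCompactSupport
    (testFunctions_isLocallyConstant φ).continuous (testFunctions_hasCompactSupport φ)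
  simpa [smul_eq_mul] using h2

/-- Besides existence this records two facts used for the supports: the integral formula holds at
any (s, t) at which the product with φ happens to be integrable, and for φ(0) = 0 the origin needs
no regularization, so that the second inverse L-factor splits off and kills such φ on `//`. -/
theorem exists_renormalization : ∃ (Kt : ℂ → ℂ → Distr E) (l : Fˣ) (c : ℂ),
    IsRenormalizedKernel b d ϖF ϖE μ χ η Kt ∧
    (∀ (s t : ℂ) (φ : testFunctions E),
      Integrable (fun x => kernelFun b d ϖF ϖE χ η s t x * φ x) μ →
        Kt s t φ = normFactor χ η s t * ∫ x, kernelFun b d ϖF ϖE χ η s t x * φ x ∂μ) ∧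
    (∀ (s t : ℂ) (φ : testFunctions E), φ 0 = 0 →
      Kt s t φ = (localL (1 / 2) (resChar χ * η⁻¹) (2 * s - t))⁻¹ *
        regInt b d ϖF ϖE μ χ η l c s t φ) ∧
    (∀ z r, (localL z (resChar χ * η) r)⁻¹ =
      c * (1 - multChar ϖF (resChar χ * η) (z + r) l)) ∧
    c ≠ 0 ∧ (resChar χ * η = 1 → (l : F) = ϖF ∧ c = 1) ∧
    (resChar χ * η ≠ 1 → absv (l : F) = 1) ∧
    (resChar χ * η⁻¹ = 1 → ∀ (s t : ℂ) (φ : testFunctions E), Kt s t φ =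
      regInt b d ϖF ϖE μ χ η l c s t fun x => φ x - φ (algebraMap F E (ϖF : F)⁻¹ * x)) := by
  obtain ⟨l, c, hl0, hc0, hl1, hl2, hl⟩ := exists_inv_localL_eq hϖF (resChar χ * η)
  obtain ⟨m, c', hm0, hc0', hm1, -, hm⟩ := exists_inv_localL_eq hϖF (resChar χ * η⁻¹)
  lift l to Fˣ using hl0.isUnit
  lift m to Fˣ using hm0.isUnit
  set Kt := renormKernel χ η μ hb hd hϖF hϖE l m c c' with hKt
  have hK : ∀ s t (φ : testFunctions E), Kt s t φ =
      c' * regInt b d ϖF ϖE μ χ η l c s t fun x => φ x - φ ((dil E m).symm x) :=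
    fun _ _ _ => rfl
  have hint : ∀ (s t : ℂ) (φ : testFunctions E),
      Integrable (fun x => kernelFun b d ϖF ϖE χ η s t x * φ x) μ →
        Kt s t φ = normFactor χ η s t * ∫ x, kernelFun b d ϖF ϖE χ η s t x * φ x ∂μ := by
    intro s t φ hi
    have e : ∀ x, kernelFun b d ϖF ϖE χ η s t x * (φ x - φ ((dil E m).symm x)) =
        kernelFun b d ϖF ϖE χ η s t x * φ x - dilationChar ϖF χ η s t m *
          (kernelFun b d ϖF ϖE χ η s t ((dil E m).symm x) * φ ((dil E m).symm x)) := by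
      intro x
      obtain ⟨y, rfl⟩ := (dil E m).surjective x
      simp only [ContinuousAddEquiv.symm_apply_apply]
      rw [dil_apply, kernelFun_algebraMap_mul hb hd hϖF hϖE hχ m.ne_zero]
      ring
    have hi2 := (integrable_comp_continuousAddEquiv μ (dil E m).symm hi).const_mul
      (dilationChar ϖF χ η s t m)
    have hi3 : Integrable (fun x => kernelFun b d ϖF ϖE χ η s t x *
        (φ x - φ ((dil E m).symm x))) μ :=
      (hi.sub hi2).congr (Filter.Eventually.of_forall fun x => (e x).symm)
    rw [hK, regInt_eq_of_integrable hb hd hϖF hϖE hχ hl hi3,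
      integral_congr_ae (Filter.Eventually.of_forall e), integral_sub hi hi2, integral_const_mul,
      integral_dil_symm b μ m fun x => kernelFun b d ϖF ϖE χ η s t x * φ x, normFactor, hm,
      dilationChar_mul_absv_sq hb hd hϖF hϖE hχ]
    ring
  refine ⟨Kt, l, c, ⟨fun φ => ?_, fun s t hs hs' => ?_, fun s t hs hs' φ => ?_⟩, hint,
    fun s t φ h0 => ?_, hl, hc0, hl1, hl2, fun h s t φ => ?_⟩
  · exact (differentiable_regInt hb hd hϖF hϖE l c
      (isLocallyConstant_sub_dil (testFunctions_isLocallyConstant φ) m)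
      (hasCompactSupport_sub_dil (testFunctions_hasCompactSupport φ) m)
      (sub_dil_zero _ m)).const_mul c'
  · exact locallyIntegrable_kernelFun hb hd hϖF hϖE hχ hs hs'
  · exact hint s t φ (integrable_kernelFun_mul_testFunction hb hd hϖF hϖE hχ hs hs' φ)
  -- As φ(0) = 0, the two terms of φ - φ(m⁻¹·) can be regularized separately, and homogeneity makes
  -- the second a multiple of the first.
  · have hlc := testFunctions_isLocallyConstant φ
    have hcs := testFunctions_hasCompactSupport φ
    have e : (fun x => φ x - φ ((dil E m).symm x)) = fun x =>
        φ x + (-1) * φ ((dil E m).symm x) := by funext x; ring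
    rw [hK, e, regInt_add hb hd hϖF hϖE l c hlc hcs h0, regInt_smul,
      regInt_comp_dil_symm hb hd hϖF hϖE hχ, hm]
    · ring
    · exact (hlc.comp_continuous (dil E m).symm.continuous_toFun).comp fun z => (-1) * z
    · exact (hasCompactSupport_comp_dil hcs m).mul_left
    · simp [h0]
  · obtain ⟨h1, h2⟩ := hm1 h
    rw [hK, h2, one_mul]
    congr 1
    funext x
    rw [dil_symm_apply, Units.val_inv_eq_inv_val, h1]

omit hχ [BorelSpace E] [μ.IsAddHaarMeasure] in
-- Along the line (s + z, t) both families are entire in z, and large Re z lies in the domain where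
-- both are given by the same integral.
lemma IsRenormalizedKernel.unique {Kt Kt' : ℂ → ℂ → Distr E}
    (h : IsRenormalizedKernel b d ϖF ϖE μ χ η Kt)
    (h' : IsRenormalizedKernel b d ϖF ϖE μ χ η Kt') : Kt = Kt' := by
  funext s t
  ext φ
  have key := eq_of_eq_on_halfPlane (f := fun z => Kt (s + z) t φ) (g := fun z => Kt' (s + z) t φ)
    ((h.holomorphic φ).comp (f := fun z : ℂ => (s + z, t)) (by fun_prop))
    ((h'.holomorphic φ).comp (f := fun z : ℂ => (s + z, t)) (by fun_prop))
    (|t.re| + |s.re|) fun z hz => by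
      have h1 : 0 < (2 * (s + z) + t + 1 / 2).re := by
        simp
        linarith [neg_abs_le t.re, neg_abs_le s.re, abs_nonneg s.re, abs_nonneg t.re]
      have h2 : 0 < (2 * (s + z) - t + 1 / 2).re := by
        simp
        linarith [le_abs_self t.re, neg_abs_le s.re, abs_nonneg s.re, abs_nonneg t.re]
      rw [h.eq_integral _ _ h1 h2, h'.eq_integral _ _ h1 h2]
  simpa using congrFun key 0

end Renormalization

/-! ### Period lattices and the zeros of the inverse L-factors. -/

section Periods

variable {K : Type*} [Field K] [ValuativeRel K] [TopologicalSpace K]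
  [IsNonarchimedeanLocalField K]

lemma log_resCard_ne_zero : (Real.log (resCard K) : ℂ) ≠ 0 := by
  exact_mod_cast (Real.log_pos one_lt_resCard_real).ne'

lemma resCard_cpow (z : ℂ) : (resCard K : ℂ) ^ z = Complex.exp (Real.log (resCard K) * z) := by
  have h : (resCard K : ℂ) ≠ 0 := by exact_mod_cast (resCard_pos_real (K := K)).ne'
  rw [Complex.cpow_def_of_ne_zero h, Complex.natCast_log]

lemma mem_periods_iff {z : ℂ} : z ∈ periods K ↔ (resCard K : ℂ) ^ z = 1 := by
  rw [resCard_cpow, Complex.exp_eq_one_iff]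
  refine exists_congr fun n => ?_
  rw [← mul_div_assoc, eq_div_iff log_resCard_ne_zero, mul_comm z]

lemma inv_localL_eq_zero_iff {ξ : UnitChar K} {r : ℂ} :
    (localL (1 / 2) ξ r)⁻¹ = 0 ↔ ξ = 1 ∧ r + 1 / 2 ∈ periods K := by
  rw [localL, mem_periods_iff]
  split_ifs with h
  · rw [inv_inv, sub_eq_zero, show -(1 / 2 : ℂ) - r = -(r + 1 / 2) by ring, Complex.cpow_neg,
      eq_comm, inv_eq_one]
    simp [h]
  · simp [h]

end Periods

/-! ### Indicators of compact open sets, and supports of distributions. -/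

section Support

variable {E : Type*} [TopologicalSpace E]

lemma isLocallyConstant_indicator_one {S : Set E} (hS : IsClopen S) :
    IsLocallyConstant (S.indicator (1 : E → ℂ)) := by
  rw [IsLocallyConstant.iff_eventually_eq]
  intro x
  by_cases hx : x ∈ S
  · filter_upwards [hS.isOpen.mem_nhds hx] with y hy
    rw [Set.indicator_of_mem hy, Set.indicator_of_mem hx]
    rfl
  · filter_upwards [hS.compl.isOpen.mem_nhds hx] with y hy
    rw [Set.indicator_of_notMem hy, Set.indicator_of_notMem hx]

/-- The indicator of a compact open set, as a test function. -/
def indicatorTest (S : Set E) (hS : IsClopen S) (hc : IsCompact S) : testFunctions E :=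
  ⟨S.indicator 1, isLocallyConstant_indicator_one hS,
    HasCompactSupport.intro' hc hS.isClosed fun x hx => by simp [hx]⟩

lemma indicatorTest_apply (S : Set E) (hS : IsClopen S) (hc : IsCompact S) (x : E) :
    indicatorTest S hS hc x = S.indicator (1 : E → ℂ) x := rfl

lemma tsupport_indicatorTest_subset (S : Set E) (hS : IsClopen S) (hc : IsCompact S) :
    tsupport (indicatorTest S hS hc) ⊆ S :=
  closure_minimal (fun x hx => by
    by_contra h
    exact hx (by rw [indicatorTest_apply]; simp [h])) hS.isClosed

lemma isClosed_dsupport (T : Distr E) : IsClosed (Distribution.dsupport T) :=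
  isClosed_sInter fun _ h => h.2

lemma dsupport_zero : Distribution.dsupport (0 : Distr E) = ∅ := by
  rw [Set.eq_empty_iff_forall_notMem]
  intro x hx
  obtain ⟨u, -, hu⟩ := (Distribution.mem_dsupport_iff_forall_exists_ne x).1 hx Set.univ trivial
    isOpen_univ
  exact hu rfl

end Support

/-! ### The cases where the support is E or F. -/

section Renormalization

variable {F E : Type*} [Field F] [ValuativeRel F] [TopologicalSpace F]
  [IsNonarchimedeanLocalField F] [Field E] [ValuativeRel E] [TopologicalSpace E]
  [IsNonarchimedeanLocalField E] [Algebra F E] [ValuativeExtension F E]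

variable {b : Module.Basis (Fin 2) F E} {d : F} {ϖF : 𝒪[F]} {ϖE : 𝒪[E]} {χ : UnitChar E}
  {η : UnitChar F} {s t : ℂ} [MeasurableSpace E] [BorelSpace E] {μ : Measure E}
  [μ.IsAddHaarMeasure]

lemma normFactor_eq_zero_iff : normFactor χ η s t = 0 ↔
    (χ, s, η, t) ∈ slashSet F E ∪ backslashSet F E := by
  rw [normFactor, mul_eq_zero, inv_localL_eq_zero_iff, inv_localL_eq_zero_iff, or_comm]
  rfl

lemma measureReal_pos_of_isOpen_of_isCompact {S : Set E} (hS : IsOpen S) (hc : IsCompact S)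
    (hne : S.Nonempty) : 0 < μ.real S :=
  ENNReal.toReal_pos (hS.measure_pos μ hne).ne' hc.measure_lt_top.ne

lemma exists_ball_subset {K : Type*} [Field K] [ValuativeRel K] [TopologicalSpace K]
    [IsNonarchimedeanLocalField K] {x : K} {U : Set K} (hU : U ∈ 𝓝 x) :
    ∃ r > 0, {y | absv (y - x) ≤ r} ⊆ U := by
  obtain ⟨n, -, hn⟩ := (hasBasis_nhds_absv x).mem_iff.1 hU
  exact ⟨_, zpow_pos resCard_pos_real _, hn⟩

lemma setOf_repr_one_eq_zero (hb : b 0 = 1) :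
    {x : E | b.repr x 1 = 0} = Set.range (algebraMap F E) := by
  ext x
  constructor
  · intro h
    refine ⟨b.repr x 0, ?_⟩
    conv_rhs => rw [eq_coords hb x, show b.repr x 1 = 0 from h]
    simp
  · rintro ⟨a, rfl⟩
    exact repr_algebraMap_one hb a

variable (hb : b 0 = 1) (hd : b 1 ^ 2 = algebraMap F E d) (hϖF : Irreducible ϖF)
  (hϖE : Irreducible ϖE) (hχ : multChar ϖE χ 0 (algebraMap F E ϖF) = 1)

include hb hd hϖF hϖE hχ

lemma integrable_kernelFun_of_tsupport {φ : E → ℂ} (hφ : IsLocallyConstant φ)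
    (hc : HasCompactSupport φ) (hs : tsupport φ ⊆ {x | b.repr x 1 ≠ 0}) :
    Integrable (fun x => kernelFun b d ϖF ϖE χ η s t x * φ x) μ := by
  refine integrable_of_isLocallyConstant ?_ hc.mul_left
  rw [IsLocallyConstant.iff_eventually_eq]
  intro x
  by_cases hx : x ∈ tsupport φ
  · filter_upwards [hφ.eventually_eq x, eventually_kernelFun_eq hb hd hϖF hϖE hχ (hs hx)]
      with y h1 h2
    rw [h1, h2]
  · filter_upwards [(isClosed_tsupport φ).isOpen_compl.mem_nhds hx] with y hy
    rw [image_eq_zero_of_notMem_tsupport hx, image_eq_zero_of_notMem_tsupport hy, mul_zero,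
      mul_zero]

variable {T : Distr E}
  (hT : ∀ φ : testFunctions E, Integrable (fun x => kernelFun b d ϖF ϖE χ η s t x * φ x) μ →
    T φ = normFactor χ η s t * ∫ x, kernelFun b d ϖF ϖE χ η s t x * φ x ∂μ)

include hT

/-- Points off F are dense, and near each of them the kernel is a nonzero constant, which a small
ball detects. -/
lemma dsupport_eq_univ (hn : normFactor χ η s t ≠ 0) : Distribution.dsupport T = Set.univ := by
  rw [Set.eq_univ_iff_forall]
  intro x
  rw [Distribution.mem_dsupport_iff_forall_exists_ne]
  intro U hxU hU
  obtain ⟨y, hyU, hy⟩ : ∃ y ∈ U, b.repr y 1 ≠ 0 := by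
    by_cases hx : b.repr x 1 ≠ 0
    · exact ⟨x, hxU, hx⟩
    rw [not_not] at hx
    have hc : Continuous fun a : F => x + algebraMap F E a * b 1 := by
      have := continuous_algebraMap_localField F E
      fun_prop
    have h1 : {a : F | x + algebraMap F E a * b 1 ∈ U} ∈ 𝓝 (0 : F) :=
      hc.continuousAt.preimage_mem_nhds (by simpa using hU.mem_nhds hxU)
    obtain ⟨n, -, hn⟩ := hasBasis_nhds_zero_absv.mem_iff.1 h1
    refine ⟨x + algebraMap F E ((ϖF : F) ^ n) * b 1, hn (absv_uniformizer_zpow hϖF n).le, ?_⟩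
    rw [map_add, Finsupp.add_apply, hx, repr_algebraMap_mul, zero_add]
    rw [b.repr_self, Finsupp.single_eq_same, mul_one]
    exact zpow_ne_zero n (uniformizer_ne_zero hϖF)
  obtain ⟨r, hr, hrU⟩ := exists_ball_subset (Filter.inter_mem (hU.mem_nhds hyU)
    (eventually_kernelFun_eq (η := η) (s := s) (t := t) hb hd hϖF hϖE hχ hy))
  have hcl := isClopen_absv_sub_le y hr
  have hco := isCompact_absv_sub_le y r
  set φ := indicatorTest _ hcl hco with hφ
  have hk : ∀ x, kernelFun b d ϖF ϖE χ η s t x * φ x =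
      {z | absv (z - y) ≤ r}.indicator (fun _ => kernelFun b d ϖF ϖE χ η s t y) x := by
    intro x
    rw [hφ, indicatorTest_apply]
    by_cases hx : x ∈ {z | absv (z - y) ≤ r}
    · rw [Set.indicator_of_mem hx, Set.indicator_of_mem hx, show kernelFun b d ϖF ϖE χ η s t x = _
        from (hrU hx).2]
      simp
    · rw [Set.indicator_of_notMem hx, Set.indicator_of_notMem hx, mul_zero]
  refine ⟨φ, (tsupport_indicatorTest_subset _ _ _).trans fun z hz => (hrU hz).1, ?_⟩
  have hi : Integrable ({z | absv (z - y) ≤ r}.indicator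
      (fun _ => kernelFun b d ϖF ϖE χ η s t y)) μ :=
    (integrable_indicator_iff hcl.isOpen.measurableSet).2
      (integrableOn_const hco.measure_lt_top.ne)
  rw [hT φ (hi.congr (Filter.Eventually.of_forall fun x => (hk x).symm)),
    integral_congr_ae (Filter.Eventually.of_forall hk), integral_indicator hcl.isOpen.measurableSet,
    setIntegral_const, Complex.real_smul]
  refine mul_ne_zero hn (mul_ne_zero ?_ (kernelFun_ne_zero hb hd hϖF hϖE hχ hy))
  have := measureReal_pos_of_isOpen_of_isCompact (μ := μ) hcl.isOpen hco
    ⟨y, by simp [absv_zero, hr.le]⟩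
  exact_mod_cast this.ne'

lemma dsupport_subset_range (hn : normFactor χ η s t = 0) :
    Distribution.dsupport T ⊆ Set.range (algebraMap F E) := by
  rw [← setOf_repr_one_eq_zero hb]
  intro x hx
  by_contra h
  obtain ⟨φ, hφ, h1⟩ := (Distribution.mem_dsupport_iff_forall_exists_ne x).1 hx
    {x | b.repr x 1 ≠ 0} h (isOpen_ne.preimage (continuous_repr b 1))
  refine h1 ?_
  rw [hT φ (integrable_kernelFun_of_tsupport hb hd hϖF hϖE hχ (testFunctions_isLocallyConstant φ)
    (testFunctions_hasCompactSupport φ) hφ), hn, zero_mul]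

omit hT
variable {l : Fˣ} {c C : ℂ}
  (hreg : ∀ φ : testFunctions E, φ 0 = 0 → T φ = C * regInt b d ϖF ϖE μ χ η l c s t φ)

include hreg

omit hχ in
-- On a small box around a ∈ Fˣ the regularized integrand survives only on the outer shell |x₂| = R,
-- where it is a nonzero constant; l has to be a uniformizer so that scaling strips off exactly this
-- shell. The origin follows because supports are closed.
lemma range_subset_dsupport (hη : resChar χ * η = 1) (hl : (l : F) = ϖF) (hc : c ≠ 0)
    (hC : C ≠ 0) : Set.range (algebraMap F E) ⊆ Distribution.dsupport T := by
  have key : ∀ a : F, a ≠ 0 → algebraMap F E a ∈ Distribution.dsupport T := by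
    intro a ha
    set x := algebraMap F E a with hx
    have hx0 : x ≠ 0 := by simpa [hx] using ha
    rw [Distribution.mem_dsupport_iff_forall_exists_ne]
    intro U hxU hU
    have hV := Filter.inter_mem (Filter.inter_mem (hU.mem_nhds hxU)
      (eventually_smoothFactor_eq (χ := χ) (η := η) hb hd hϖF hϖE hx0))
      (isOpen_ne.mem_nhds hx0)
    have hq := one_lt_resCard_real (K := F)
    obtain ⟨j, hj⟩ : ∃ j : ℤ, {y | y - x ∈ box b ((resCard F : ℝ) ^ j) ((resCard F : ℝ) ^ j)} ⊆
        (U ∩ {y | ∀ s t, smoothFactor b d ϖF ϖE χ η s t y = smoothFactor b d ϖF ϖE χ η s t x}) ∩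
          {y | y ≠ 0} := by
      have hc : Continuous fun y : F × F => x + coordEquiv b y :=
        continuous_const.add (coordEquiv b).continuous_toFun
      have h1 := hc.continuousAt.preimage_mem_nhds (x := 0) (by rw [map_zero, add_zero]; exact hV)
      rw [Prod.zero_eq_mk, nhds_prod_eq] at h1
      obtain ⟨⟨n, n'⟩, -, hn⟩ :=
        (hasBasis_nhds_zero_absv.prod hasBasis_nhds_zero_absv).mem_iff.1 h1
      refine ⟨-(max n n'), fun y hy => ?_⟩
      have h2 : ((b.repr (y - x) 0, b.repr (y - x) 1) : F × F) ∈ _ := hn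
        ⟨le_trans hy.1 (zpow_le_zpow_right₀ hq.le (by omega)),
          le_trans hy.2 (zpow_le_zpow_right₀ hq.le (by omega))⟩
      rw [Set.mem_preimage, coordEquiv_apply, repr_sum_eq, add_sub_cancel] at h2
      exact h2
    set R := (resCard F : ℝ) ^ j with hR
    have hRpos : 0 < R := zpow_pos resCard_pos_real j
    set B : Set E := {y | y - x ∈ box b R R} with hB
    have hBcl : IsClopen B := (isClopen_box b hRpos hRpos).preimage
      (by fun_prop : Continuous fun y => y - x)
    have hBco : IsCompact B := by
      have := (isCompact_box b R R).image (Homeomorph.addRight x).continuous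
      convert! this
      ext y
      simp only [hB, Set.mem_ofPred_eq, Homeomorph.coe_addRight, Set.mem_image]
      exact ⟨fun h => ⟨y - x, h, by simp⟩, by rintro ⟨z, hz, rfl⟩; simpa using hz⟩
    have hBmem : ∀ y, y ∈ B ↔ absv (b.repr y 0 - a) ≤ R ∧ absv (b.repr y 1) ≤ R := by
      intro y
      simp [hB, box, hx, repr_algebraMap_zero hb, repr_algebraMap_one hb]
    refine ⟨indicatorTest B hBcl hBco, (tsupport_indicatorTest_subset _ _ _).trans
      fun y hy => (hj hy).1.1, ?_⟩
    set D : Set E := {y | absv (b.repr y 0 - a) ≤ R ∧ absv (b.repr y 1) = R} with hD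
    have hDcl : IsClopen D := ((isClopen_absv_sub_le a hRpos).preimage (continuous_repr b 0)).inter
      ((isClopen_absv_eq hRpos).preimage (continuous_repr b 1))
    have hDB : D ⊆ B := fun y hy => (hBmem y).2 ⟨hy.1, hy.2.le⟩
    -- The inverse scaling multiplies |x₂| by q, so y is carried into B exactly when |y₂| ≤ R/q,
    -- that is, when |y₂| < R by discreteness.
    have hsB : ∀ y, (scaleAut b 1 l).symm y ∈ B ↔ (y ∈ B ∧ y ∉ D) := by
      intro y
      rw [hBmem, hBmem, scaleAut_symm, repr_scaleAut_zero, repr_scaleAut_one, inv_one,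
        Units.val_one, one_mul, absv_mul, Units.val_inv_eq_inv_val, absv_inv, hl,
        absv_uniformizer hϖF, inv_inv]
      simp only [ hD, Set.mem_ofPred_eq, not_and]
      have h3 : (resCard F : ℝ) * absv (b.repr y 1) ≤ R ↔
          absv (b.repr y 1) ≤ R ∧ absv (b.repr y 1) ≠ R := by
        constructor
        · intro h
          have := absv_nonneg (b.repr y 1)
          have h4 : absv (b.repr y 1) < R := by
            rcases this.eq_or_lt with h0 | h0
            · rw [← h0]; exact hRpos
            · nlinarith
          exact ⟨h4.le, h4.ne⟩
        · rintro ⟨h1, h2⟩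
          by_contra! h3
          have h5 : (resCard F : ℝ) ^ (j - 1) < absv (b.repr y 1) := by
            rw [zpow_sub_one₀ resCard_pos_real.ne', ← hR, ← div_eq_mul_inv,
              div_lt_iff₀ resCard_pos_real]
            linarith
          have := absv_le_zpow_or h5
          rw [sub_add_cancel] at this
          exact h2 (le_antisymm h1 this)
      rw [h3]
      tauto
    set κ : ℂ := (R : ℂ) ^ (2 * s + t - 1 / 2) with hκ
    have hint : ∀ y, regIntegrand b d ϖF ϖE χ η l (indicatorTest B hBcl hBco) s t y =
        D.indicator (fun _ => κ * smoothFactor b d ϖF ϖE χ η s t x) y := by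
      intro y
      have hg : ∀ z, smoothFactor b d ϖF ϖE χ η s t z * indicatorTest B hBcl hBco z =
          B.indicator (fun _ => smoothFactor b d ϖF ϖE χ η s t x) z := by
        intro z
        rw [indicatorTest_apply]
        by_cases hz : z ∈ B
        · rw [Set.indicator_of_mem hz, Set.indicator_of_mem hz, (hj hz).1.2 s t]
          simp
        · rw [Set.indicator_of_notMem hz, Set.indicator_of_notMem hz, mul_zero]
      rw [regIntegrand, hg, hg]
      by_cases hyD : y ∈ D
      · rw [Set.indicator_of_mem hyD, Set.indicator_of_mem (hDB hyD),
          Set.indicator_of_notMem (fun h => ((hsB y).1 h).2 hyD), sub_zero]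
        congr 1
        have h0 : b.repr y 1 ≠ 0 := fun h => by
          have := hyD.2
          rw [h, absv_zero] at this
          exact hRpos.ne this
        rw [fiberChar, hη, multChar_one_char hϖF _ h0, hyD.2]
      · rw [Set.indicator_of_notMem hyD]
        by_cases hyB : y ∈ B
        · rw [Set.indicator_of_mem hyB, Set.indicator_of_mem ((hsB y).2 ⟨hyB, hyD⟩), sub_self,
            mul_zero]
        · rw [Set.indicator_of_notMem hyB, Set.indicator_of_notMem
            (fun h => hyB ((hsB y).1 h).1), sub_self, mul_zero]
    rw [hreg, regInt, integral_congr_ae (Filter.Eventually.of_forall hint),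
      integral_indicator hDcl.isOpen.measurableSet, setIntegral_const, Complex.real_smul]
    · refine mul_ne_zero hC (mul_ne_zero hc (mul_ne_zero ?_ (mul_ne_zero ?_
        (smoothFactor_ne_zero hb hd hϖF hϖE hx0))))
      · have := measureReal_pos_of_isOpen_of_isCompact (μ := μ) hDcl.isOpen
          (hBco.of_isClosed_subset hDcl.isClosed hDB)
          ⟨algebraMap F E a + algebraMap F E ((ϖF : F) ^ (-j)) * b 1, by
            simp only [hD, Set.mem_ofPred_eq, repr_of_coords hb]
            change absv (a - a) ≤ R ∧ absv ((ϖF : F) ^ (-j)) = R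
            rw [sub_self, absv_zero, absv_uniformizer_zpow hϖF, neg_neg]
            exact ⟨hRpos.le, rfl⟩⟩
        exact_mod_cast this.ne'
      · have hR0 : (R : ℂ) ≠ 0 := by exact_mod_cast hRpos.ne'
        rw [hκ, Complex.cpow_def_of_ne_zero hR0]
        exact Complex.exp_ne_zero _
    · rw [indicatorTest_apply, Set.indicator_of_notMem]
      exact fun h => (hj h).2 rfl
  rintro _ ⟨a, rfl⟩
  by_cases ha : a = 0
  · subst ha
    by_contra h
    have h1 : {a : F | algebraMap F E a ∉ Distribution.dsupport T} ∈ 𝓝 (0 : F) :=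
      ((isClosed_dsupport T).isOpen_compl.preimage
        (continuous_algebraMap_localField F E)).mem_nhds h
    obtain ⟨n, -, hn⟩ := hasBasis_nhds_zero_absv.mem_iff.1 h1
    exact hn (a := (ϖF : F) ^ n) (absv_uniformizer_zpow hϖF n).le
      (key _ (zpow_ne_zero _ (uniformizer_ne_zero hϖF)))
  · exact key a ha

end Renormalization

/-! ### Distributions supported at the origin. -/

section PointSupport

variable {K : Type*} [Field K] [ValuativeRel K] [TopologicalSpace K]
  [IsNonarchimedeanLocalField K] {T : Distr K}

variable (K) in
/-- The indicator of the ring of integers. -/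
def integerTest : testFunctions K :=
  indicatorTest {x | absv x ≤ 1} (isClopen_absv_le one_pos) (isCompact_absv_le 1)

lemma integerTest_zero : integerTest K 0 = 1 := by
  rw [integerTest, indicatorTest_apply, Set.indicator_of_mem (by simp [absv_zero])]; rfl

/-- The combination ψ(0)φ - φ(0)ψ vanishes at 0. Hence T is a multiple of the Dirac mass, and one
test value decides whether it is zero. -/
lemma distr_eq_of_vanishing (hT : ∀ φ : testFunctions K, φ 0 = 0 → T φ = 0)
    (φ ψ : testFunctions K) : T φ * ψ 0 = φ 0 * T ψ := by
  have h := hT (ψ 0 • φ - φ 0 • ψ) (by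
    change ψ 0 * φ 0 - φ 0 * ψ 0 = 0
    ring)
  rw [map_sub, map_smul, map_smul, smul_eq_mul, smul_eq_mul] at h
  linear_combination h

lemma distr_eq_zero_iff_of_vanishing (hT : ∀ φ : testFunctions K, φ 0 = 0 → T φ = 0)
    {ψ : testFunctions K} (hψ : ψ 0 = 1) : T = 0 ↔ T ψ = 0 := by
  refine ⟨fun h => by rw [h]; rfl, fun h => ?_⟩
  ext φ
  have := distr_eq_of_vanishing hT φ ψ
  rw [hψ, h, mul_one, mul_zero] at this
  exact this

lemma dsupport_eq_singleton (hT : ∀ φ : testFunctions K, φ 0 = 0 → T φ = 0) (h : T ≠ 0) :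
    Distribution.dsupport T = {0} := by
  ext x
  rw [Set.mem_singleton_iff, Distribution.mem_dsupport_iff_forall_exists_ne]
  constructor
  · intro hx
    by_contra h0
    obtain ⟨φ, hφ, h1⟩ := hx {y | y ≠ 0} h0 isOpen_ne
    refine h1 (hT φ ?_)
    by_contra h2
    exact hφ (subset_tsupport _ h2) rfl
  · rintro rfl U hU hUo
    obtain ⟨r, hr, hrU⟩ := exists_ball_subset (hUo.mem_nhds hU)
    refine ⟨indicatorTest _ (isClopen_absv_sub_le 0 hr) (isCompact_absv_sub_le 0 r),
      (tsupport_indicatorTest_subset _ _ _).trans hrU, fun h1 => h ?_⟩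
    refine (distr_eq_zero_iff_of_vanishing hT ?_).2 h1
    rw [indicatorTest_apply, Set.indicator_of_mem (by simp [absv_zero, hr.le])]
    rfl

end PointSupport

/-! ### An integral basis of E over F. -/

section IntegralBasis

variable {F E : Type*} [Field F] [ValuativeRel F] [TopologicalSpace F]
  [IsNonarchimedeanLocalField F] [Field E] [ValuativeRel E] [TopologicalSpace E]
  [IsNonarchimedeanLocalField E] [Algebra F E] [ValuativeExtension F E]

variable (b : Module.Basis (Fin 2) F E)

include b

/-- The residue field of `E` is an extension of that of `F`; either it is a proper one, or the
residue fields have the same cardinality. -/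
lemma resCard_eq_or_exists_residue_generator : resCard E = resCard F ∨ resCard F < resCard E ∧
    ∃ θ : E, absv θ ≤ 1 ∧ ∀ a : F, absv a ≤ 1 → 1 ≤ absv (θ - algebraMap F E a) := by
  obtain ⟨r, hr1, hr2, hr3⟩ := exists_residue_reps F
  set ι : 𝓀[F] → 𝓀[E] := fun i => IsLocalRing.residue 𝒪[E]
    (integerMap F E ⟨r i, mem_integer_iff_absv.2 (hr1 i)⟩) with hι
  have hcoe : ∀ a : 𝒪[F], ((integerMap F E a : 𝒪[E]) : E) = algebraMap F E a := fun _ => rfl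
  have hinj : Function.Injective ι := by
    intro i j hij
    rw [hι, residue_eq_iff, hcoe, hcoe, ← map_sub, absv_algebraMap b] at hij
    exact hr3 i j (by
      have := absv_nonneg (r i - r j)
      change absv (r i - r j) ^ 2 < 1 at hij
      nlinarith)
  have hfin : Finite 𝓀[E] := inferInstance
  have hle : resCard F ≤ resCard E := Nat.card_le_card_of_injective ι hinj
  rcases hle.eq_or_lt with h | h
  · exact Or.inl h.symm
  refine Or.inr ⟨h, ?_⟩
  have hns : ¬ Function.Surjective ι := fun hs =>
    absurd (Nat.card_le_card_of_surjective ι hs) (not_le.2 h)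
  rw [Function.Surjective] at hns
  push Not at hns
  obtain ⟨y, hy⟩ := hns
  obtain ⟨θ, rfl⟩ := IsLocalRing.residue_surjective y
  refine ⟨θ, absv_integer_le θ, fun a ha => ?_⟩
  by_contra! h1
  obtain ⟨i, hi⟩ := hr2 a ha
  refine hy i ?_
  rw [hι, residue_eq_iff, hcoe, absv_sub_comm]
  have : (θ : E) - algebraMap F E (r i) =
      (θ - algebraMap F E a) + algebraMap F E (a - r i) := by rw [map_sub]; ring
  change absv ((θ : E) - algebraMap F E (r i)) < 1
  rw [this]
  refine (absv_add_le _ _).trans_lt (max_lt h1 ?_)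
  rw [absv_algebraMap b]
  have := absv_nonneg (a - r i)
  nlinarith

/-- The quadratic extension has an integral basis `1, θ`, with an explicit absolute value. -/
lemma exists_integralBasis {ϖE : 𝒪[E]} (hϖE : Irreducible ϖE) {ϖF : 𝒪[F]}
    (hϖF : Irreducible ϖF) : ∃ b' : Module.Basis (Fin 2) F E, b' 0 = 1 ∧
    ((resCard E = resCard F ^ 2 ∧
      ∀ x, absv x = max (absv (b'.repr x 0)) (absv (b'.repr x 1)) ^ 2) ∨
    (resCard E = resCard F ∧
      ∀ x, absv x = max (absv (b'.repr x 0) ^ 2)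
        (absv (b'.repr x 1) ^ 2 * (resCard F : ℝ)⁻¹))) := by
  have hbasis : ∀ θ : E, θ ∉ Set.range (algebraMap F E) →
      ∃ b' : Module.Basis (Fin 2) F E, b' 0 = 1 ∧ b' 1 = θ := by
    intro θ hθ
    have hli : LinearIndependent F ![(1 : E), θ] := by
      rw [LinearIndependent.pair_iff]
      intro x y hxy
      have hy : y = 0 := by
        by_contra hy
        refine hθ ⟨-x / y, ?_⟩
        rw [Algebra.smul_def, Algebra.smul_def, mul_one] at hxy
        rw [map_div₀, map_neg, div_eq_iff (by simpa using hy)]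
        linear_combination -hxy
      rw [hy, zero_smul, add_zero, Algebra.smul_def, mul_one] at hxy
      exact ⟨by simpa using hxy, hy⟩
    have hcard : Fintype.card (Fin 2) = Module.finrank F E :=
      (Module.finrank_eq_card_basis b).symm
    refine ⟨basisOfLinearIndependentOfCardEqFinrank hli hcard, ?_, ?_⟩ <;> simp
  have hF := one_lt_resCard_real (K := F)
  have hord : (resCard E : ℝ) ^ (-ord (algebraMap F E ϖF)) = (resCard F : ℝ) ^ (-2 : ℤ) := by
    rw [← absv_of_ne_zero (by simpa using uniformizer_ne_zero hϖF), absv_algebraMap b,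
      absv_uniformizer hϖF, zpow_neg, inv_pow]
    norm_cast
  rcases resCard_eq_or_exists_residue_generator b with h | ⟨h, θ, hθ1, hθ2⟩
  -- Equal residue fields: ϖE serves as θ. Its absolute value is an odd power of q, whereas nonzero
  -- elements of F have even powers in E.
  · have hθ : (ϖE : E) ∉ Set.range (algebraMap F E) := by
      rintro ⟨a, ha⟩
      have h0 : a ≠ 0 := by
        rintro rfl
        exact uniformizer_ne_zero hϖE (by rw [← ha, map_zero])
      have h1 := congrArg absv ha
      rw [absv_algebraMap b, absv_uniformizer hϖE, h, absv_of_ne_zero h0, ← zpow_natCast,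
        ← zpow_mul, ← zpow_neg_one] at h1
      have := zpow_right_injective₀ (by linarith) hF.ne' h1
      push_cast at this
      omega
    obtain ⟨b', hb0, hb1⟩ := hbasis _ hθ
    refine ⟨b', hb0, Or.inr ⟨h, fun x => ?_⟩⟩
    have hx := eq_coords hb0 x
    by_cases h0 : b'.repr x 0 = 0 ∧ b'.repr x 1 = 0
    · have : x = 0 := by rw [hx, h0.1, h0.2]; simp
      simp [this, absv_zero]
    have e1 : absv (algebraMap F E (b'.repr x 1) * b' 1) =
        absv (b'.repr x 1) ^ 2 * (resCard F : ℝ)⁻¹ := by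
      rw [absv_mul, absv_algebraMap b, hb1, absv_uniformizer hϖE, h]
    conv_lhs => rw [hx]
    -- By the same parity the two summands never have equal size unless both vanish, so the
    -- ultrametric inequality is an equality.
    rw [absv_add_eq_max, e1, absv_algebraMap b]
    rw [e1, absv_algebraMap b]
    intro h1
    by_cases h2 : b'.repr x 1 = 0
    · rw [h2, absv_zero] at h1
      refine h0 ⟨?_, h2⟩
      simpa [absv_eq_zero] using h1
    · by_cases h3 : b'.repr x 0 = 0
      · rw [h3, absv_zero] at h1
        have := absv_pos h2
        have : 0 < absv (b'.repr x 1) ^ 2 * (resCard F : ℝ)⁻¹ := by positivity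
        rw [zero_pow two_ne_zero] at h1
        linarith
      · rw [absv_of_ne_zero h2, absv_of_ne_zero h3, ← zpow_natCast, ← zpow_natCast, ← zpow_mul,
          ← zpow_mul, ← zpow_sub_one₀ (by linarith)] at h1
        have := zpow_right_injective₀ (by linarith) hF.ne' h1
        push_cast at this
        omega
  · have hθ : θ ∉ Set.range (algebraMap F E) := by
      rintro ⟨a, rfl⟩
      have h1 : absv a ≤ 1 := by
        rw [absv_algebraMap b] at hθ1
        have := absv_nonneg a
        nlinarith
      have := hθ2 a h1
      rw [sub_self, absv_zero] at this
      linarith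
    obtain ⟨b', hb0, hb1⟩ := hbasis _ hθ
    refine ⟨b', hb0, Or.inl ⟨?_, fun x => ?_⟩⟩
    -- The two expressions for |ϖF|_E give q_E^e = q_F², and q_E > q_F leaves only e = 1.
    · have hE := one_lt_resCard_real (K := E)
      have hFE : (resCard F : ℝ) < resCard E := by exact_mod_cast h
      set e := ord (algebraMap F E ϖF) with he
      rw [zpow_neg, zpow_neg, inv_inj] at hord
      have hF2 : (1 : ℝ) < (resCard F : ℝ) ^ (2 : ℤ) := one_lt_zpow₀ hF (by norm_num)
      have he1 : 1 ≤ e := by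
        by_contra! h1
        have : (resCard E : ℝ) ^ e ≤ 1 := zpow_le_one_of_nonpos₀ hE.le (by omega)
        linarith
      have he2 : e ≤ 1 := by
        by_contra! h1
        have h2 : (resCard E : ℝ) ^ (2 : ℤ) ≤ (resCard E : ℝ) ^ e :=
          zpow_le_zpow_right₀ hE.le (by omega)
        have h3 : (resCard F : ℝ) ^ (2 : ℤ) < (resCard E : ℝ) ^ (2 : ℤ) := by
          rw [zpow_ofNat, zpow_ofNat]
          exact pow_lt_pow_left₀ hFE (by linarith) two_ne_zero
        exact absurd (h2.trans hord.le) (not_le.2 h3)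
      rw [le_antisymm he2 he1, zpow_one, zpow_ofNat] at hord
      exact_mod_cast hord
    · have hx := eq_coords hb0 x
      rw [hb1] at hx
      set a := b'.repr x 0
      set c := b'.repr x 1
      rcases lt_or_ge (absv c) (absv a) with h1 | h1
      · rw [max_eq_left h1.le, hx]
        have h2 : absv (algebraMap F E c * θ) < absv (algebraMap F E a) := by
          rw [absv_mul, absv_algebraMap b, absv_algebraMap b]
          have := absv_nonneg c
          have := absv_nonneg θ
          calc absv c ^ 2 * absv θ ≤ absv c ^ 2 * 1 := by gcongr
            _ < _ := by nlinarith
        rw [absv_add_eq_max h2.ne', max_eq_left h2.le, absv_algebraMap b]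
      · rw [max_eq_right h1]
        by_cases hc : c = 0
        · have ha : a = 0 := by
            rw [hc, absv_zero] at h1
            exact absv_eq_zero.1 (le_antisymm h1 (absv_nonneg a))
          rw [hx, hc, ha]
          simp [absv_zero]
        have h2 : absv (-a / c) ≤ 1 := by
          rw [absv_div, absv_neg, div_le_one (absv_pos hc)]
          exact h1
        -- Since -a/c is an integer of F, its residue differs from that of θ.
        have h3 : absv (θ - algebraMap F E (-a / c)) = 1 := by
          refine le_antisymm ((absv_sub_le _ _).trans (max_le hθ1 ?_)) (hθ2 _ h2)
          rw [absv_algebraMap b]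
          exact pow_le_one₀ (absv_nonneg _) h2
        have h4 : x = algebraMap F E c * (θ - algebraMap F E (-a / c)) := by
          have hc' : algebraMap F E c ≠ 0 := by simpa using hc
          rw [hx, map_div₀, map_neg]
          field_simp
          ring
        rw [h4, absv_mul, h3, mul_one, absv_algebraMap b]

end IntegralBasis

/-! ### Change of variables for integrals over sets. -/

section SetIntegral

variable {G : Type*} [AddCommGroup G] [TopologicalSpace G]
  [MeasurableSpace G] [BorelSpace G] [IsTopologicalAddGroup G] [LocallyCompactSpace G]
  (μ : Measure G) [μ.IsAddHaarMeasure] [μ.Regular]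

lemma setIntegral_comp_continuousAddEquiv (φ : G ≃ₜ+ G) (f : G → ℂ) {S : Set G}
    (hS : MeasurableSet S) :
    ∫ x in S, f x ∂μ = (addEquivAddHaarChar φ : ℝ) * ∫ x in φ ⁻¹' S, f (φ x) ∂μ := by
  have hφ : MeasurableSet (φ ⁻¹' S) := φ.continuous_toFun.measurable hS
  rw [← integral_indicator hS, ← integral_indicator hφ,
    integral_comp_continuousAddEquiv μ φ]
  rfl

end SetIntegral

/-! ### Level sets of the second coordinate inside the units. -/

section LevelSets

variable {F E : Type*} [Field F] [ValuativeRel F] [TopologicalSpace F]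
  [IsNonarchimedeanLocalField F] [Field E] [ValuativeRel E] [TopologicalSpace E]
  [IsNonarchimedeanLocalField E] [Algebra F E] [ValuativeExtension F E]

variable (b : Module.Basis (Fin 2) F E) {ϖF : 𝒪[F]}

/-- The units of `𝒪[F] + 𝔭ʲ𝒪[E]`, when `b` is an integral basis. -/
def levelUnits (j : ℕ) : Set E :=
  {x | absv x = 1 ∧ absv (b.repr x 1) ≤ (resCard F : ℝ) ^ (-(j : ℤ))}

/-- The quasi-character `|x₂|ᶻ` of the second coordinate. -/
def coordPow (ϖF : 𝒪[F]) (z : ℂ) (x : E) : ℂ := multChar ϖF 1 z (b.repr x 1)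

lemma isClopen_levelUnits (j : ℕ) : IsClopen (levelUnits b j) :=
  (isClopen_absv_eq one_pos).inter
    ((isClopen_absv_le (zpow_pos resCard_pos_real _)).preimage (continuous_repr b 1))

lemma isCompact_levelUnits (j : ℕ) : IsCompact (levelUnits b j) :=
  (isCompact_absv_le 1).of_isClosed_subset (isClopen_levelUnits b j).isClosed
    fun _ hx => le_of_eq hx.1

lemma levelUnits_succ_subset (j : ℕ) : levelUnits b (j + 1) ⊆ levelUnits b j := fun _ hx =>
  ⟨hx.1, hx.2.trans (zpow_le_zpow_right₀ one_lt_resCard_real.le (by push_cast; omega))⟩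

lemma absv_repr_of_mem_diff {j : ℕ} {x : E} (hx : x ∈ levelUnits b j \ levelUnits b (j + 1)) :
    absv (b.repr x 1) = (resCard F : ℝ) ^ (-(j : ℤ)) := by
  refine le_antisymm hx.1.2 ?_
  by_contra! h
  refine hx.2 ⟨hx.1.1, ?_⟩
  by_contra! h1
  have := absv_le_zpow_or h1
  rw [show -((j + 1 : ℕ) : ℤ) + 1 = -(j : ℤ) by push_cast; ring] at this
  linarith

lemma multChar_one_uniformizer (hϖF : Irreducible ϖF) (z : ℂ) :
    multChar ϖF 1 z (ϖF : F) = (resCard F : ℂ) ^ (-z) := by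
  rw [multChar_one_char hϖF _ (uniformizer_ne_zero hϖF), absv_uniformizer hϖF, Complex.ofReal_inv,
    Complex.ofReal_natCast, Complex.inv_cpow _ _ (by
      rw [Complex.natCast_arg]; exact Real.pi_ne_zero.symm), Complex.cpow_neg]

lemma coordPow_of_absv (hϖF : Irreducible ϖF) {z : ℂ} {x : E} {j : ℕ}
    (h : absv (b.repr x 1) = (resCard F : ℝ) ^ (-(j : ℤ))) :
    coordPow b ϖF z x = ((resCard F : ℂ) ^ (-z)) ^ j := by
  have h0 : b.repr x 1 ≠ 0 := fun h0 => by
    rw [h0, absv_zero] at h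
    exact (zpow_pos resCard_pos_real _).ne h
  rw [coordPow, multChar_one_char hϖF _ h0, h, ← absv_uniformizer_zpow hϖF,
    ← multChar_one_char hϖF _ (zpow_ne_zero _ (uniformizer_ne_zero hϖF)), zpow_natCast,
    multChar_pow hϖF, multChar_one_uniformizer hϖF]

lemma isLocallyConstant_unitExt {K : Type*} [Field K] [ValuativeRel K] [TopologicalSpace K]
    [IsNonarchimedeanLocalField K] (ω : UnitChar K) : IsLocallyConstant (unitExt ω) := by
  obtain ⟨ϖ, hϖ⟩ := IsDiscreteValuationRing.exists_irreducible 𝒪[K]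
  rw [IsLocallyConstant.iff_eventually_eq]
  intro x
  by_cases hx : absv x = 1
  · have h0 : x ≠ 0 := fun h => by simp [h, absv_zero] at hx
    filter_upwards [eventually_multChar_eq hϖ ω h0, eventually_absv_eq h0] with y h1 h2
    rw [← multChar_of_absv_one ϖ ω 0 hx, ← multChar_of_absv_one ϖ ω 0 (h2.trans hx), h1]
  · filter_upwards [(isClopen_absv_eq one_pos).compl.isOpen.mem_nhds hx] with y hy
    rw [unitExt_eq_zero ω hx, unitExt_eq_zero ω hy]

lemma norm_unitExt_le {K : Type*} [Field K] [ValuativeRel K] [TopologicalSpace K]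
    [IsNonarchimedeanLocalField K] (ω : UnitChar K) (x : K) : ‖unitExt ω x‖ ≤ 1 := by
  by_cases hx : absv x = 1
  · exact (norm_unitExt ω hx).le
  · rw [unitExt_eq_zero ω hx, norm_zero]; exact zero_le_one

variable [MeasurableSpace E] [BorelSpace E] (μ : Measure E) [μ.IsAddHaarMeasure]

lemma integrableOn_coordPow (hϖF : Irreducible ϖF) {z : ℂ} (hz : 0 < (z + 1).re) :
    IntegrableOn (coordPow b ϖF z) (box b 1 1) μ := by
  have := integrableOn_fiberChar_box (b := b) (μ := μ) (χ := 1) (η := 1) (s := 0) (t := z + 1 / 2)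
    hϖF (by convert hz using 2; ring) 1 0
  have e : (fun x : E => fiberChar ϖF (1 : UnitChar E) (1 : UnitChar F) 0 (z + 1 / 2) (b.repr x 1)) =
      coordPow b ϖF z := by
    funext x
    rw [fiberChar, coordPow, show 2 * 0 + (z + 1 / 2) - 1 / 2 = z by ring, mul_one,
      show resChar (F := F) (1 : UnitChar E) = 1 from rfl]
  rwa [e, zpow_zero] at this

lemma integrableOn_unitExt_mul_coordPow (ω : UnitChar E) (hϖF : Irreducible ϖF) {z : ℂ}
    (hz : 0 < (z + 1).re) :
    IntegrableOn (fun x => unitExt ω x * coordPow b ϖF z x) (box b 1 1) μ :=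
  (integrableOn_coordPow b μ hϖF hz).bdd_mul (c := 1)
    (isLocallyConstant_unitExt ω).continuous.aestronglyMeasurable
    (Filter.Eventually.of_forall (norm_unitExt_le ω))

lemma integrableOn_unitExt (ω : UnitChar E) {S : Set E} (hS : IsCompact S) :
    IntegrableOn (unitExt ω) S μ :=
  (isLocallyConstant_unitExt ω).continuous.continuousOn.integrableOn_compact hS

/-! ### Telescoping over the level sets -/

variable {b}

/-- On the difference of two successive level sets |x₂| is constant, equal to q^{-j}, so the power
of |x₂| comes out of the integral. -/
lemma setIntegral_levelUnits_sub (ω : UnitChar E) (hϖF : Irreducible ϖF) {z : ℂ}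
    (hz : 0 < (z + 1).re) {j : ℕ} (hj : levelUnits b j ⊆ box b 1 1) :
    ∫ x in levelUnits b j, unitExt ω x * coordPow b ϖF z x ∂μ =
      ∫ x in levelUnits b (j + 1), unitExt ω x * coordPow b ϖF z x ∂μ +
      ((resCard F : ℂ) ^ (-z)) ^ j * (∫ x in levelUnits b j, unitExt ω x ∂μ -
        ∫ x in levelUnits b (j + 1), unitExt ω x ∂μ) := by
  have hm := (isClopen_levelUnits b (j + 1)).isOpen.measurableSet
  have hm' := (isClopen_levelUnits b j).isOpen.measurableSet
  have h1 := setIntegral_sdiff hm ((integrableOn_unitExt_mul_coordPow b μ ω hϖF hz).mono_set hj)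
    (levelUnits_succ_subset b j)
  have h2 := setIntegral_sdiff hm (integrableOn_unitExt μ ω (isCompact_levelUnits b j))
    (levelUnits_succ_subset b j)
  have h3 : ∫ x in levelUnits b j \ levelUnits b (j + 1), unitExt ω x * coordPow b ϖF z x ∂μ =
      ∫ x in levelUnits b j \ levelUnits b (j + 1),
        ((resCard F : ℂ) ^ (-z)) ^ j * unitExt ω x ∂μ := by
    refine setIntegral_congr_fun (hm'.diff hm) fun x hx => ?_
    rw [coordPow_of_absv b hϖF (absv_repr_of_mem_diff b hx), mul_comm]
  rw [integral_const_mul, h2, h1] at h3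
  linear_combination h3

lemma coordPow_scaleAut (hϖF : Irreducible ϖF) (z : ℂ) (l : Fˣ) (x : E) :
    coordPow b ϖF z (scaleAut b 1 l x) = multChar ϖF 1 z (l : F) * coordPow b ϖF z x := by
  rw [coordPow, repr_scaleAut_one, multChar_mul hϖF, coordPow]

/-- On a level set which is scaled into the next one, the integral of `|x₂|ᶻ` is geometric. -/
lemma setIntegral_levelUnits_coordPow (hϖF : Irreducible ϖF) {z : ℂ} (hz : 0 < (z + 1).re) {j : ℕ}
    (hj : levelUnits b j ⊆ box b 1 1) (hsc : ∀ l : Fˣ, (l : F) = ϖF →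
      scaleAut b 1 l ⁻¹' levelUnits b (j + 1) = levelUnits b j) :
    (1 - (resCard F : ℂ) ^ (-z - 1)) * ∫ x in levelUnits b j, coordPow b ϖF z x ∂μ =
      ((resCard F : ℂ) ^ (-z)) ^ j * (1 - (resCard F : ℂ)⁻¹) * μ.real (levelUnits b j) := by
  obtain ⟨l, hl⟩ := (uniformizer_ne_zero hϖF).isUnit
  have hq : (resCard F : ℂ) ≠ 0 := by exact_mod_cast (resCard_pos_real (K := F)).ne'
  have hm := (isClopen_levelUnits b (j + 1)).isOpen.measurableSet
  have hm' := (isClopen_levelUnits b j).isOpen.measurableSet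
  have hchar : ((addEquivAddHaarChar (scaleAut b 1 l) : ℝ) : ℂ) = (resCard F : ℂ)⁻¹ := by
    rw [haarChar_scaleAut, hl, absv_uniformizer hϖF, Units.val_one, absv_one, one_mul]
    push_cast
    rfl
  have e1 := setIntegral_comp_continuousAddEquiv μ (scaleAut b 1 l) (coordPow b ϖF z) hm
  have e2 := setIntegral_comp_continuousAddEquiv μ (scaleAut b 1 l) (fun _ => (1 : ℂ)) hm
  have e3 := setIntegral_levelUnits_sub μ 1 hϖF hz hj
  have hc : ∀ i, ∫ x in levelUnits b i, unitExt 1 x * coordPow b ϖF z x ∂μ =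
      ∫ x in levelUnits b i, coordPow b ϖF z x ∂μ := fun i =>
    setIntegral_congr_fun (isClopen_levelUnits b i).isOpen.measurableSet fun x hx => by
      rw [unitExt_one_char hx.1, one_mul]
  have hc' : ∀ i, ∫ x in levelUnits b i, unitExt 1 x ∂μ = ∫ x in levelUnits b i, (1 : ℂ) ∂μ :=
    fun i => setIntegral_congr_fun (isClopen_levelUnits b i).isOpen.measurableSet fun x hx =>
      unitExt_one_char hx.1
  -- With I_j the integral and V_j the volume, scaling gives I_{j+1} = q^{-z-1} I_j and V_{j+1} =
  -- q⁻¹ V_j. The telescoping identity then determines I_j.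
  rw [hchar, hsc l hl] at e1 e2
  simp_rw [coordPow_scaleAut hϖF, hl, multChar_one_uniformizer hϖF] at e1
  rw [integral_const_mul] at e1
  rw [hc, hc, hc', hc', e1, e2, setIntegral_const, Complex.real_smul, mul_one] at e3
  rw [Complex.cpow_sub _ _ hq, Complex.cpow_one]
  linear_combination e3

end LevelSets

/-! ### The groups (𝒪[F] + 𝔭ʲ𝒪[E])ˣ and orthogonality of characters. -/

section LevelGroups

variable {F E : Type*} [Field F] [ValuativeRel F] [TopologicalSpace F]
  [IsNonarchimedeanLocalField F] [Field E] [ValuativeRel E] [TopologicalSpace E]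
  [IsNonarchimedeanLocalField E] [Algebra F E] [ValuativeExtension F E]

/-- `b = (1, θ)` is an integral basis: `𝒪[E] = 𝒪[F] + 𝒪[F]θ`. -/
structure IsIntegralBasis (b : Module.Basis (Fin 2) F E) : Prop where
  zero_eq : b 0 = 1
  le_one_iff : ∀ x, absv x ≤ 1 ↔ absv (b.repr x 0) ≤ 1 ∧ absv (b.repr x 1) ≤ 1

variable {b : Module.Basis (Fin 2) F E} {ϖF : 𝒪[F]}

namespace IsIntegralBasis

variable (hI : IsIntegralBasis b)

include hI

lemma absv_one_le : absv (b 1) ≤ 1 := by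
  rw [hI.le_one_iff, b.repr_self]
  simp [absv_zero, absv_one]

lemma levelUnits_subset_box (j : ℕ) : levelUnits b j ⊆ box b 1 1 :=
  fun x hx => (hI.le_one_iff x).1 hx.1.le

lemma levelUnits_zero : levelUnits b 0 = {x | absv x = 1} := by
  ext x
  refine ⟨fun h => h.1, fun h => ⟨h, ?_⟩⟩
  simpa using ((hI.le_one_iff x).1 (le_of_eq h)).2

/-- The second summand of `x = x₁ + x₂θ` is small compared with units when `x₂` is. -/
lemma absv_eq_one_iff {x : E} (hx : absv (b.repr x 1) < 1) :
    absv x = 1 ↔ absv (b.repr x 0) = 1 := by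
  have h1 : absv (algebraMap F E (b.repr x 1) * b 1) < 1 := by
    rw [absv_mul, absv_algebraMap b]
    have h2 := hI.absv_one_le
    have h3 := absv_nonneg (b.repr x 1)
    calc absv (b.repr x 1) ^ 2 * absv (b 1) ≤ absv (b.repr x 1) ^ 2 * 1 := by gcongr
      _ < 1 := by nlinarith
  have h2 := eq_coords hI.zero_eq x
  have h3 : absv (algebraMap F E (b.repr x 0)) = 1 ↔ absv (b.repr x 0) = 1 := by
    rw [absv_algebraMap b, pow_eq_one_iff_of_nonneg (absv_nonneg _) two_ne_zero]
  rw [← h3]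
  constructor
  · intro h
    rw [← h]
    refine absv_eq_of_sub_lt ?_
    rw [h]
    nth_rw 2 [h2]
    rw [sub_add_cancel_left, absv_neg]
    exact h1
  · intro h
    rw [← h]
    refine absv_eq_of_sub_lt ?_
    rw [h]
    nth_rw 1 [h2]
    rw [add_sub_cancel_left]
    exact h1

/-- Every term of (xy)₂ contains x₂ or y₂, and the cofactors are integral because θ² is. -/
lemma mul_mem_levelUnits {j : ℕ} {x y : E} (hx : x ∈ levelUnits b j) (hy : y ∈ levelUnits b j) :
    x * y ∈ levelUnits b j := by
  refine ⟨by rw [absv_mul, hx.1, hy.1, one_mul], ?_⟩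
  obtain ⟨hx0, hx1⟩ := (hI.le_one_iff x).1 hx.1.le
  obtain ⟨hy0, hy1⟩ := (hI.le_one_iff y).1 hy.1.le
  have hθ : absv (b.repr (b 1 * b 1) 1) ≤ 1 := ((hI.le_one_iff _).1 (by
    rw [absv_mul]; exact mul_le_one₀ hI.absv_one_le (absv_nonneg _) hI.absv_one_le)).2
  set c := b.repr (b 1 * b 1) 1
  have h : b.repr (x * y) 1 = b.repr x 0 * b.repr y 1 + b.repr x 1 * b.repr y 0 +
      b.repr x 1 * b.repr y 1 * c := by
    have e : x * y = algebraMap F E (b.repr x 0 * b.repr y 0) * b 0 +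
        algebraMap F E (b.repr x 0 * b.repr y 1 + b.repr x 1 * b.repr y 0) * b 1 +
        algebraMap F E (b.repr x 1 * b.repr y 1) * (b 1 * b 1) := by
      conv_lhs => rw [eq_coords hI.zero_eq x, eq_coords hI.zero_eq y]
      rw [hI.zero_eq]
      simp only [map_add, map_mul]
      ring
    rw [e, map_add, map_add, Finsupp.add_apply, Finsupp.add_apply, repr_algebraMap_mul,
      repr_algebraMap_mul, repr_algebraMap_mul, b.repr_self, b.repr_self]
    simp
    exact Or.inl rfl
  set ε := (resCard F : ℝ) ^ (-(j : ℤ)) with hε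
  have hε0 : 0 ≤ ε := zpow_nonneg resCard_pos_real.le _
  have h1 : absv (b.repr x 0 * b.repr y 1) ≤ ε := by
    rw [absv_mul]
    exact (mul_le_mul hx0 hy.2 (absv_nonneg _) zero_le_one).trans_eq (one_mul _)
  have h2 : absv (b.repr x 1 * b.repr y 0) ≤ ε := by
    rw [absv_mul]
    exact (mul_le_mul hx.2 hy0 (absv_nonneg _) hε0).trans_eq (mul_one _)
  have h3 : absv (b.repr x 1 * b.repr y 1 * c) ≤ ε := by
    rw [absv_mul, absv_mul]
    have := mul_le_mul hx.2 hy1 (absv_nonneg _) hε0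
    exact (mul_le_mul this hθ (absv_nonneg _) (by simpa using hε0)).trans_eq (by ring)
  rw [h]
  exact (absv_add_le _ _).trans (max_le ((absv_add_le _ _).trans (max_le h1 h2)) h3)

/-- For y = x⁻¹ the second coordinate of xy = 1 reads y₂ (xθ)₂ = -y₁ x₂. If j ≥ 1 then (xθ)₂ is
congruent to the unit x₁, so |y₂| ≤ |x₂|. -/
lemma inv_mem_levelUnits {j : ℕ} {x : E} (hx : x ∈ levelUnits b j) : x⁻¹ ∈ levelUnits b j := by
  have hx' : absv x⁻¹ = 1 := by rw [absv_inv, hx.1, inv_one]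
  refine ⟨hx', ?_⟩
  obtain ⟨hy0, hy1⟩ := (hI.le_one_iff x⁻¹).1 hx'.le
  rcases Nat.eq_zero_or_pos j with rfl | hj
  · simpa using hy1
  set y := x⁻¹ with hy
  set ε := (resCard F : ℝ) ^ (-(j : ℤ)) with hε
  have hq := one_lt_resCard_real (K := F)
  have hε1 : ε < 1 := zpow_lt_one_of_neg₀ hq (by omega)
  have hxy : x * y = 1 := mul_inv_cancel₀ fun h => by
    have := hx.1
    rw [h, absv_zero] at this
    exact zero_ne_one this
  have hx0 := (hI.absv_eq_one_iff (hx.2.trans_lt hε1)).1 hx.1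
  have hθ : absv (b.repr (b 1 * b 1) 1) ≤ 1 := ((hI.le_one_iff _).1 (by
    rw [absv_mul]; exact mul_le_one₀ hI.absv_one_le (absv_nonneg _) hI.absv_one_le)).2
  by_contra! hlt
  have e : x * y = algebraMap F E (b.repr y 0) * x + algebraMap F E (b.repr y 1) * (x * b 1) := by
    conv_lhs => rw [eq_coords hI.zero_eq y]
    ring
  have e2 : b.repr (x * b 1) 1 = b.repr x 0 + b.repr x 1 * b.repr (b 1 * b 1) 1 := by
    have : x * b 1 = algebraMap F E (b.repr x 0) * b 1 +
        algebraMap F E (b.repr x 1) * (b 1 * b 1) := by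
      conv_lhs => rw [eq_coords hI.zero_eq x]
      ring
    rw [this, map_add, Finsupp.add_apply, repr_algebraMap_mul, repr_algebraMap_mul, b.repr_self]
    simp
  have e3 : absv (b.repr (x * b 1) 1) = 1 := by
    rw [e2, ← hx0]
    refine absv_eq_of_sub_lt ?_
    rw [add_sub_cancel_left, absv_mul, hx0]
    calc _ ≤ ε * 1 := mul_le_mul hx.2 hθ (absv_nonneg _) (zpow_nonneg resCard_pos_real.le _)
      _ < 1 := by linarith
  have e4 : b.repr y 1 * b.repr (x * b 1) 1 = - (b.repr y 0 * b.repr x 1) := by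
    have := congrArg (fun w => b.repr w 1) (e.symm.trans hxy)
    simp only [map_add, Finsupp.add_apply, repr_algebraMap_mul] at this
    rw [← hI.zero_eq, b.repr_self] at this
    simp at this
    linear_combination this
  have e5 := congrArg absv e4
  rw [absv_mul, e3, mul_one, absv_neg, absv_mul] at e5
  have := mul_le_mul hy0 hx.2 (absv_nonneg _) zero_le_one
  linarith

variable [MeasurableSpace E] [BorelSpace E] (μ : Measure E) [μ.IsAddHaarMeasure]

/-- The level set is a group, and translating by u multiplies the integral by ω(u) ≠ 1. -/
lemma setIntegral_levelUnits_unitExt_eq_zero (ω : UnitChar E) {j : ℕ} {u : E}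
    (hu : u ∈ levelUnits b j) (hω : unitExt ω u ≠ 1) :
    ∫ x in levelUnits b j, unitExt ω x ∂μ = 0 := by
  have hu0 : u ≠ 0 := fun h => by
    have := hu.1
    rw [h, absv_zero] at this
    exact zero_ne_one this
  have hm := (isClopen_levelUnits b j).isOpen.measurableSet
  have h1 := setIntegral_comp_continuousAddEquiv μ (mulAut (Units.mk0 u hu0)) (unitExt ω) hm
  have h2 : mulAut (Units.mk0 u hu0) ⁻¹' levelUnits b j = levelUnits b j := by
    ext x
    rw [Set.mem_preimage, mulAut_apply, Units.val_mk0]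
    refine ⟨fun h => ?_, hI.mul_mem_levelUnits hu⟩
    have := hI.mul_mem_levelUnits (hI.inv_mem_levelUnits hu) h
    rwa [inv_mul_cancel_left₀ hu0] at this
  have h3 : ∫ x in levelUnits b j, unitExt ω (mulAut (Units.mk0 u hu0) x) ∂μ =
      ∫ x in levelUnits b j, unitExt ω u * unitExt ω x ∂μ :=
    setIntegral_congr_fun hm fun x hx => by
      rw [mulAut_apply, Units.val_mk0]
      exact unitExt_mul ω hu.1 hx.1
  rw [h2, h3, haarChar_mulAut, Units.val_mk0, hu.1, integral_const_mul, Complex.ofReal_one,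
    one_mul] at h1
  have : (1 - unitExt ω u) * ∫ x in levelUnits b j, unitExt ω x ∂μ = 0 := by
    linear_combination h1
  exact (mul_eq_zero.1 this).resolve_left (sub_ne_zero.2 (Ne.symm hω))

omit [MeasurableSpace E] [BorelSpace E] in
-- Write x = x₁ (1 + (x₂/x₁)θ): ω is trivial on x₁ by hypothesis, and on the second factor by
-- continuity once x₂ is small.
lemma exists_unitExt_eq_one_on_levelUnits {ω : UnitChar E}
    (hω : ∀ a : F, absv a = 1 → unitExt ω (algebraMap F E a) = 1) :
    ∃ j, ∀ x ∈ levelUnits b j, unitExt ω x = 1 := by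
  obtain ⟨m, -, hm⟩ := exists_conductor ω
  have hq := one_lt_resCard_real (K := F)
  obtain ⟨n, hn⟩ := exists_pow_lt_of_lt_one
    (zpow_pos (resCard_pos_real (K := E)) (-(m : ℤ))) (inv_lt_one_of_one_lt₀ hq)
  refine ⟨n + 1, fun x hx => ?_⟩
  set ε := (resCard F : ℝ) ^ (-((n + 1 : ℕ) : ℤ)) with hε
  have hε0 : 0 < ε := zpow_pos resCard_pos_real _
  have hε1 : ε < 1 := zpow_lt_one_of_neg₀ hq (by push_cast; omega)
  have hεn : ε ≤ ((resCard F : ℝ)⁻¹) ^ n := by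
    rw [inv_pow, ← zpow_natCast, ← zpow_neg]
    exact zpow_le_zpow_right₀ hq.le (by push_cast; omega)
  have hx0 := (hI.absv_eq_one_iff (hx.2.trans_lt hε1)).1 hx.1
  have h0 : b.repr x 0 ≠ 0 := fun h => by
    rw [h, absv_zero] at hx0
    exact zero_ne_one hx0
  have h0' : algebraMap F E (b.repr x 0) ≠ 0 := by simpa using h0
  have ha : absv (algebraMap F E (b.repr x 0)) = 1 := by rw [absv_algebraMap b, hx0, one_pow]
  have e : x = algebraMap F E (b.repr x 0) * (x / algebraMap F E (b.repr x 0)) := by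
    field_simp
  rw [e, unitExt_mul ω ha (by rw [absv_div, ha, hx.1, div_one]), hω _ hx0, one_mul]
  refine hm _ ?_
  rw [div_sub_one h0', absv_div, ha, div_one]
  have : x - algebraMap F E (b.repr x 0) = algebraMap F E (b.repr x 1) * b 1 := by
    nth_rw 1 [eq_coords hI.zero_eq x]
    ring
  rw [this, absv_mul, absv_algebraMap b]
  have h1 := absv_nonneg (b.repr x 1)
  have h2 := hI.absv_one_le
  calc absv (b.repr x 1) ^ 2 * absv (b 1) ≤ absv (b.repr x 1) ^ 2 * 1 := by gcongr
    _ ≤ ε ^ 2 := by rw [mul_one]; exact pow_le_pow_left₀ h1 hx.2 2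
    _ ≤ ε := by nlinarith
    _ ≤ _ := hεn.trans hn.le

omit hI in
-- The hypothesis `hU` says that being a unit depends on x₁ alone. It holds for j ≥ 1 in any
-- integral basis, but already for j = 0 in the ramified case; this is where the two cases part.
lemma preimage_scaleAut_levelUnits (hϖF : Irreducible ϖF) {j : ℕ}
    (hU : ∀ x, absv (b.repr x 1) ≤ (resCard F : ℝ) ^ (-(j : ℤ)) →
      (absv x = 1 ↔ absv (b.repr x 0) = 1)) (l : Fˣ) (hl : (l : F) = ϖF) :
    scaleAut b 1 l ⁻¹' levelUnits b (j + 1) = levelUnits b j := by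
  ext x
  have hq := one_lt_resCard_real (K := F)
  have h1 : absv (b.repr (scaleAut b 1 l x) 1) ≤ (resCard F : ℝ) ^ (-((j + 1 : ℕ) : ℤ)) ↔
      absv (b.repr x 1) ≤ (resCard F : ℝ) ^ (-(j : ℤ)) := by
    rw [repr_scaleAut_one, absv_mul, hl, absv_uniformizer hϖF,
      inv_mul_le_iff₀ resCard_pos_real, ← zpow_one_add₀ resCard_pos_real.ne']
    push_cast
    ring_nf
  have h2 : (resCard F : ℝ) ^ (-((j + 1 : ℕ) : ℤ)) ≤ (resCard F : ℝ) ^ (-(j : ℤ)) :=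
    zpow_le_zpow_right₀ hq.le (by push_cast; omega)
  rw [Set.mem_preimage, levelUnits, levelUnits, Set.mem_ofPred_eq, Set.mem_ofPred_eq, h1]
  refine and_congr_left fun h => ?_
  rw [hU _ ((h1.2 h).trans h2), hU _ h, repr_scaleAut_zero, Units.val_one, one_mul]

lemma one_sub_mul_setIntegral_levelUnits (hϖF : Irreducible ϖF) {z : ℂ} (hz : 0 < (z + 1).re)
    {j : ℕ} (hj : j ≠ 0) :
    (1 - (resCard F : ℂ) ^ (-z - 1)) * ∫ x in levelUnits b j, coordPow b ϖF z x ∂μ =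
      ((resCard F : ℂ) ^ (-z)) ^ j * (1 - (resCard F : ℂ)⁻¹) * μ.real (levelUnits b j) :=
  setIntegral_levelUnits_coordPow μ hϖF hz (hI.levelUnits_subset_box j)
    (preimage_scaleAut_levelUnits hϖF fun x hx => hI.absv_eq_one_iff (hx.trans_lt
      (zpow_lt_one_of_neg₀ one_lt_resCard_real (by omega))))

/-- The integral over the units, for a nontrivial angular character. -/
lemma exists_setIntegral_units_eq (hϖF : Irreducible ϖF) {ω : UnitChar E}
    (hω : ∀ a : F, absv a = 1 → unitExt ω (algebraMap F E a) = 1) (hω1 : ω ≠ 1) :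
    ∃ (A : ℂ) (n : ℕ), A ≠ 0 ∧ ∀ z : ℂ, 0 < (z + 1).re →
      (1 - (resCard F : ℂ) ^ (-z - 1)) *
        ∫ x in {x | absv x = 1}, unitExt ω x * coordPow b ϖF z x ∂μ =
      A * ((resCard F : ℂ) ^ (-z)) ^ n * ((resCard F : ℂ) ^ (-z) - 1) := by
  classical
  have hex := hI.exists_unitExt_eq_one_on_levelUnits hω
  have hspec := Nat.find_spec hex
  have hmin : ∀ i < Nat.find hex, ∃ u ∈ levelUnits b i, unitExt ω u ≠ 1 := fun i hi => by
    have := Nat.find_min hex hi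
    push Not at this
    exact this
  -- The least level on which ω is trivial is positive, since level 0 consists of all units. By
  -- orthogonality ω integrates to zero on the levels up to n, so the only jump in the telescoping
  -- occurs at level n.
  obtain ⟨n, hn⟩ : ∃ n, Nat.find hex = n + 1 := by
    refine Nat.exists_eq_succ_of_ne_zero fun h0 => hω1 ?_
    rw [h0, hI.levelUnits_zero] at hspec
    ext u
    rw [← unitExt_unit]
    have := hspec _ (absv_unit u)
    rw [this]
    rfl
  rw [hn] at hspec hmin
  have hV : 0 < μ.real (levelUnits b (n + 1)) :=
    measureReal_pos_of_isOpen_of_isCompact (isClopen_levelUnits b _).isOpen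
      (isCompact_levelUnits b _) ⟨1, absv_one, by
        rw [← hI.zero_eq, b.repr_self]
        simpa [absv_zero] using zpow_nonneg (resCard_pos_real (K := F)).le _⟩
  refine ⟨μ.real (levelUnits b (n + 1)), n, by exact_mod_cast hV.ne', fun z hz => ?_⟩
  have hq : (resCard F : ℂ) ≠ 0 := by exact_mod_cast (resCard_pos_real (K := F)).ne'
  have hW : ∀ i < n + 1, ∫ x in levelUnits b i, unitExt ω x ∂μ = 0 := fun i hi => by
    obtain ⟨u, hu, hu1⟩ := hmin i hi
    exact hI.setIntegral_levelUnits_unitExt_eq_zero μ ω hu hu1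
  have hW' : ∫ x in levelUnits b (n + 1), unitExt ω x ∂μ = μ.real (levelUnits b (n + 1)) := by
    rw [setIntegral_congr_fun (g := fun _ => (1 : ℂ))
      (isClopen_levelUnits b (n + 1)).isOpen.measurableSet fun x hx => hspec x hx,
      setIntegral_const, Complex.real_smul, mul_one]
  have hI' : ∫ x in levelUnits b (n + 1), unitExt ω x * coordPow b ϖF z x ∂μ =
      ∫ x in levelUnits b (n + 1), coordPow b ϖF z x ∂μ :=
    setIntegral_congr_fun (isClopen_levelUnits b (n + 1)).isOpen.measurableSet fun x hx => by
      rw [hspec x hx, one_mul]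
  have hrec : ∀ i ≤ n, ∫ x in levelUnits b 0, unitExt ω x * coordPow b ϖF z x ∂μ =
      ∫ x in levelUnits b i, unitExt ω x * coordPow b ϖF z x ∂μ := by
    intro i
    induction i with
    | zero => intro _; rfl
    | succ i ih =>
      intro hi
      rw [ih (by omega), setIntegral_levelUnits_sub μ ω hϖF hz (hI.levelUnits_subset_box i),
        hW i (by omega), hW (i + 1) (by omega), sub_zero, mul_zero, add_zero]
  have h1 := setIntegral_levelUnits_sub μ ω hϖF hz (hI.levelUnits_subset_box n)
  have h2 := hI.one_sub_mul_setIntegral_levelUnits μ hϖF hz n.succ_ne_zero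
  rw [Nat.succ_eq_add_one] at h2
  rw [← hI.levelUnits_zero, hrec n le_rfl, h1, hW n (by omega), hW', hI', mul_add, h2,
    Complex.cpow_sub _ _ hq, Complex.cpow_one]
  ring

end IsIntegralBasis

end LevelGroups

/-! ### Integrals of |x₂|ᶻ over the units. -/

section TrivialAngularCharacter

variable {F E : Type*} [Field F] [ValuativeRel F] [TopologicalSpace F]
  [IsNonarchimedeanLocalField F] [Field E] [ValuativeRel E] [TopologicalSpace E]
  [IsNonarchimedeanLocalField E] [Algebra F E] [ValuativeExtension F E]

variable {b : Module.Basis (Fin 2) F E} {ϖF : 𝒪[F]}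

/-- The shape of the absolute value in an integral basis, in the unramified case. -/
def IsUnramifiedBasis (b : Module.Basis (Fin 2) F E) : Prop :=
  ∀ x, absv x = max (absv (b.repr x 0)) (absv (b.repr x 1)) ^ 2

/-- The shape of the absolute value in an integral basis, in the ramified case. -/
def IsRamifiedBasis (b : Module.Basis (Fin 2) F E) : Prop :=
  ∀ x, absv x = max (absv (b.repr x 0) ^ 2) (absv (b.repr x 1) ^ 2 * (resCard F : ℝ)⁻¹)

lemma absv_sq_mul_inv_le_one_iff {a : F} :
    absv a ^ 2 * (resCard F : ℝ)⁻¹ ≤ 1 ↔ absv a ≤ 1 := by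
  have hq := one_lt_resCard_real (K := F)
  rw [mul_inv_le_iff₀ resCard_pos_real, one_mul]
  constructor
  · intro h
    by_contra! h1
    have := absv_le_zpow_or (x := a) (n := 0) (by simpa using h1)
    rw [zero_add, zpow_one] at this
    nlinarith
  · intro h
    have := absv_nonneg a
    nlinarith

lemma IsUnramifiedBasis.isIntegralBasis (hb : b 0 = 1) (h : IsUnramifiedBasis b) :
    IsIntegralBasis b := by
  refine ⟨hb, fun x => ?_⟩
  rw [h, pow_le_one_iff_of_nonneg (le_max_of_le_left (absv_nonneg _)) two_ne_zero, max_le_iff]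

lemma IsRamifiedBasis.isIntegralBasis (hb : b 0 = 1) (h : IsRamifiedBasis b) :
    IsIntegralBasis b := by
  refine ⟨hb, fun x => ?_⟩
  rw [h, max_le_iff, absv_sq_mul_inv_le_one_iff,
    pow_le_one_iff_of_nonneg (absv_nonneg _) two_ne_zero]

lemma sq_absv_ne (a c : F) (hc : c ≠ 0) : absv a ^ 2 ≠ absv c ^ 2 * (resCard F : ℝ)⁻¹ := by
  have hq := one_lt_resCard_real (K := F)
  by_cases ha : a = 0
  · have := absv_pos hc
    have : 0 < absv c ^ 2 * (resCard F : ℝ)⁻¹ := by positivity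
    rw [ha, absv_zero, zero_pow two_ne_zero]
    exact this.ne
  · rw [absv_of_ne_zero hc, absv_of_ne_zero ha, ← zpow_natCast, ← zpow_natCast, ← zpow_mul,
      ← zpow_mul, ← zpow_sub_one₀ (by linarith)]
    intro h
    have := zpow_right_injective₀ (by linarith) hq.ne' h
    push_cast at this
    omega

lemma IsRamifiedBasis.absv_eq_one_iff (h : IsRamifiedBasis b) {x : E}
    (hx : absv (b.repr x 1) ≤ 1) : absv x = 1 ↔ absv (b.repr x 0) = 1 := by
  have hq := one_lt_resCard_real (K := F)
  have h1 : absv (b.repr x 1) ^ 2 * (resCard F : ℝ)⁻¹ < 1 := by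
    rw [mul_inv_lt_iff₀ resCard_pos_real, one_mul]
    have := absv_nonneg (b.repr x 1)
    nlinarith
  rw [h, ← pow_eq_one_iff_of_nonneg (absv_nonneg (b.repr x 0)) two_ne_zero]
  constructor
  · intro h2
    rcases max_choice (absv (b.repr x 0) ^ 2) (absv (b.repr x 1) ^ 2 * (resCard F : ℝ)⁻¹)
      with h3 | h3
    · rw [← h3, h2]
    · linarith
  · intro h2
    rw [h2, max_eq_left h1.le]

/-- An odd power of q can only come from the second term of the maximum. -/
lemma IsRamifiedBasis.absv_repr_eq_one (h : IsRamifiedBasis b) {x : E}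
    (hx : absv x = (resCard F : ℝ)⁻¹) : absv (b.repr x 1) = 1 := by
  have hq := one_lt_resCard_real (K := F)
  rw [h] at hx
  rcases max_choice (absv (b.repr x 0) ^ 2) (absv (b.repr x 1) ^ 2 * (resCard F : ℝ)⁻¹)
    with h3 | h3
  · rw [hx] at h3
    exact absurd h3.symm (by simpa [absv_one] using sq_absv_ne (b.repr x 0) (1 : F) one_ne_zero)
  · rw [hx] at h3
    have h4 : absv (b.repr x 1) ^ 2 = 1 := by
      have : (resCard F : ℝ)⁻¹ ≠ 0 := by positivity
      field_simp at h3
      linarith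
    exact (pow_eq_one_iff_of_nonneg (absv_nonneg _) two_ne_zero).1 h4

variable [MeasurableSpace E] [BorelSpace E] (μ : Measure E) [μ.IsAddHaarMeasure]

lemma measureReal_box (hϖF : Irreducible ϖF) (i j : ℕ) :
    μ.real (box b ((resCard F : ℝ) ^ (-(i : ℤ))) ((resCard F : ℝ) ^ (-(j : ℤ)))) =
      (resCard F : ℝ) ^ (-(i : ℤ)) * (resCard F : ℝ) ^ (-(j : ℤ)) * μ.real (box b 1 1) := by
  obtain ⟨l, hl⟩ := (uniformizer_ne_zero hϖF).isUnit
  have h := image_scaleAut_box b (l ^ i) (l ^ j) 1 1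
  have e : ∀ n : ℕ, absv ((l ^ n : Fˣ) : F) = (resCard F : ℝ) ^ (-(n : ℤ)) := fun n => by
    rw [Units.val_pow_eq_pow_val, hl, ← zpow_natCast, absv_uniformizer_zpow hϖF]
  rw [mul_one, mul_one, e, e] at h
  rw [← h, Measure.real, measure_image_continuousAddEquiv, Measure.real]
  have h2 := haarChar_scaleAut b (l ^ i) (l ^ j)
  rw [e, e] at h2
  rw [← h2]
  simp [ENNReal.smul_def]

/-- Relative to the unit box, the units are its complement of the box of radii q⁻¹, of volume 1 -
q⁻², and level 1 has volume q⁻¹ - q⁻². -/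
lemma measureReal_units_of_unramified (hϖF : Irreducible ϖF) (hI : IsIntegralBasis b)
    (h : IsUnramifiedBasis b) : μ.real {x : E | absv x = 1} =
      (1 + resCard F) * μ.real (levelUnits b 1) := by
  have hq := one_lt_resCard_real (K := F)
  set q : ℝ := (resCard F : ℝ) with hqdef
  have h1 : levelUnits b 1 = box b 1 q⁻¹ \ box b q⁻¹ q⁻¹ := by
    ext x
    have e : q ^ (-((1 : ℕ) : ℤ)) = q⁻¹ := by simp
    rw [levelUnits, Set.mem_ofPred_eq, e]
    simp only [box, Set.mem_sdiff, Set.mem_ofPred_eq, not_and, not_le]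
    have hlt : q⁻¹ < 1 := inv_lt_one_of_one_lt₀ hq
    constructor
    · rintro ⟨hx, hx1⟩
      have := (hI.absv_eq_one_iff (hx1.trans_lt hlt)).1 hx
      refine ⟨⟨this.le, hx1⟩, fun h2 => ?_⟩
      linarith
    · rintro ⟨⟨hx0, hx1⟩, h2⟩
      refine ⟨(hI.absv_eq_one_iff (hx1.trans_lt hlt)).2 (le_antisymm hx0 ?_), hx1⟩
      by_contra! h3
      have := h2 (absv_lt_one_iff.1 h3)
      linarith
  have h2 : {x : E | absv x = 1} = box b 1 1 \ box b q⁻¹ q⁻¹ := by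
    ext x
    simp only [box, Set.mem_sdiff, Set.mem_ofPred_eq, not_and, not_le]
    rw [h, pow_eq_one_iff_of_nonneg (le_max_of_le_left (absv_nonneg _)) two_ne_zero]
    constructor
    · intro hx
      refine ⟨⟨(le_max_left _ _).trans hx.le, (le_max_right _ _).trans hx.le⟩, fun h3 => ?_⟩
      rw [← not_le, ← absv_lt_one_iff]
      rw [← absv_lt_one_iff] at h3
      intro h4
      exact absurd hx (max_lt h3 h4).ne
    · rintro ⟨⟨hx0, hx1⟩, h2⟩
      refine le_antisymm (max_le hx0 hx1) ?_
      by_contra! h3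
      rw [max_lt_iff] at h3
      have := h2 (absv_lt_one_iff.1 h3.1)
      have := absv_lt_one_iff.1 h3.2
      linarith
  have e0 : q ^ (-((0 : ℕ) : ℤ)) = 1 := by simp
  have e1 : q ^ (-((1 : ℕ) : ℤ)) = q⁻¹ := by simp
  have m1 := measureReal_box (b := b) μ hϖF 0 1
  have m2 := measureReal_box (b := b) μ hϖF 1 1
  rw [← hqdef, e1] at m1 m2
  rw [e0, one_mul] at m1
  have hlt : q⁻¹ ≤ 1 := (inv_lt_one_of_one_lt₀ hq).le
  have hq0 : 0 < q⁻¹ := by positivity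
  have hm := (isClopen_box b hq0 hq0).isOpen.measurableSet
  have hsub : ∀ {r r' : ℝ}, q⁻¹ ≤ r → q⁻¹ ≤ r' → box b q⁻¹ q⁻¹ ⊆ box b r r' :=
    fun h3 h4 x hx => ⟨hx.1.trans h3, hx.2.trans h4⟩
  rw [h1, h2, measureReal_sdiff (hsub hlt hlt) hm (isCompact_box b _ _).measure_lt_top.ne,
    measureReal_sdiff (hsub hlt le_rfl) hm (isCompact_box b _ _).measure_lt_top.ne, m1, m2]
  have : q ≠ 0 := by linarith
  field_simp
  ring

lemma measureReal_levelUnits_pos (hI : IsIntegralBasis b) (j : ℕ) :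
    0 < μ.real (levelUnits b j) :=
  measureReal_pos_of_isOpen_of_isCompact (isClopen_levelUnits b _).isOpen
    (isCompact_levelUnits b _) ⟨1, absv_one, by
      rw [← hI.zero_eq, b.repr_self]
      simpa [absv_zero] using zpow_nonneg (resCard_pos_real (K := F)).le _⟩

/-- The integral of `|x₂|ᶻ` over the units, for an unramified extension. -/
lemma exists_setIntegral_units_coordPow_of_unramified (hϖF : Irreducible ϖF)
    (hI : IsIntegralBasis b) (h : IsUnramifiedBasis b) : ∃ A : ℂ, A ≠ 0 ∧ ∀ z : ℂ,
      0 < (z + 1).re → (1 - (resCard F : ℂ) ^ (-z - 1)) *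
        ∫ x in {x | absv x = 1}, coordPow b ϖF z x ∂μ =
      A * (1 - (resCard F : ℂ) ^ (-z) / (resCard F : ℂ) ^ 2) := by
  have hq : (resCard F : ℂ) ≠ 0 := by exact_mod_cast (resCard_pos_real (K := F)).ne'
  have hV := measureReal_levelUnits_pos μ hI 1
  refine ⟨resCard F * μ.real (levelUnits b 1), mul_ne_zero hq (by exact_mod_cast hV.ne'),
    fun z hz => ?_⟩
  have h1 := setIntegral_levelUnits_sub μ 1 hϖF hz (hI.levelUnits_subset_box 0)
  have h2 := hI.one_sub_mul_setIntegral_levelUnits μ hϖF hz one_ne_zero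
  have hm := fun i => (isClopen_levelUnits b i).isOpen.measurableSet
  have hc : ∀ i, ∫ x in levelUnits b i, unitExt 1 x * coordPow b ϖF z x ∂μ =
      ∫ x in levelUnits b i, coordPow b ϖF z x ∂μ := fun i =>
    setIntegral_congr_fun (hm i) fun x hx => by
      rw [unitExt_one_char hx.1, one_mul]
  have hc' : ∀ i, ∫ x in levelUnits b i, unitExt 1 x ∂μ = μ.real (levelUnits b i) := fun i => by
    rw [setIntegral_congr_fun (g := fun _ => (1 : ℂ)) (hm i) fun x hx => unitExt_one_char hx.1,
      setIntegral_const, Complex.real_smul, mul_one]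
  rw [zero_add, hc, hc, hc', hc', hI.levelUnits_zero, measureReal_units_of_unramified μ hϖF hI h]
    at h1
  rw [h1, mul_add, h2, Complex.cpow_sub _ _ hq, Complex.cpow_one]
  push_cast
  field_simp
  ring

lemma one_sub_mul_setIntegral_units_coordPow_of_ramified (hϖF : Irreducible ϖF)
    (hI : IsIntegralBasis b) (h : IsRamifiedBasis b) {z : ℂ} (hz : 0 < (z + 1).re) :
    (1 - (resCard F : ℂ) ^ (-z - 1)) * ∫ x in {x | absv x = 1}, coordPow b ϖF z x ∂μ =
      (1 - (resCard F : ℂ)⁻¹) * μ.real {x : E | absv x = 1} := by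
  have := setIntegral_levelUnits_coordPow μ hϖF hz (hI.levelUnits_subset_box 0)
    (IsIntegralBasis.preimage_scaleAut_levelUnits hϖF fun x hx =>
      h.absv_eq_one_iff (by simpa using hx))
  rwa [pow_zero, one_mul, hI.levelUnits_zero] at this

end TrivialAngularCharacter

/-! ### The kernel on the set `//`. -/

section SlashKernel

variable {F E : Type*} [Field F] [ValuativeRel F] [TopologicalSpace F]
  [IsNonarchimedeanLocalField F] [Field E] [ValuativeRel E] [TopologicalSpace E]
  [IsNonarchimedeanLocalField E] [Algebra F E] [ValuativeExtension F E]

variable {b : Module.Basis (Fin 2) F E} {d : F} {ϖF : 𝒪[F]} {ϖE : 𝒪[E]} {χ : UnitChar E}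
  {η : UnitChar F} {s t : ℂ}

variable (hb : b 0 = 1) (hd : b 1 ^ 2 = algebraMap F E d) (hϖF : Irreducible ϖF)
  (hϖE : Irreducible ϖE) (hχ : multChar ϖE χ 0 (algebraMap F E ϖF) = 1)

include hb hd hϖF hϖE hχ

/-- Here κ = (χ|²)_{4s}, so κ(N(x)) is the value of (χ²)_{2s} at the product of x and its conjugate;
the factor at x cancels against χ_{s-1/2}(x)² up to |x|. -/
lemma smoothFactor_slash (hη : resChar χ = η) {x : E} (hx : x ≠ 0) :
    smoothFactor b d ϖF ϖE χ η s (2 * s + 1 / 2) x =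
      (multChar ϖE (χ ^ 2) (2 * s + 1) (conj b x))⁻¹ := by
  have hN := normForm_ne_zero hb hd hx
  have hcx : conj b x ≠ 0 := (map_ne_zero_iff (conj b) (conj b).injective).2 hx
  have hax : (absv x : ℂ) ≠ 0 := by exact_mod_cast (absv_pos hx).ne'
  have h1 : fiberChar ϖF χ η s (2 * s + 1 / 2) (normForm b d x) =
      multChar ϖE (χ ^ 2) (2 * s) x * multChar ϖE (χ ^ 2) (2 * s) (conj b x) := by
    rw [fiberChar, ← hη, ← sq, show 2 * s + (2 * s + 1 / 2) - 1 / 2 = 2 * (2 * s) by ring,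
      ← multChar_pow_char _ _ hN, ← multChar_algebraMap b hϖF hϖE hχ, ← mul_conj hb hd,
      multChar_mul hϖE, mul_pow, multChar_pow_char _ _ hx, multChar_pow_char _ _ hcx]
  have h2 : multChar ϖE (χ ^ 2) (2 * s) x = multChar ϖE χ (s - 1 / 2) x ^ 2 * absv x := by
    rw [multChar_pow_char _ _ hx, ← pow_one (absv x : ℂ), ← multChar_add_nat]
    congr 1
    push_cast
    ring
  have h3 : multChar ϖE (χ ^ 2) (2 * s + 1) (conj b x) =
      multChar ϖE (χ ^ 2) (2 * s) (conj b x) * absv x := by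
    have := multChar_add_nat ϖE (χ ^ 2) (2 * s) 1 (conj b x)
    rwa [Nat.cast_one, pow_one, absv_conj hb hd] at this
  have h4 := multChar_ne_zero hϖE χ (s - 1 / 2) hx
  have h5 := multChar_ne_zero hϖE (χ ^ 2) (2 * s) hcx
  rw [smoothFactor, h1, h2, h3]
  generalize multChar ϖE χ (s - 1 / 2) x = u at *
  generalize multChar ϖE (χ ^ 2) (2 * s) (conj b x) = v at *
  field_simp

lemma kernelFun_slash (hη : resChar χ = η) (x : E) :
    kernelFun b d ϖF ϖE χ η s (2 * s + 1 / 2) x =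
      (multChar ϖE (χ ^ 2) (2 * s + 1) (conj b x))⁻¹ *
        multChar ϖF (resChar χ ^ 2) (4 * s) (b.repr x 1) := by
  by_cases hx : x = 0
  · rw [kernelFun_eq hb hd hϖF hϖE hχ, hx]
    simp [multChar_zero, fiberChar_zero]
  rw [kernelFun_eq hb hd hϖF hϖE hχ, smoothFactor_slash hb hd hϖF hϖE hχ hη hx, fiberChar, ← hη,
    ← sq]
  congr 2
  ring

/-- As χ² is trivial on the units of F, (χ²)_{2s+1} sends N(x) to a power of |x|, which trades the
conjugate of x for x⁻¹. The kernel becomes a quasi-character of x times a power of |x₂|. -/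
lemma kernelFun_slash_of_sq_eq_one (hη : resChar χ = η) (hη2 : resChar (F := F) χ ^ 2 = 1) {x : E}
    (hx : x ≠ 0) : kernelFun b d ϖF ϖE χ η s (2 * s + 1 / 2) x =
      multChar ϖE (χ ^ 2) (-2 * s - 1) x * multChar ϖF 1 (4 * s) (b.repr x 1) := by
  rw [kernelFun_slash hb hd hϖF hϖE hχ hη, hη2]
  congr 1
  have hN := normForm_ne_zero hb hd hx
  have hcx : conj b x ≠ 0 := (map_ne_zero_iff (conj b) (conj b).injective).2 hx
  have hax : (absv x : ℂ) ≠ 0 := by exact_mod_cast (absv_pos hx).ne'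
  have hcomp : multChar ϖE (χ ^ 2) 0 (algebraMap F E ϖF) = 1 := by
    have := multChar_pow_char (ϖ := ϖE) χ 0 (x := algebraMap F E ϖF)
      (by simpa using uniformizer_ne_zero hϖF)
    rw [hχ, mul_zero, one_pow] at this
    exact this.symm
  have h1 : multChar ϖE (χ ^ 2) (2 * s + 1) x * multChar ϖE (χ ^ 2) (2 * s + 1) (conj b x) =
      (absv x : ℂ) ^ (2 * (2 * s + 1)) := by
    have hr : resChar (F := F) (χ ^ 2) = resChar (F := F) χ ^ 2 := rfl
    rw [← multChar_mul hϖE, mul_conj hb hd, multChar_algebraMap b hϖF hϖE hcomp,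
      hr, hη2, multChar_one_char hϖF _ hN,
      absv_normForm hb hd]
  have h2 : multChar ϖE (χ ^ 2) (2 * s + 1) x =
      multChar ϖE (χ ^ 2) (-2 * s - 1) x * (absv x : ℂ) ^ (2 * (2 * s + 1)) := by
    rw [← multChar_one_char hϖE _ hx, multChar_mul_multChar _ _ _ _ _ hx, mul_one]
    congr 1
    ring
  have h3 : (absv x : ℂ) ^ (2 * (2 * s + 1)) ≠ 0 := by
    rw [Complex.cpow_def_of_ne_zero hax]
    exact Complex.exp_ne_zero _
  have h4 := multChar_ne_zero hϖE (χ ^ 2) (2 * s + 1) hcx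
  rw [h2] at h1
  have := mul_right_cancel₀ h3 (by linear_combination h1 :
    (multChar ϖE (χ ^ 2) (-2 * s - 1) x * multChar ϖE (χ ^ 2) (2 * s + 1) (conj b x)) *
      (absv x : ℂ) ^ (2 * (2 * s + 1)) = 1 * (absv x : ℂ) ^ (2 * (2 * s + 1)))
  exact (eq_inv_of_mul_eq_one_left this).symm

end SlashKernel

/-! ### The value at the indicator of the integers. -/

section SlashConstant

variable {F E : Type*} [Field F] [ValuativeRel F] [TopologicalSpace F]
  [IsNonarchimedeanLocalField F] [Field E] [ValuativeRel E] [TopologicalSpace E]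
  [IsNonarchimedeanLocalField E] [Algebra F E] [ValuativeExtension F E]
  [MeasurableSpace E] [BorelSpace E]

variable {b b' : Module.Basis (Fin 2) F E} {d : F} {ϖF : 𝒪[F]} {ϖE : 𝒪[E]} {χ : UnitChar E}
  {η : UnitChar F} {s t : ℂ}

/-- Both bases begin with 1, so their second coordinates are proportional. Powers of |x₂| can thus
be integrated in an integral basis, which (1, α) need not be. -/
lemma repr_one_change (hb : b 0 = 1) (hb' : b' 0 = 1) (x : E) :
    b.repr x 1 = b'.repr x 1 * b.repr (b' 1) 1 := by
  conv_lhs => rw [eq_coords hb' x]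
  rw [map_add, Finsupp.add_apply, repr_algebraMap_one hb, zero_add, repr_algebraMap_mul]

lemma repr_change_ne_zero (hb : b 0 = 1) (hb' : b' 0 = 1) : b.repr (b' 1) 1 ≠ 0 := by
  intro h
  have := repr_one_change hb hb' (b 1)
  rw [h, mul_zero, b.repr_self] at this
  simp at this

variable (E F) in
/-- A fundamental domain for dilation by a uniformizer of `F`. -/
def fundamentalShell : Set E := {x | absv x ≤ 1 ∧ ((resCard F : ℝ) ^ 2)⁻¹ < absv x}

/-- The dilated integers form the ball of radius |ϖF|_E = q_F⁻². What remains is compact and avoids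
the origin, so the integral converges under the single condition Re(2s + t + 1/2) > 0. -/
lemma integerTest_sub_dil (b : Module.Basis (Fin 2) F E) (hϖF : Irreducible ϖF) (x : E) :
    integerTest E x - integerTest E (algebraMap F E (ϖF : F)⁻¹ * x) =
      (fundamentalShell F E).indicator 1 x := by
  have hq := one_lt_resCard_real (K := F)
  have h1 : algebraMap F E (ϖF : F)⁻¹ * x ∈ {x : E | absv x ≤ 1} ↔
      absv x ≤ ((resCard F : ℝ) ^ 2)⁻¹ := by
    rw [Set.mem_ofPred_eq, absv_mul, absv_algebraMap b, absv_inv, absv_uniformizer hϖF, inv_inv,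
      ← le_div_iff₀' (by positivity), one_div]
  have h2 : ((resCard F : ℝ) ^ 2)⁻¹ ≤ 1 := inv_le_one_of_one_le₀ (one_le_pow₀ hq.le)
  rw [integerTest, indicatorTest_apply, indicatorTest_apply]
  by_cases h3 : absv x ≤ ((resCard F : ℝ) ^ 2)⁻¹
  · rw [Set.indicator_of_mem (h1.2 h3),
      Set.indicator_of_mem (show x ∈ {x : E | absv x ≤ 1} from h3.trans h2),
      Set.indicator_of_notMem fun h => absurd h.2 (not_lt.2 h3)]
    exact sub_self _
  · rw [Set.indicator_of_notMem (mt h1.1 h3), sub_zero]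
    by_cases h4 : absv x ≤ 1
    · rw [Set.indicator_of_mem (show x ∈ {x : E | absv x ≤ 1} from h4),
        Set.indicator_of_mem (show x ∈ fundamentalShell F E from ⟨h4, not_le.1 h3⟩)]
    · rw [Set.indicator_of_notMem (show x ∉ {x : E | absv x ≤ 1} from h4),
        Set.indicator_of_notMem fun h => h4 h.1]

lemma isClopen_fundamentalShell : IsClopen (fundamentalShell F E) := by
  have : fundamentalShell F E = {x : E | absv x ≤ 1} \ {x | absv x ≤ ((resCard F : ℝ) ^ 2)⁻¹} := by
    ext x
    simp [fundamentalShell]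
  rw [this]
  exact (isClopen_absv_le one_pos).diff (isClopen_absv_le
    (inv_pos.2 (pow_pos resCard_pos_real 2)))

lemma isCompact_fundamentalShell : IsCompact (fundamentalShell F E) :=
  (isCompact_absv_le 1).of_isClosed_subset isClopen_fundamentalShell.isClosed fun _ hx => hx.1

lemma zero_notMem_fundamentalShell : (0 : E) ∉ fundamentalShell F E := fun h => by
  have h1 := h.2
  rw [absv_zero] at h1
  exact absurd h1 (not_lt.2 (inv_nonneg.2 (pow_nonneg resCard_pos_real.le 2)))

lemma fundamentalShell_of_unramified (hq : resCard E = resCard F ^ 2) :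
    fundamentalShell F E = {x | absv x = 1} := by
  have hE := one_lt_resCard_real (K := E)
  have e : ((resCard F : ℝ) ^ 2)⁻¹ = (resCard E : ℝ) ^ (-1 : ℤ) := by
    rw [hq, zpow_neg_one]
    push_cast
    rfl
  ext x
  rw [fundamentalShell, Set.mem_ofPred_eq, Set.mem_ofPred_eq, e]
  refine ⟨fun h => le_antisymm h.1 (by simpa using absv_le_zpow_or h.2), fun h => ⟨h.le, ?_⟩⟩
  rw [h, zpow_neg_one]
  exact inv_lt_one_of_one_lt₀ hE

lemma fundamentalShell_of_ramified (hq : resCard E = resCard F) :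
    fundamentalShell F E = {x | absv x = 1} ∪ {x | absv x = (resCard E : ℝ)⁻¹} := by
  have hE := one_lt_resCard_real (K := E)
  have e : ((resCard F : ℝ) ^ 2)⁻¹ = (resCard E : ℝ) ^ (-2 : ℤ) := by
    rw [hq, zpow_neg]
    norm_cast
  have h1 : (resCard E : ℝ)⁻¹ < 1 := inv_lt_one_of_one_lt₀ hE
  have h2 : (resCard E : ℝ) ^ (-2 : ℤ) < (resCard E : ℝ)⁻¹ := by
    rw [← zpow_neg_one]
    exact zpow_lt_zpow_right₀ hE (by norm_num)
  ext x
  rw [fundamentalShell, Set.mem_ofPred_eq, e, Set.mem_union, Set.mem_ofPred_eq, Set.mem_ofPred_eq]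
  constructor
  · rintro ⟨h3, h4⟩
    rcases h3.eq_or_lt with h | h
    · exact Or.inl h
    · refine Or.inr (le_antisymm (absv_lt_one_iff.1 h) ?_)
      have := absv_le_zpow_or h4
      rwa [show (-2 : ℤ) + 1 = -1 by norm_num, zpow_neg_one] at this
  · rintro (h | h)
    · exact ⟨h.le, by rw [h]; linarith⟩
    · exact ⟨by rw [h]; exact h1.le, by rw [h]; exact h2⟩

variable {μ : Measure E} [μ.IsAddHaarMeasure]

variable (hb : b 0 = 1) (hd : b 1 ^ 2 = algebraMap F E d) (hϖF : Irreducible ϖF)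
  (hϖE : Irreducible ϖE) (hχ : multChar ϖE χ 0 (algebraMap F E ϖF) = 1)

include hb hd hϖF hϖE hχ

lemma regInt_fundamentalShell {l : Fˣ} {c : ℂ}
    (hl : ∀ z r, (localL z (resChar χ * η) r)⁻¹ = c * (1 - multChar ϖF (resChar χ * η) (z + r) l))
    (hs : 0 < (2 * s + t + 1 / 2).re) :
    regInt b d ϖF ϖE μ χ η l c s t ((fundamentalShell F E).indicator 1) =
      (localL (1 / 2) (resChar χ * η) (2 * s + t))⁻¹ *
        ∫ x in fundamentalShell F E, kernelFun b d ϖF ϖE χ η s t x ∂μ := by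
  have hm : MeasurableSet (fundamentalShell F E) :=
    (isClopen_fundamentalShell (F := F) (E := E)).isOpen.measurableSet
  have e : (fun x => kernelFun b d ϖF ϖE χ η s t x * (fundamentalShell F E).indicator 1 x) =
      (fundamentalShell F E).indicator (kernelFun b d ϖF ϖE χ η s t) := by
    funext x
    by_cases hx : x ∈ fundamentalShell F E
    · rw [Set.indicator_of_mem hx, Set.indicator_of_mem hx, Pi.one_apply, mul_one]
    · rw [Set.indicator_of_notMem hx, Set.indicator_of_notMem hx, mul_zero]
  rw [regInt_eq_of_integrable hb hd hϖF hϖE hχ hl, e, integral_indicator hm]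
  rw [e, integrable_indicator_iff hm]
  exact integrableOn_kernelFun_of_isCompact hb hd hϖF hϖE hχ hs isCompact_fundamentalShell
    zero_notMem_fundamentalShell

/-- The value of the distribution at the indicator of the integers, in terms of an integral
basis `b'`. -/
lemma regInt_fundamentalShell_of_sq_eq_one (hη : resChar χ = η) (hη2 : resChar χ * η = 1)
    (hb' : b' 0 = 1) {l : Fˣ} {c : ℂ}
    (hl : ∀ z r, (localL z (resChar χ * η) r)⁻¹ = c * (1 - multChar ϖF (resChar χ * η) (z + r) l))
    (hs : 0 < (4 * s + 1).re) :
    regInt b d ϖF ϖE μ χ η l c s (2 * s + 1 / 2) ((fundamentalShell F E).indicator 1) =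
      multChar ϖF 1 (4 * s) (b.repr (b' 1) 1) * ((1 - (resCard F : ℂ) ^ (-(4 * s) - 1)) *
        ∫ x in fundamentalShell F E,
          multChar ϖE (χ ^ 2) (-2 * s - 1) x * coordPow b' ϖF (4 * s) x ∂μ) := by
  rw [regInt_fundamentalShell hb hd hϖF hϖE hχ hl (by convert hs using 2; ring), localL, if_pos hη2,
    inv_inv]
  have hm : MeasurableSet (fundamentalShell F E) :=
    (isClopen_fundamentalShell (F := F) (E := E)).isOpen.measurableSet
  have e : ∫ x in fundamentalShell F E, kernelFun b d ϖF ϖE χ η s (2 * s + 1 / 2) x ∂μ =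
      ∫ x in fundamentalShell F E, multChar ϖF 1 (4 * s) (b.repr (b' 1) 1) *
        (multChar ϖE (χ ^ 2) (-2 * s - 1) x * coordPow b' ϖF (4 * s) x) ∂μ := by
    refine setIntegral_congr_fun hm fun x hx => ?_
    have hx0 : x ≠ 0 := fun h => zero_notMem_fundamentalShell (h ▸ hx)
    rw [kernelFun_slash_of_sq_eq_one hb hd hϖF hϖE hχ hη (by rw [sq]; rwa [← hη] at hη2) hx0,
      repr_one_change hb hb', multChar_mul hϖF, coordPow]
    ring
  rw [e, integral_const_mul, show -(1 / 2 : ℂ) - (2 * s + (2 * s + 1 / 2)) = -(4 * s) - 1 by ring]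
  ring

omit [MeasurableSpace E] [BorelSpace E] hb hd hϖF hϖE hχ in
lemma multChar_uniformizer_eq {K : Type*} [Field K] [ValuativeRel K] [TopologicalSpace K]
    [IsNonarchimedeanLocalField K] {ϖ : 𝒪[K]} (hϖ : Irreducible ϖ) (ξ : UnitChar K) (z : ℂ) :
    multChar ϖ ξ z (ϖ : K) = (resCard K : ℂ) ^ (-z) := by
  have := multChar_mul_multChar ϖ ξ 1 0 z (uniformizer_ne_zero hϖ)
  rwa [multChar_uniformizer hϖ, multChar_one_uniformizer hϖ, one_mul, mul_one, zero_add, eq_comm]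
    at this

omit hb hd hϖF hχ in
lemma integrableOn_multChar_shell (ω : UnitChar E) (z : ℂ) {r : ℝ} (hr : 0 < r) :
    IntegrableOn (multChar ϖE ω z) {x | absv x = r} μ := by
  refine ContinuousOn.integrableOn_compact ((isCompact_absv_le r).of_isClosed_subset
    (isClopen_absv_eq hr).isClosed fun x hx => le_of_eq hx) ?_
  intro x hx
  have hx0 : x ≠ 0 := fun h => hr.ne (by rw [← show absv x = r from hx, h, absv_zero])
  exact (continuousAt_const.congr (f := fun _ => multChar ϖE ω z x)
    ((eventually_multChar_eq hϖE ω hx0).mono fun y hy => (hy z).symm)).continuousWithinAt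

omit hb hd hϖF hχ in
-- Substitute x = ϖE u: the character contributes q_E^{-z} and the measure q_E⁻¹.
lemma setIntegral_multChar_uniformizer_shell (ω : UnitChar E) (z : ℂ) :
    ∫ x in {x | absv x = (resCard E : ℝ)⁻¹}, multChar ϖE ω z x ∂μ =
      (resCard E : ℂ) ^ (-z - 1) * ∫ x in {x | absv x = 1}, unitExt ω x ∂μ := by
  have hq : (resCard E : ℂ) ≠ 0 := by exact_mod_cast (resCard_pos_real (K := E)).ne'
  have hm : MeasurableSet {x : E | absv x = (resCard E : ℝ)⁻¹} :=
    (isClopen_absv_eq (inv_pos.2 resCard_pos_real)).isOpen.measurableSet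
  have h1 : mulAut (Units.mk0 (ϖE : E) (uniformizer_ne_zero hϖE)) ⁻¹'
      {x | absv x = (resCard E : ℝ)⁻¹} = {x | absv x = 1} := by
    ext x
    rw [Set.mem_preimage, Set.mem_ofPred_eq, Set.mem_ofPred_eq, mulAut_apply, absv_mul,
      Units.val_mk0, absv_uniformizer hϖE,
      mul_eq_left₀ (inv_ne_zero (resCard_pos_real (K := E)).ne')]
  rw [setIntegral_comp_continuousAddEquiv μ (mulAut (Units.mk0 (ϖE : E) (uniformizer_ne_zero hϖE)))
    _ hm, h1, haarChar_mulAut, Units.val_mk0, absv_uniformizer hϖE]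
  have h2 : ∫ x in {x : E | absv x = 1},
      multChar ϖE ω z (mulAut (Units.mk0 (ϖE : E) (uniformizer_ne_zero hϖE)) x) ∂μ =
      ∫ x in {x : E | absv x = 1}, (resCard E : ℂ) ^ (-z) * unitExt ω x ∂μ :=
    setIntegral_congr_fun (isClopen_absv_eq one_pos).isOpen.measurableSet fun x hx => by
      rw [mulAut_apply, multChar_mul hϖE, Units.val_mk0, multChar_uniformizer_eq hϖE,
        multChar_of_absv_one _ _ _ hx]
  rw [h2, integral_const_mul, Complex.cpow_sub _ _ hq, Complex.cpow_one]
  push_cast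
  ring

variable {l : Fˣ} {c : ℂ} (hη : resChar χ = η) (hη2 : resChar χ * η = 1)
  (hl : ∀ z r, (localL z (resChar χ * η) r)⁻¹ = c * (1 - multChar ϖF (resChar χ * η) (z + r) l))

omit hχ in
lemma differentiable_regInt_fundamentalShell : Differentiable ℂ fun s =>
    regInt b d ϖF ϖE μ χ η l c s (2 * s + 1 / 2) ((fundamentalShell F E).indicator 1) :=
  (differentiable_regInt hb hd hϖF hϖE l c (isLocallyConstant_indicator_one
    isClopen_fundamentalShell) (HasCompactSupport.intro' isCompact_fundamentalShell
      isClopen_fundamentalShell.isClosed fun x hx => Set.indicator_of_notMem hx _)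
    (Set.indicator_of_notMem zero_notMem_fundamentalShell _)).comp
    (f := fun s : ℂ => (s, 2 * s + 1 / 2)) (by fun_prop)

include hη hη2 hl

omit hη2 hl hη in
lemma resChar_sq_eq_one_apply (h : resChar (F := F) (χ ^ 2) = 1) (a : F) (ha : absv a = 1) :
    unitExt (χ ^ 2) (algebraMap F E a) = 1 := by
  rw [unitExt_algebraMap _ ha, h, unitExt_one_char ha]

/-- Analytic continuation of a formula for the value at the fundamental shell. -/
lemma regInt_fundamentalShell_eq_of_halfPlane (hb' : b' 0 = 1) {f : ℂ → ℂ}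
    (hf : Differentiable ℂ f) (h : ∀ s : ℂ, 0 < (4 * s + 1).re →
      (1 - (resCard F : ℂ) ^ (-(4 * s) - 1)) * ∫ x in fundamentalShell F E,
        multChar ϖE (χ ^ 2) (-2 * s - 1) x * coordPow b' ϖF (4 * s) x ∂μ = f s) (s : ℂ) :
    regInt b d ϖF ϖE μ χ η l c s (2 * s + 1 / 2) ((fundamentalShell F E).indicator 1) = 0 ↔
      f s = 0 := by
  -- The change of basis contributes an entire factor without zeros, so the zeros of the
  -- continuation are those of f.
  have key := eq_of_eq_on_halfPlane
    (f := fun s => regInt b d ϖF ϖE μ χ η l c s (2 * s + 1 / 2) ((fundamentalShell F E).indicator 1))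
    (g := fun s => multChar ϖF 1 (4 * s) (b.repr (b' 1) 1) * f s)
    (differentiable_regInt_fundamentalShell hb hd hϖF hϖE)
    (((differentiable_multChar ϖF 1 _).comp (f := fun s : ℂ => 4 * s) (by fun_prop)).mul hf) 0
    fun s hs => by
      have hs' : 0 < (4 * s + 1).re := by
        simp
        linarith
      rw [regInt_fundamentalShell_of_sq_eq_one hb hd hϖF hϖE hχ hη hη2 hb' hl hs', h s hs']
  rw [congrFun key s, mul_eq_zero, or_iff_right (multChar_ne_zero hϖF _ _ (repr_change_ne_zero hb hb'))]

omit hη hη2 hl hb hd hχ hϖE in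
lemma setIntegral_units_coordPow (ω : UnitChar E) (z z' : ℂ) :
    ∫ x in {x | absv x = 1}, multChar ϖE ω z x * coordPow b' ϖF z' x ∂μ =
      ∫ x in {x | absv x = 1}, unitExt ω x * coordPow b' ϖF z' x ∂μ :=
  setIntegral_congr_fun (isClopen_absv_eq one_pos).isOpen.measurableSet fun x hx => by
    rw [multChar_of_absv_one _ _ _ hx]

omit hη hη2 hl hb hd hχ in
-- The shell consists of the units and of ϖE times the units. On the second piece |x₂| = 1 in the
-- integral basis, so only the character is left to integrate.
lemma setIntegral_fundamentalShell_of_ramified (hq : resCard E = resCard F) (hb' : b' 0 = 1)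
    (hR : IsRamifiedBasis b') (ω : UnitChar E) {z z' : ℂ} (hz : 0 < (z' + 1).re) :
    ∫ x in fundamentalShell F E, multChar ϖE ω z x * coordPow b' ϖF z' x ∂μ =
      ∫ x in {x | absv x = 1}, unitExt ω x * coordPow b' ϖF z' x ∂μ +
        (resCard E : ℂ) ^ (-z - 1) * ∫ x in {x | absv x = 1}, unitExt ω x ∂μ := by
  have hE := one_lt_resCard_real (K := E)
  have hm : MeasurableSet {x : E | absv x = (resCard E : ℝ)⁻¹} :=
    (isClopen_absv_eq (inv_pos.2 resCard_pos_real)).isOpen.measurableSet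
  have hc : Set.EqOn (fun x => multChar ϖE ω z x * coordPow b' ϖF z' x) (multChar ϖE ω z)
      {x | absv x = (resCard E : ℝ)⁻¹} := fun x hx => by
    have h1 := hR.absv_repr_eq_one (x := x) (by rw [← hq]; exact hx)
    simp only
    rw [coordPow, multChar_of_absv_one _ _ _ h1, unitExt_one_char h1, mul_one]
  rw [fundamentalShell_of_ramified hq, setIntegral_union _ hm _ _, setIntegral_units_coordPow hϖF,
    setIntegral_congr_fun hm hc, setIntegral_multChar_uniformizer_shell hϖE]
  · rw [Set.disjoint_left]
    intro x hx hx'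
    rw [Set.mem_ofPred_eq] at hx hx'
    rw [hx] at hx'
    exact absurd hx'.symm (inv_lt_one_of_one_lt₀ hE).ne
  · refine ((integrableOn_unitExt_mul_coordPow b' μ ω hϖF hz).mono_set fun x hx => ?_).congr_fun
      (f := fun x => unitExt ω x * coordPow b' ϖF z' x) (fun x hx => ?_)
      (isClopen_absv_eq one_pos).isOpen.measurableSet
    · exact ((hR.isIntegralBasis hb').le_one_iff x).1 (le_of_eq hx)
    · simp only
      rw [multChar_of_absv_one _ _ _ hx]
  · exact (integrableOn_multChar_shell hϖE ω z (inv_pos.2 resCard_pos_real)).congr_fun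
      (fun x hx => (hc hx).symm) hm

end SlashConstant

/-! ### The zeros on `//` when χ|² = 1. -/

section SlashZeros

variable {F E : Type*} [Field F] [ValuativeRel F] [TopologicalSpace F]
  [IsNonarchimedeanLocalField F] [Field E] [ValuativeRel E] [TopologicalSpace E]
  [IsNonarchimedeanLocalField E] [Algebra F E] [ValuativeExtension F E]
  [MeasurableSpace E] [BorelSpace E]

variable {b : Module.Basis (Fin 2) F E} {d : F} {ϖF : 𝒪[F]} {ϖE : 𝒪[E]} {χ : UnitChar E}
  {η : UnitChar F} {μ : Measure E} [μ.IsAddHaarMeasure] {l : Fˣ} {c : ℂ}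

lemma resCard_ne_zero (K : Type*) [Field K] [ValuativeRel K] [TopologicalSpace K]
    [IsNonarchimedeanLocalField K] : (resCard K : ℂ) ≠ 0 := by
  exact_mod_cast (resCard_pos_real (K := K)).ne'

lemma differentiable_resCard_cpow (K : Type*) [Field K] [ValuativeRel K] [TopologicalSpace K]
    [IsNonarchimedeanLocalField K] {f : ℂ → ℂ} (hf : Differentiable ℂ f) :
    Differentiable ℂ fun s => (resCard K : ℂ) ^ f s :=
  hf.const_cpow (Or.inl (resCard_ne_zero K))

lemma resCard_cpow_ne_zero (K : Type*) [Field K] [ValuativeRel K] [TopologicalSpace K]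
    [IsNonarchimedeanLocalField K] (z : ℂ) : (resCard K : ℂ) ^ z ≠ 0 := by
  rw [resCard_cpow]
  exact Complex.exp_ne_zero _

variable (hb : b 0 = 1) (hd : b 1 ^ 2 = algebraMap F E d) (hϖF : Irreducible ϖF)
  (hϖE : Irreducible ϖE) (hχ : multChar ϖE χ 0 (algebraMap F E ϖF) = 1)
  (hη : resChar χ = η) (hη2 : resChar χ * η = 1)
  (hl : ∀ z r, (localL z (resChar χ * η) r)⁻¹ = c * (1 - multChar ϖF (resChar χ * η) (z + r) l))

include hb hd hϖF hϖE hχ hη hη2 hl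

/-- χ² is nontrivial but trivial on the units of F, so `exists_setIntegral_units_eq` applies with z
= 4s. In the ramified case the sphere through ϖE adds nothing, by orthogonality. -/
lemma regInt_fundamentalShell_eq_zero_iff_of_sq_ne_one (h2 : χ ^ 2 ≠ 1) (s : ℂ) :
    regInt b d ϖF ϖE μ χ η l c s (2 * s + 1 / 2) ((fundamentalShell F E).indicator 1) = 0 ↔
      (resCard F : ℂ) ^ (-(4 * s)) = 1 := by
  obtain ⟨b', hb', hB⟩ := exists_integralBasis b hϖE hϖF
  have hI : IsIntegralBasis b' := hB.elim (fun h => IsUnramifiedBasis.isIntegralBasis hb' h.2)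
    fun h => IsRamifiedBasis.isIntegralBasis hb' h.2
  have hres : resChar (F := F) (χ ^ 2) = 1 := by
    have h : resChar (F := F) (χ ^ 2) = resChar (F := F) χ ^ 2 := rfl
    rw [h, sq]
    rwa [← hη] at hη2
  have htriv := resChar_sq_eq_one_apply hb hd hϖF hϖE hχ hres
  obtain ⟨A, n, hA, hform⟩ := hI.exists_setIntegral_units_eq μ hϖF htriv h2
  have hf : Differentiable ℂ fun s : ℂ => A * ((resCard F : ℂ) ^ (-(4 * s))) ^ n *
      ((resCard F : ℂ) ^ (-(4 * s)) - 1) := by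
    have := differentiable_resCard_cpow F (f := fun s : ℂ => -(4 * s)) (by fun_prop)
    exact ((this.pow n).const_mul A).mul (this.sub_const 1)
  rw [regInt_fundamentalShell_eq_of_halfPlane hb hd hϖF hϖE hχ hη hη2 hl hb' hf ?_ s]
  · rw [mul_eq_zero, or_iff_right (mul_ne_zero hA (pow_ne_zero _ (resCard_cpow_ne_zero F _))),
      sub_eq_zero]
  · intro s hs
    rw [← hform _ hs]
    congr 1
    rcases hB with ⟨hq, hB⟩ | ⟨hq, hB⟩
    · rw [fundamentalShell_of_unramified hq, setIntegral_units_coordPow hϖF]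
    · rw [setIntegral_fundamentalShell_of_ramified hϖF hϖE hq hb' hB _ hs, ← hI.levelUnits_zero]
      obtain ⟨u, hu⟩ : ∃ u : 𝒪[E]ˣ, unitExt (χ ^ 2) ((u : 𝒪[E]) : E) ≠ 1 := by
        by_contra! h
        refine h2 ?_
        ext u
        rw [← unitExt_unit, h u]
        rfl
      rw [hI.setIntegral_levelUnits_unitExt_eq_zero μ (χ ^ 2) (j := 0) (u := u) (by
        rw [hI.levelUnits_zero]; exact absv_unit u) hu, mul_zero, add_zero]

/-- The shell is the group of units, and up to a nowhere vanishing factor the value is 1 -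
q^{-4s-2}. -/
lemma regInt_fundamentalShell_eq_zero_iff_of_unramified (h2 : χ ^ 2 = 1)
    (hq : resCard E = resCard F ^ 2) (s : ℂ) :
    regInt b d ϖF ϖE μ χ η l c s (2 * s + 1 / 2) ((fundamentalShell F E).indicator 1) = 0 ↔
      (resCard F : ℂ) ^ (-(4 * s)) = (resCard F : ℂ) ^ 2 := by
  obtain ⟨b', hb', hB⟩ := exists_integralBasis b hϖE hϖF
  replace hB : IsUnramifiedBasis b' := by
    rcases hB with h | h
    · exact h.2
    · have := one_lt_resCard (K := F)
      have := h.1.symm.trans hq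
      nlinarith
  have hI : IsIntegralBasis b' := hB.isIntegralBasis hb'
  obtain ⟨A, hA, hform⟩ := exists_setIntegral_units_coordPow_of_unramified μ hϖF hI hB
  have hf : Differentiable ℂ fun s : ℂ =>
      A * (1 - (resCard F : ℂ) ^ (-(4 * s)) / (resCard F : ℂ) ^ 2) := by
    have := differentiable_resCard_cpow F (f := fun s : ℂ => -(4 * s)) (by fun_prop)
    exact ((differentiable_const _).sub (this.div_const _)).const_mul A
  rw [regInt_fundamentalShell_eq_of_halfPlane hb hd hϖF hϖE hχ hη hη2 hl hb' hf ?_ s]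
  · rw [mul_eq_zero, or_iff_right hA, sub_eq_zero, eq_comm,
      div_eq_one_iff_eq (pow_ne_zero _ (resCard_ne_zero F))]
  · intro s hs
    rw [← hform _ hs, fundamentalShell_of_unramified hq, setIntegral_units_coordPow hϖF, h2]
    congr 1
    exact setIntegral_congr_fun (isClopen_absv_eq one_pos).isOpen.measurableSet fun x hx => by
      rw [unitExt_one_char hx, one_mul]

/-- The units contribute (1 - q⁻¹)V and the sphere through ϖE contributes q^{2s}(1 - q^{-4s-1})V;
the sum factors as V(1 + q^{2s})(1 - q^{-2s-1}). -/
lemma regInt_fundamentalShell_eq_zero_iff_of_ramified (h2 : χ ^ 2 = 1)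
    (hq : resCard E ≠ resCard F ^ 2) (s : ℂ) :
    regInt b d ϖF ϖE μ χ η l c s (2 * s + 1 / 2) ((fundamentalShell F E).indicator 1) = 0 ↔
      (resCard F : ℂ) ^ (2 * s) = -1 ∨ (resCard F : ℂ) ^ (-2 * s - 1) = 1 := by
  obtain ⟨b', hb', hB⟩ := exists_integralBasis b hϖE hϖF
  replace hB : resCard E = resCard F ∧ IsRamifiedBasis b' := by
    rcases hB with h | h
    · exact absurd h.1 hq
    · exact h
  obtain ⟨hqe, hB⟩ := hB
  have hI : IsIntegralBasis b' := hB.isIntegralBasis hb'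
  set V : ℂ := ((μ.real {x : E | absv x = 1} : ℝ) : ℂ) with hV
  have hV0 : V ≠ 0 := by
    have := measureReal_levelUnits_pos μ hI 0
    rw [hI.levelUnits_zero] at this
    rw [hV]; exact_mod_cast this.ne'
  have hf : Differentiable ℂ fun s : ℂ =>
      V * ((1 + (resCard F : ℂ) ^ (2 * s)) * (1 - (resCard F : ℂ) ^ (-2 * s - 1))) := by
    have h3 := differentiable_resCard_cpow F (f := fun s : ℂ => 2 * s) (by fun_prop)
    have h4 := differentiable_resCard_cpow F (f := fun s : ℂ => -2 * s - 1) (by fun_prop)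
    exact ((h3.const_add 1).mul ((differentiable_const _).sub h4)).const_mul V
  rw [regInt_fundamentalShell_eq_of_halfPlane hb hd hϖF hϖE hχ hη hη2 hl hb' hf ?_ s]
  · rw [mul_eq_zero, or_iff_right hV0, mul_eq_zero, sub_eq_zero, add_comm, add_eq_zero_iff_eq_neg,
      eq_comm (a := (1 : ℂ))]
  · intro s hs
    have hm := (isClopen_absv_eq (K := E) one_pos).isOpen.measurableSet
    have e1 : ∫ x in {x : E | absv x = 1}, unitExt 1 x ∂μ = V := by
      rw [setIntegral_congr_fun (g := fun _ => (1 : ℂ)) hm fun x hx => unitExt_one_char hx,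
        setIntegral_const, Complex.real_smul, mul_one]
    have e2 : ∫ x in {x : E | absv x = 1}, unitExt 1 x * coordPow b' ϖF (4 * s) x ∂μ =
        ∫ x in {x : E | absv x = 1}, coordPow b' ϖF (4 * s) x ∂μ :=
      setIntegral_congr_fun hm fun x hx => by
        rw [unitExt_one_char hx, one_mul]
    rw [setIntegral_fundamentalShell_of_ramified hϖF hϖE hqe hb' hB _ hs, h2, e1, e2, mul_add,
      one_sub_mul_setIntegral_units_coordPow_of_ramified μ hϖF hI hB hs, ← hV, hqe,
      show -(-2 * s - 1) - 1 = 2 * s by ring]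
    have h0 := resCard_cpow_ne_zero F s
    have hq0 := resCard_ne_zero F
    have e3 : (resCard F : ℂ) ^ (-(4 * s) - 1) * (resCard F : ℂ) ^ (2 * s) =
        (resCard F : ℂ) ^ (-2 * s - 1) := by
      rw [← Complex.cpow_add _ _ hq0]
      ring_nf
    have e4 : (resCard F : ℂ) ^ (2 * s) * (resCard F : ℂ) ^ (-2 * s - 1) = (resCard F : ℂ)⁻¹ := by
      rw [← Complex.cpow_add _ _ hq0, ← Complex.cpow_neg_one]
      ring_nf
    linear_combination V * e4 - V * e3

end SlashZeros

/-! ### A nontrivial additive character. -/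

section AdditiveCharacter

variable (K : Type*) [Field K] [ValuativeRel K] [TopologicalSpace K]
  [IsNonarchimedeanLocalField K]

/-- There is a nontrivial additive character which is trivial on the integers. -/
lemma exists_addChar : ∃ Ψ : AddChar K ℂ, (∀ x, absv x ≤ 1 → Ψ x = 1) ∧ ∃ v, Ψ v ≠ 1 := by
  obtain ⟨ϖ, hϖ⟩ := IsDiscreteValuationRing.exists_irreducible 𝒪[K]
  set A : AddSubgroup K := (𝒪[K]).toAddSubgroup with hA
  have hmem : ∀ x, x ∈ A ↔ absv x ≤ 1 := fun x => mem_integer_iff_absv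
  have hne : (QuotientAddGroup.mk ((ϖ : K)⁻¹) : K ⧸ A) ≠ 0 := by
    rw [Ne, QuotientAddGroup.eq_zero_iff, hmem, absv_inv, absv_uniformizer hϖ, inv_inv, not_le]
    exact one_lt_resCard_real
  -- Divisibility of ℚ/ℤ yields a character of K/𝒪 that is nonzero at the class of ϖ⁻¹; it is then
  -- moved to the circle through ℚ/ℤ → ℝ/ℤ. Continuity is automatic, the integers being open.
  obtain ⟨c, hc⟩ := CharacterModule.exists_character_apply_ne_zero_of_ne_zero hne
  have hle : AddSubgroup.zmultiples (1 : ℚ) ≤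
      (AddSubgroup.zmultiples (1 : ℝ)).comap ((Rat.castHom ℝ).toAddMonoidHom) := by
    rw [AddSubgroup.zmultiples_le]
    exact AddSubgroup.mem_comap.2 (by simp)
  set g : AddCircle (1 : ℚ) →+ AddCircle (1 : ℝ) :=
    QuotientAddGroup.map _ _ ((Rat.castHom ℝ).toAddMonoidHom) hle with hg
  have hginj : ∀ y, g y = 0 → y = 0 := by
    intro y hy
    obtain ⟨x, rfl⟩ := QuotientAddGroup.mk_surjective y
    rw [hg, QuotientAddGroup.map_mk, QuotientAddGroup.eq_zero_iff] at hy
    rw [QuotientAddGroup.eq_zero_iff]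
    obtain ⟨n, hn⟩ := AddSubgroup.mem_zmultiples_iff.1 hy
    refine AddSubgroup.mem_zmultiples_iff.2 ⟨n, ?_⟩
    simp only [zsmul_eq_mul, mul_one] at hn ⊢
    have hn' : ((n : ℚ) : ℝ) = (x : ℝ) := by
      push_cast
      exact hn
    exact_mod_cast hn'
  refine ⟨{ toFun := fun x => (AddCircle.toCircle (g (c (QuotientAddGroup.mk x : K ⧸ A))) : ℂ)
            map_zero_eq_one' := ?_
            map_add_eq_mul' := fun x y => ?_ }, fun x hx => ?_, (ϖ : K)⁻¹, fun h => hc ?_⟩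
  · rw [QuotientAddGroup.mk_zero, map_zero, map_zero, AddCircle.toCircle_zero, Circle.coe_one]
  · rw [QuotientAddGroup.mk_add, map_add, map_add, AddCircle.toCircle_add, Circle.coe_mul]
  · change (AddCircle.toCircle (g (c (QuotientAddGroup.mk x : K ⧸ A))) : ℂ) = 1
    rw [(QuotientAddGroup.eq_zero_iff x).2 ((hmem x).2 hx), map_zero, map_zero,
      AddCircle.toCircle_zero, Circle.coe_one]
  · change (AddCircle.toCircle (g (c (QuotientAddGroup.mk (ϖ : K)⁻¹ : K ⧸ A))) : ℂ) = 1 at h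
    rw [Circle.coe_eq_one, ← AddCircle.toCircle_zero] at h
    exact hginj _ (AddCircle.injective_toCircle one_ne_zero h)

end AdditiveCharacter

/-! ### Conductors, and integrals that vanish by oscillation. -/

section GaussSum

variable {K : Type*} [Field K] [ValuativeRel K] [TopologicalSpace K]
  [IsNonarchimedeanLocalField K]

/-- A multiplicative function which is locally constant away from the origin, uniformly with
respect to dilations, and nontrivial on the units. -/
structure IsRamifiedChar (P : K →*₀ ℂ) : Prop where
  exists_add_eq : ∃ r : ℝ, 0 < r ∧ r < 1 ∧ ∀ x v, absv v ≤ r * absv x → P (x + v) = P x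
  exists_ne_one : ∃ u, absv u = 1 ∧ P u ≠ 1

variable {P : K →*₀ ℂ} {Ψ : AddChar K ℂ}

/-- f is one less than the conductor exponent. For f = 0 the bound on u - 1 is no condition on the
unit u. -/
lemma IsRamifiedChar.exists_conductor (hP : IsRamifiedChar P) : ∃ f : ℕ,
    (∀ v, absv v ≤ (resCard K : ℝ) ^ (-((f + 1 : ℕ) : ℤ)) → P (1 + v) = 1) ∧
    ∃ u, absv u = 1 ∧ absv (u - 1) ≤ (resCard K : ℝ) ^ (-(f : ℤ)) ∧ P u ≠ 1 := by
  classical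
  have hq := one_lt_resCard_real (K := K)
  obtain ⟨r, hr0, hr1, hr⟩ := hP.exists_add_eq
  obtain ⟨u, hu, hPu⟩ := hP.exists_ne_one
  have hex : ∃ f : ℕ, ∀ u, absv u = 1 → absv (u - 1) ≤ (resCard K : ℝ) ^ (-(f : ℤ)) → P u = 1 := by
    obtain ⟨n, hn⟩ := exists_pow_lt_of_lt_one hr0 (inv_lt_one_of_one_lt₀ hq)
    refine ⟨n, fun w hw hw1 => ?_⟩
    have := hr 1 (w - 1) (by
      rw [absv_one, mul_one]
      refine hw1.trans ?_
      rw [zpow_neg, zpow_natCast, ← inv_pow]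
      exact hn.le)
    rwa [add_sub_cancel, map_one] at this
  have h0 : Nat.find hex ≠ 0 := fun h => hPu (by
    have := Nat.find_spec hex
    rw [h] at this
    refine this u hu ?_
    have := absv_sub_le u 1
    rw [hu, absv_one, max_self] at this
    simpa using this)
  obtain ⟨f, hf⟩ := Nat.exists_eq_succ_of_ne_zero h0
  refine ⟨f, fun v hv => ?_, ?_⟩
  · have hspec := Nat.find_spec hex
    rw [hf] at hspec
    have hv1 : absv v < 1 := hv.trans_lt (zpow_lt_one_of_neg₀ hq (by push_cast; omega))
    refine hspec _ ?_ (by rwa [add_sub_cancel_left])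
    rw [← absv_one (K := K)]
    exact absv_eq_of_sub_lt (by rwa [add_sub_cancel_left, absv_one])
  · have := Nat.find_min hex (m := f) (by omega)
    push Not at this
    exact this

/-- m is the least exponent whose ball lies in the kernel of Ψ; a nontrivial value of Ψ bounds such
exponents from below. -/
lemma exists_level (h1 : ∃ n : ℤ, ∀ x, absv x ≤ (resCard K : ℝ) ^ (-n) → Ψ x = 1)
    (h2 : ∃ v, Ψ v ≠ 1) : ∃ m : ℤ, (∀ x, absv x ≤ (resCard K : ℝ) ^ (-m) → Ψ x = 1) ∧
      ∃ v, absv v = (resCard K : ℝ) ^ (-(m - 1)) ∧ Ψ v ≠ 1 := by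
  have hq := one_lt_resCard_real (K := K)
  obtain ⟨v, hv⟩ := h2
  have hv0 : v ≠ 0 := fun h => hv (by rw [h, AddChar.map_zero_eq_one])
  obtain ⟨m, hm, hmin⟩ := Int.exists_least_of_bdd
    (P := fun n : ℤ => ∀ x, absv x ≤ (resCard K : ℝ) ^ (-n) → Ψ x = 1)
    ⟨ord v, fun n hn => by
      by_contra! h
      refine hv (hn v ?_)
      rw [absv_of_ne_zero hv0]
      exact zpow_le_zpow_right₀ hq.le (by omega)⟩ h1
  refine ⟨m, hm, ?_⟩
  have h3 := mt (hmin (m - 1)) (by omega)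
  push Not at h3
  obtain ⟨w, hw, hw1⟩ := h3
  refine ⟨w, le_antisymm hw ?_, hw1⟩
  by_contra! h4
  refine hw1 (hm w ?_)
  by_contra! h5
  have := absv_le_zpow_or h5
  rw [show -m + 1 = -(m - 1) by ring] at this
  linarith

variable [MeasurableSpace K] [BorelSpace K] {μ : Measure K} [μ.IsAddHaarMeasure]

/-- Invariance of a region under a translation by which the integrand is multiplied. -/
lemma setIntegral_eq_zero_of_translation {f : K → ℂ} {S : Set K} {v : K} {a : ℂ}
    (hm : MeasurableSet S) (hS : ∀ x, x + v ∈ S ↔ x ∈ S) (hf : ∀ x ∈ S, f (x + v) = a * f x)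
    (ha : a ≠ 1) : ∫ x in S, f x ∂μ = 0 := by
  have h1 : ∫ x in S, f x ∂μ = a * ∫ x in S, f x ∂μ := by
    conv_lhs => rw [← integral_indicator hm, ← integral_add_right_eq_self _ v]
    rw [← integral_const_mul, ← integral_indicator hm]
    refine integral_congr_ae (Filter.Eventually.of_forall fun x => ?_)
    by_cases hx : x ∈ S
    · simp only
      rw [Set.indicator_of_mem hx, Set.indicator_of_mem ((hS x).2 hx), hf x hx]
    · simp only
      rw [Set.indicator_of_notMem hx, Set.indicator_of_notMem (mt (hS x).1 hx)]
  have h2 : (1 - a) * ∫ x in S, f x ∂μ = 0 := by linear_combination h1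
  exact (mul_eq_zero.1 h2).resolve_left (sub_ne_zero.2 (Ne.symm ha))

/-- Invariance of a region under a dilation by which the integrand is multiplied. -/
lemma setIntegral_eq_zero_of_dilation {f : K → ℂ} {S : Set K} {u : K} {a : ℂ}
    (hm : MeasurableSet S) (hu : absv u = 1) (hS : ∀ x, u * x ∈ S ↔ x ∈ S)
    (hf : ∀ x ∈ S, f (u * x) = a * f x) (ha : a ≠ 1) : ∫ x in S, f x ∂μ = 0 := by
  have hu0 : u ≠ 0 := fun h => by simp [h, absv_zero] at hu
  have h1 := setIntegral_comp_continuousAddEquiv μ (mulAut (Units.mk0 u hu0)) f hm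
  have h3 : mulAut (Units.mk0 u hu0) ⁻¹' S = S := by
    ext x
    exact hS x
  have h4 : ∫ x in S, f (mulAut (Units.mk0 u hu0) x) ∂μ = ∫ x in S, a * f x ∂μ :=
    setIntegral_congr_fun hm fun x hx => hf x hx
  rw [h3, h4, haarChar_mulAut, Units.val_mk0, hu, integral_const_mul, Complex.ofReal_one,
    one_mul] at h1
  have h2 : (1 - a) * ∫ x in S, f x ∂μ = 0 := by linear_combination h1
  exact (mul_eq_zero.1 h2).resolve_left (sub_ne_zero.2 (Ne.symm ha))

/-- The integral of an additive character over a ball. -/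
lemma setIntegral_addChar_ball {m : ℤ} (hm : ∀ x, absv x ≤ (resCard K : ℝ) ^ (-m) → Ψ x = 1)
    {v : K} (hv : absv v = (resCard K : ℝ) ^ (-(m - 1))) (hv1 : Ψ v ≠ 1) (n : ℤ) (y : K) :
    ∫ z in {z | absv z ≤ (resCard K : ℝ) ^ (-n)}, Ψ (y * z) ∂μ =
      {y | absv y ≤ (resCard K : ℝ) ^ (n - m)}.indicator
        (fun _ => (μ.real {z : K | absv z ≤ (resCard K : ℝ) ^ (-n)} : ℂ)) y := by
  have hq := one_lt_resCard_real (K := K)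
  have hms : MeasurableSet {z : K | absv z ≤ (resCard K : ℝ) ^ (-n)} :=
    (isClopen_absv_le (zpow_pos resCard_pos_real _)).isOpen.measurableSet
  by_cases hy : absv y ≤ (resCard K : ℝ) ^ (n - m)
  · rw [Set.indicator_of_mem (show y ∈ {y : K | absv y ≤ (resCard K : ℝ) ^ (n - m)} from hy),
      setIntegral_congr_fun (g := fun _ => (1 : ℂ)) hms fun z hz => hm _ ?_, setIntegral_const,
      Complex.real_smul, mul_one]
    rw [absv_mul]
    refine (mul_le_mul hy hz (absv_nonneg _) (zpow_nonneg resCard_pos_real.le _)).trans_eq ?_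
    rw [← zpow_add₀ resCard_pos_real.ne']
    congr 1
    ring
  · rw [Set.indicator_of_notMem (show y ∉ {y : K | absv y ≤ (resCard K : ℝ) ^ (n - m)} from hy)]
    have hy0 : y ≠ 0 := fun h => hy (by
      rw [h, absv_zero]; exact zpow_nonneg resCard_pos_real.le _)
    have hyn := absv_le_zpow_or (not_le.1 hy)
    -- Translation by v/y preserves the ball and multiplies the integrand by Ψ(v) ≠ 1.
    have hvy : absv (v / y) ≤ (resCard K : ℝ) ^ (-n) := by
      rw [absv_div, hv, div_le_iff₀ (absv_pos hy0)]
      calc (resCard K : ℝ) ^ (-(m - 1)) =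
          (resCard K : ℝ) ^ (-n) * (resCard K : ℝ) ^ (n - m + 1) := by
            rw [← zpow_add₀ resCard_pos_real.ne']
            congr 1
            ring
        _ ≤ _ := mul_le_mul_of_nonneg_left hyn (zpow_nonneg resCard_pos_real.le _)
    refine setIntegral_eq_zero_of_translation (v := v / y) (a := Ψ v) hms (fun z => ?_)
      (fun z _ => ?_) hv1
    · constructor
      · intro h
        have := (absv_sub_le (z + v / y) (v / y)).trans (max_le h hvy)
        rwa [add_sub_cancel_right] at this
      · exact fun h => (absv_add_le _ _).trans (max_le h hvy)
    · rw [mul_add, mul_div_cancel₀ _ hy0, AddChar.map_add_eq_mul, mul_comm]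

end GaussSum

/-! ### Nonvanishing of Gauss sums. -/

section GaussSum

variable {K : Type*} [Field K] [ValuativeRel K] [TopologicalSpace K]
  [IsNonarchimedeanLocalField K] {P : K →*₀ ℂ} {Ψ : AddChar K ℂ}

lemma isLocallyConstant_addChar
    (h : ∃ n : ℤ, ∀ x : K, absv x ≤ (resCard K : ℝ) ^ (-n) → Ψ x = 1) : IsLocallyConstant Ψ := by
  obtain ⟨n, hn⟩ := h
  refine isLocallyConstant_of_absv fun x => ⟨_, zpow_pos (resCard_pos_real (K := K)) (-n),
    fun y hy => ?_⟩
  rw [← add_sub_cancel x y, AddChar.map_add_eq_mul, hn _ hy.le, mul_one]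

lemma IsRamifiedChar.eventually_eq (hP : IsRamifiedChar P) {x : K} (hx : x ≠ 0) :
    ∀ᶠ y in 𝓝 x, P y = P x := by
  obtain ⟨r, hr0, -, hr⟩ := hP.exists_add_eq
  filter_upwards [eventually_absv_sub_lt x (mul_pos hr0 (absv_pos hx))] with y hy
  rw [← hr x (y - x) hy.le, add_sub_cancel]

lemma isLocallyConstant_indicator {f : K → ℂ} {S : Set K} (hS : IsClopen S)
    (hf : ∀ x ∈ S, ∀ᶠ y in 𝓝 x, f y = f x) : IsLocallyConstant (S.indicator f) := by
  rw [IsLocallyConstant.iff_eventually_eq]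
  intro x
  by_cases hx : x ∈ S
  · filter_upwards [hS.isOpen.mem_nhds hx, hf x hx] with y hy h1
    rw [Set.indicator_of_mem hy, Set.indicator_of_mem hx, h1]
  · filter_upwards [hS.compl.isOpen.mem_nhds hx] with y hy
    rw [Set.indicator_of_notMem hy, Set.indicator_of_notMem hx]

variable [MeasurableSpace K] [BorelSpace K] {μ : Measure K} [μ.IsAddHaarMeasure]

lemma IsRamifiedChar.integrableOn (hP : IsRamifiedChar P)
    (hΨ : ∃ n : ℤ, ∀ x : K, absv x ≤ (resCard K : ℝ) ^ (-n) → Ψ x = 1) {S : Set K} (hS : IsCompact S)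
    (h0 : (0 : K) ∉ S) : IntegrableOn (fun x => P x * Ψ x) S μ := by
  refine ContinuousOn.integrableOn_compact hS fun x hx => ?_
  have hx0 : x ≠ 0 := fun h => h0 (h ▸ hx)
  refine (continuousAt_const.congr (f := fun _ => P x * Ψ x) ?_).continuousWithinAt
  filter_upwards [hP.eventually_eq hx0, (isLocallyConstant_addChar hΨ).eventually_eq x]
    with y h1 h2
  rw [h1, h2]

/-- The Gauss sum over the critical shell does not vanish, nor does the integral over any region
which agrees with a large shell up to parts over which the integrand oscillates. -/
theorem IsRamifiedChar.exists_setIntegral_ne_zero (hP : IsRamifiedChar P)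
    (h1 : ∃ n : ℤ, ∀ x : K, absv x ≤ (resCard K : ℝ) ^ (-n) → Ψ x = 1) (h2 : ∃ v, Ψ v ≠ 1) :
    ∃ (ρ : ℝ) (v : K), 0 < ρ ∧ ∀ (B S : Set K) (ρ' : ℝ), IsClopen B → IsCompact B → IsClopen S →
      0 < ρ' → ρ' < ρ → {x | absv x ≤ ρ} ⊆ B → (∀ x, x + v ∈ B ↔ x ∈ B) → 0 ∈ S →
      S ⊆ {x | absv x ≤ ρ'} → (∀ x, absv x ≤ ρ' → Ψ x = 1) →
      (∃ u, absv u = 1 ∧ P u ≠ 1 ∧ ∀ x, u * x ∈ S ↔ x ∈ S) →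
      ∫ x in B \ S, P x * Ψ x ∂μ ≠ 0 := by
  have hq := one_lt_resCard_real (K := K)
  have hqpos := resCard_pos_real (K := K)
  obtain ⟨f, hf, u₀, hu₀, hu₀1, hPu₀⟩ := hP.exists_conductor
  obtain ⟨m, hm, v, hv, hΨv⟩ := exists_level h1 h2
  have hΨc := isLocallyConstant_addChar h1
  -- At the radius ρ the conductor of P and the level of Ψ balance. Beyond it P is invariant under
  -- translation by v, while Ψ is not; below it Ψ is invariant under multiplication by u₀, while P
  -- is not.
  set ρ : ℝ := (resCard K : ℝ) ^ (-(m - f - 1)) with hρ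
  have hρ0 : 0 < ρ := zpow_pos hqpos _
  have hf1 : (resCard K : ℝ) ^ (-((f + 1 : ℕ) : ℤ)) < 1 :=
    zpow_lt_one_of_neg₀ hq (by push_cast; omega)
  have hvρ : absv v ≤ ρ := by
    rw [hv]; exact zpow_le_zpow_right₀ hq.le (by omega)
  -- large arguments
  have hlarge : ∀ z y : K, ρ < absv (z * y) → absv (v / (z * y)) ≤
      (resCard K : ℝ) ^ (-((f + 1 : ℕ) : ℤ)) := by
    intro z y h
    have h3 := absv_le_zpow_or h
    rw [absv_div, hv, div_le_iff₀ (hρ0.trans h)]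
    refine le_trans (le_of_eq ?_) (mul_le_mul_of_nonneg_left h3 (zpow_nonneg hqpos.le _))
    rw [← zpow_add₀ hqpos.ne']
    congr 1
    push_cast
    ring
  -- small arguments
  have hsmall : ∀ x : K, absv x < ρ → Ψ (u₀ * x) = Ψ x := by
    intro x hx
    have hx1 : absv x ≤ (resCard K : ℝ) ^ (-(m - f)) := by
      by_contra! h
      have := absv_le_zpow_or h
      rw [show -(m - (f : ℤ)) + 1 = -(m - f - 1) by ring] at this
      linarith
    rw [show u₀ * x = x + (u₀ - 1) * x by ring, AddChar.map_add_eq_mul, hm ((u₀ - 1) * x), mul_one]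
    rw [absv_mul]
    refine (mul_le_mul hu₀1 hx1 (absv_nonneg _) (zpow_nonneg hqpos.le _)).trans_eq ?_
    rw [← zpow_add₀ hqpos.ne']
    congr 1
    ring
  set U : Set K := {y | absv y = 1} with hU
  have hUcl : IsClopen U := isClopen_absv_eq one_pos
  have hUco : IsCompact U := (isCompact_absv_le 1).of_isClosed_subset hUcl.isClosed
    fun x hx => le_of_eq hx
  have hUm := hUcl.isOpen.measurableSet
  -- Otherwise the Fourier transform of P restricted to the units vanishes identically, against
  -- Fourier inversion at 1.
  have hcrit : ∫ x in {x | absv x = ρ}, P x * Ψ x ∂μ ≠ 0 := by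
    intro h0
    have hhat : ∀ z, ∫ y in U, P y * Ψ (z * y) ∂μ = 0 := by
      intro z
      rcases lt_trichotomy (absv z) ρ with hz | hz | hz
      · refine setIntegral_eq_zero_of_dilation (u := u₀) (a := P u₀) hUm hu₀ (fun y => ?_)
          (fun y hy => ?_) hPu₀
        · rw [hU, Set.mem_ofPred_eq, Set.mem_ofPred_eq, absv_mul, hu₀, one_mul]
        · rw [map_mul, mul_left_comm z, hsmall _ (by rwa [absv_mul, show absv y = 1 from hy,
            mul_one]), mul_assoc]
      · have hz0 : z ≠ 0 := fun h => by
          rw [h, absv_zero] at hz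
          exact hρ0.ne hz
        have h3 := setIntegral_comp_continuousAddEquiv μ (mulAut (Units.mk0 z hz0))
          (fun x => P x * Ψ x) (isClopen_absv_eq (K := K) hρ0).isOpen.measurableSet
        have h4 : mulAut (Units.mk0 z hz0) ⁻¹' {x | absv x = ρ} = U := by
          ext y
          rw [Set.mem_preimage, Set.mem_ofPred_eq, mulAut_apply, absv_mul, Units.val_mk0, hz,
            mul_eq_left₀ hρ0.ne']
          rfl
        have h5 : ∀ y, P (mulAut (Units.mk0 z hz0) y) * Ψ (mulAut (Units.mk0 z hz0) y) =
            P z * (P y * Ψ (z * y)) := fun y => by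
          rw [mulAut_apply, Units.val_mk0, map_mul, mul_assoc]
        simp_rw [h5] at h3
        rw [h0, h4, haarChar_mulAut, Units.val_mk0, hz, integral_const_mul, eq_comm, mul_eq_zero,
          mul_eq_zero] at h3
        rcases h3 with h3 | h3 | h3
        · exact absurd h3 (by exact_mod_cast hρ0.ne')
        · exact absurd h3 ((map_ne_zero P).2 hz0)
        · exact h3
      · have hz0 : z ≠ 0 := fun h => by
          rw [h, absv_zero] at hz
          linarith
        have h3 : absv (v / z) < 1 := by
          have := hlarge z 1 (by rwa [mul_one])
          rw [mul_one] at this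
          linarith
        have hadd : ∀ y, absv y = 1 → absv (y + v / z) = 1 := fun y hy => by
          rw [← hy]
          exact absv_eq_of_sub_lt (by rwa [add_sub_cancel_left, hy])
        refine setIntegral_eq_zero_of_translation (v := v / z) (a := Ψ v) hUm (fun y => ?_)
          (fun y hy => ?_) hΨv
        · refine ⟨fun h => ?_, hadd y⟩
          have h4 : absv y = absv (y + v / z) := absv_eq_of_sub_lt (by
            rwa [sub_add_cancel_left, absv_neg, show absv (y + v / z) = 1 from h])
          exact h4.trans h
        · have hy0 : y ≠ 0 := fun h => by simp [hU, h, absv_zero] at hy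
          rw [show y + v / z = y * (1 + v / (z * y)) by field_simp, map_mul,
            hf _ (hlarge z y (by rwa [absv_mul, show absv y = 1 from hy, mul_one])), mul_one,
            show z * (y * (1 + v / (z * y))) = v + z * y by field_simp; ring,
            AddChar.map_add_eq_mul]
          ring
    -- With this radius the integral of Ψ(z(y - 1)) over z ∈ B is supported on |y - 1| ≤ q^{-(f+1)},
    -- where P = 1. The two orders of integration give 0 and vol(B)·vol(C).
    set B : Set K := {z | absv z ≤ (resCard K : ℝ) ^ (-(m - f - 1))} with hB
    have hBcl : IsClopen B := isClopen_absv_le (zpow_pos hqpos _)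
    have hBco : IsCompact B := isCompact_absv_le _
    have hBm := hBcl.isOpen.measurableSet
    set h : K → K → ℂ := fun z y =>
      B.indicator 1 z * (U.indicator P y * Ψ (z * (y - 1))) with hh
    have hcont : Continuous h.uncurry := by
      have c1 := (isLocallyConstant_indicator_one hBcl).continuous
      have c2 : Continuous (U.indicator P) := (isLocallyConstant_indicator hUcl fun x hx =>
        hP.eventually_eq fun h => by simp [hU, h, absv_zero] at hx).continuous
      have c3 := hΨc.continuous
      exact (c1.comp continuous_fst).mul ((c2.comp continuous_snd).mul (c3.comp
        (continuous_fst.mul (continuous_snd.sub continuous_const))))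
    have hsupp : HasCompactSupport h.uncurry :=
      HasCompactSupport.intro' (hBco.prod hUco) (hBcl.isClosed.prod hUcl.isClosed) fun x hx => by
        rw [Set.mem_prod, not_and_or] at hx
        rw [Function.uncurry, hh]
        rcases hx with hx | hx <;> simp [hx]
    have hswap := integral_integral_swap_of_hasCompactSupport hcont hsupp (μ := μ) (ν := μ)
    have e1 : ∀ z, ∫ y, h z y ∂μ = 0 := fun z => by
      have : ∀ y, h z y = B.indicator 1 z * Ψ (-z) *
          U.indicator (fun y => P y * Ψ (z * y)) y := fun y => by
        rw [hh]
        by_cases hy : y ∈ U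
        · simp only [Set.indicator_of_mem hy]
          rw [show z * (y - 1) = -z + z * y by ring, AddChar.map_add_eq_mul]
          ring
        · simp only [Set.indicator_of_notMem hy]
          ring
      rw [integral_congr_ae (Filter.Eventually.of_forall this), integral_const_mul,
        integral_indicator hUm, hhat, mul_zero]
    set C : Set K := {y | absv (y - 1) ≤ (resCard K : ℝ) ^ (-((f + 1 : ℕ) : ℤ))} with hC
    have hCcl : IsClopen C := isClopen_absv_sub_le 1 (zpow_pos hqpos _)
    have hCU : C ⊆ U := fun y hy => by
      have : absv (y - 1) < absv (1 : K) := by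
        rw [absv_one]
        exact lt_of_le_of_lt hy hf1
      rw [hU, Set.mem_ofPred_eq, absv_eq_of_sub_lt this, absv_one]
    have e2 : ∀ y, ∫ z, h z y ∂μ = C.indicator (fun _ => (μ.real B : ℂ)) y := fun y => by
      have : ∀ z, h z y = U.indicator P y * B.indicator (fun z => Ψ ((y - 1) * z)) z := fun z => by
        rw [hh]
        by_cases hz : z ∈ B
        · simp only [Set.indicator_of_mem hz, mul_comm z, Pi.one_apply]
          ring
        · simp only [Set.indicator_of_notMem hz]
          ring
      rw [integral_congr_ae (Filter.Eventually.of_forall this), integral_const_mul,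
        integral_indicator hBm, setIntegral_addChar_ball hm hv hΨv]
      have e3 : m - f - 1 - m = -((f + 1 : ℕ) : ℤ) := by push_cast; ring
      rw [e3]
      by_cases hy : y ∈ C
      · rw [Set.indicator_of_mem (show y - 1 ∈ {y : K | absv y ≤ _} from hy),
          Set.indicator_of_mem hy, Set.indicator_of_mem (hCU hy)]
        have := hf (y - 1) hy
        rw [add_sub_cancel] at this
        rw [this, one_mul]
      · rw [Set.indicator_of_notMem (show y - 1 ∉ {y : K | absv y ≤ _} from hy),
          Set.indicator_of_notMem hy, mul_zero]
    rw [integral_congr_ae (Filter.Eventually.of_forall e1), integral_zero,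
      integral_congr_ae (Filter.Eventually.of_forall e2),
      integral_indicator hCcl.isOpen.measurableSet, setIntegral_const, Complex.real_smul, eq_comm,
      mul_eq_zero] at hswap
    have p1 : 0 < μ.real C := measureReal_pos_of_isOpen_of_isCompact hCcl.isOpen
      (isCompact_absv_sub_le 1 _) ⟨1, by
        rw [hC, Set.mem_ofPred_eq, sub_self, absv_zero]; exact zpow_nonneg hqpos.le _⟩
    have p2 : 0 < μ.real B := measureReal_pos_of_isOpen_of_isCompact hBcl.isOpen hBco ⟨0, by
      rw [hB, Set.mem_ofPred_eq, absv_zero]; exact zpow_nonneg hqpos.le _⟩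
    rcases hswap with h | h
    · exact p1.ne' (by exact_mod_cast h)
    · exact p2.ne' (by exact_mod_cast h)
  refine ⟨ρ, v, hρ0, fun B S ρ' hB hBc hS hρ'0 hρ' hρB hBv h0S hSρ' hΨρ' ⟨u, hu, hPu, huS⟩ => ?_⟩
  have hDint : IntegrableOn (fun x => P x * Ψ x) (B \ S) μ :=
    hP.integrableOn h1 (hBc.diff hS.isOpen) fun h => h.2 h0S
  -- Only the critical sphere A₃ contributes. On A₁ one has Ψ = 1 and u rotates the integrand, on A₂
  -- multiplication by u₀ does so, and on A₄ translation by v.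
  set A₁ : Set K := {x | absv x ≤ ρ'} \ S with hA₁
  set A₂ : Set K := {x | absv x < ρ} \ {x | absv x ≤ ρ'} with hA₂
  set A₃ : Set K := {x | absv x = ρ} with hA₃
  set A₄ : Set K := B \ {x | absv x ≤ ρ} with hA₄
  have hlt : IsClopen {x : K | absv x < ρ} := by
    have : {x : K | absv x < ρ} = {x | absv x ≤ ρ} \ {x | absv x = ρ} := by
      ext x
      exact lt_iff_le_and_ne (a := absv x) (b := ρ)
    rw [this]
    exact (isClopen_absv_le hρ0).diff (isClopen_absv_eq hρ0)
  have m₁ : MeasurableSet A₁ := ((isClopen_absv_le hρ'0).diff hS).isOpen.measurableSet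
  have m₂ : MeasurableSet A₂ := (hlt.diff (isClopen_absv_le hρ'0)).isOpen.measurableSet
  have m₃ : MeasurableSet A₃ := (isClopen_absv_eq hρ0).isOpen.measurableSet
  have m₄ : MeasurableSet A₄ := (hB.diff (isClopen_absv_le hρ0)).isOpen.measurableSet
  have hdec : B \ S = A₁ ∪ (A₂ ∪ (A₃ ∪ A₄)) := by
    ext x
    have a1 : x ∈ S → absv x ≤ ρ' := fun h => hSρ' h
    have a2 : absv x ≤ ρ → x ∈ B := fun h => hρB h
    simp only [hA₁, hA₂, hA₃, hA₄, Set.mem_sdiff, Set.mem_union, Set.mem_ofPred_eq]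
    constructor
    · rintro ⟨hxB, hxS⟩
      rcases le_or_gt (absv x) ρ' with h | h
      · exact Or.inl ⟨h, hxS⟩
      rcases lt_trichotomy (absv x) ρ with h3 | h3 | h3
      · exact Or.inr (Or.inl ⟨h3, not_le.2 h⟩)
      · exact Or.inr (Or.inr (Or.inl h3))
      · exact Or.inr (Or.inr (Or.inr ⟨hxB, not_le.2 h3⟩))
    · rintro (⟨h3, h4⟩ | ⟨h3, h4⟩ | h3 | ⟨h3, h4⟩)
      · exact ⟨a2 (h3.trans hρ'.le), h4⟩
      · exact ⟨a2 h3.le, fun h => h4 (a1 h)⟩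
      · exact ⟨a2 h3.le, fun h => absurd (a1 h) (by rw [h3]; exact not_le.2 hρ')⟩
      · exact ⟨h3, fun h => h4 ((a1 h).trans hρ'.le)⟩
  have d₁ : Disjoint A₁ (A₂ ∪ (A₃ ∪ A₄)) := by
    rw [Set.disjoint_left]
    rintro x ⟨hx, -⟩ (⟨-, h⟩ | h | ⟨-, h⟩)
    · exact h hx
    · rw [Set.mem_ofPred_eq] at hx
      rw [hA₃, Set.mem_ofPred_eq] at h
      linarith
    · rw [Set.mem_ofPred_eq] at hx
      exact h (hx.trans hρ'.le)
  have d₂ : Disjoint A₂ (A₃ ∪ A₄) := by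
    rw [Set.disjoint_left]
    rintro x ⟨hx, -⟩ (h | ⟨-, h⟩)
    · exact (ne_of_lt hx) h
    · exact h (le_of_lt (show absv x < ρ from hx))
  have d₃ : Disjoint A₃ A₄ := by
    rw [Set.disjoint_left]
    rintro x hx ⟨-, h⟩
    exact h (le_of_eq hx)
  rw [hdec] at hDint ⊢
  have i₁ := hDint.mono_set Set.subset_union_left
  have i₁' := hDint.mono_set Set.subset_union_right
  have i₂ := i₁'.mono_set Set.subset_union_left
  have i₂' := i₁'.mono_set Set.subset_union_right
  rw [setIntegral_union d₁ (m₂.union (m₃.union m₄)) i₁ i₁', setIntegral_union d₂ (m₃.union m₄) i₂ i₂',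
    setIntegral_union d₃ m₄ (i₂'.mono_set Set.subset_union_left)
      (i₂'.mono_set Set.subset_union_right)]
  have z₁ : ∫ x in A₁, P x * Ψ x ∂μ = 0 := by
    refine setIntegral_eq_zero_of_dilation (a := P u) m₁ hu (fun x => ?_) (fun x hx => ?_) hPu
    · rw [hA₁, Set.mem_sdiff, Set.mem_sdiff, huS, Set.mem_ofPred_eq, Set.mem_ofPred_eq, absv_mul, hu,
        one_mul]
    · rw [hΨρ' x hx.1, hΨρ' (u * x) (by rw [absv_mul, hu, one_mul]; exact hx.1), map_mul]
      ring
  have z₂ : ∫ x in A₂, P x * Ψ x ∂μ = 0 := by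
    refine setIntegral_eq_zero_of_dilation (a := P u₀) m₂ hu₀ (fun x => ?_) (fun x hx => ?_) hPu₀
    · rw [hA₂, Set.mem_sdiff, Set.mem_sdiff, Set.mem_ofPred_eq, Set.mem_ofPred_eq, Set.mem_ofPred_eq,
        Set.mem_ofPred_eq, absv_mul, hu₀, one_mul]
    · rw [hsmall x hx.1, map_mul, mul_assoc]
  have z₄ : ∫ x in A₄, P x * Ψ x ∂μ = 0 := by
    refine setIntegral_eq_zero_of_translation (v := v) (a := Ψ v) m₄ (fun x => ?_)
      (fun x hx => ?_) hΨv
    · rw [hA₄, Set.mem_sdiff, Set.mem_sdiff, hBv, Set.mem_ofPred_eq, Set.mem_ofPred_eq]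
      refine and_congr_right fun _ => not_congr ⟨fun h => ?_, fun h => ?_⟩
      · have := (absv_sub_le (x + v) v).trans (max_le h hvρ)
        rwa [add_sub_cancel_right] at this
      · exact (absv_add_le _ _).trans (max_le h hvρ)
    · have hx1 : ρ < absv x := not_le.1 hx.2
      have hx0 : x ≠ 0 := fun h => by
        rw [h, absv_zero] at hx1
        linarith
      have h3 := hf _ (hlarge x 1 (by rwa [mul_one]))
      rw [mul_one] at h3
      rw [AddChar.map_add_eq_mul, show x + v = x * (1 + v / x) by field_simp, map_mul, h3]
      ring
  rw [z₁, z₂, z₄, zero_add, zero_add, add_zero]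
  exact hcrit

end GaussSum

/-! ### Iterated integrals in the coordinates. -/

section Iterated

variable {F E : Type*} [Field F] [ValuativeRel F] [TopologicalSpace F]
  [IsNonarchimedeanLocalField F] [Field E] [ValuativeRel E] [TopologicalSpace E]
  [IsNonarchimedeanLocalField E] [Algebra F E] [ValuativeExtension F E]

variable [MeasurableSpace E] [BorelSpace E] [MeasurableSpace F] [BorelSpace F]

/-- Haar integrals on `E` are iterated Haar integrals in the coordinates, up to a constant. -/
lemma exists_integral_eq_iterated {b : Module.Basis (Fin 2) F E} (hb : b 0 = 1)
    (μ : Measure E) [μ.IsAddHaarMeasure] (ν : Measure F) [ν.IsAddHaarMeasure] :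
    ∃ C : ℂ, C ≠ 0 ∧ ∀ f : E → ℂ, Integrable f μ →
      ∫ x, f x ∂μ = C * ∫ y, ∫ x, f (algebraMap F E x + algebraMap F E y * b 1) ∂ν ∂ν := by
  have hmeas : Measurable (coordEquiv b) := (coordEquiv b).continuous_toFun.measurable
  have hemb : MeasurableEmbedding (coordEquiv b) :=
    (coordEquiv b).toHomeomorph.measurableEmbedding
  have hH : ((ν.prod ν).map (coordEquiv b)).IsAddHaarMeasure :=
    (coordEquiv b).isAddHaarMeasure_map _
  have hsm := Measure.isAddLeftInvariant_eq_smul μ ((ν.prod ν).map (coordEquiv b))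
  set a := Measure.addHaarScalarFactor μ ((ν.prod ν).map (coordEquiv b)) with ha
  have ha0 : a ≠ 0 := fun h => by
    rw [h, zero_smul] at hsm
    exact (NeZero.ne μ) hsm
  refine ⟨a, by exact_mod_cast ha0, fun f hf => ?_⟩
  rw [hsm] at hf
  have hf1 : Integrable f ((ν.prod ν).map (coordEquiv b)) :=
    (integrable_smul_measure (by simpa using ha0) (by simp)).1 (hf : Integrable f ((a : ENNReal) • _))
  have hf2 := (hemb.integrable_map_iff).1 hf1
  rw [hsm, integral_smul_nnreal_measure, hemb.integral_map]
  have := integral_prod_symm _ hf2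
  simp only [Function.comp, coordEquiv_apply, hb, Algebra.smul_def, mul_one] at this
  rw [← this, NNReal.smul_def, Complex.real_smul]
  simp only [coordEquiv_apply, hb, Algebra.smul_def, mul_one]

end Iterated

/-! ### Integrals over segments parallel to F. -/

section FiberIntegral

variable {F E : Type*} [Field F] [ValuativeRel F] [TopologicalSpace F]
  [IsNonarchimedeanLocalField F] [Field E] [ValuativeRel E] [TopologicalSpace E]
  [IsNonarchimedeanLocalField E] [Algebra F E] [ValuativeExtension F E]

variable [MeasurableSpace F] [BorelSpace F] {ν : Measure F} [ν.IsAddHaarMeasure]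
  {b : Module.Basis (Fin 2) F E} {P : E →*₀ ℂ}

/-- Substituting x ↦ wx and pulling out P(w) reduces all segments at height w ≠ 0 to those at height
1. -/
lemma setIntegral_fiber_smul (b : Module.Basis (Fin 2) F E) (P : E →*₀ ℂ) {R : ℝ} (hR : 0 < R)
    {w : F} (hw : w ≠ 0) :
    ∫ x in {x | absv x ≤ absv w * R}, P (algebraMap F E x + algebraMap F E w * b 1) ∂ν =
      absv w * P (algebraMap F E w) * ∫ x in {x | absv x ≤ R}, P (algebraMap F E x + b 1) ∂ν := by
  rw [setIntegral_comp_continuousAddEquiv ν (mulAut (Units.mk0 w hw)) _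
    (isClopen_absv_le (mul_pos (absv_pos hw) hR)).isOpen.measurableSet, haarChar_mulAut,
    Units.val_mk0, mul_assoc, ← integral_const_mul (P (algebraMap F E w))]
  have h : mulAut (Units.mk0 w hw) ⁻¹' {x | absv x ≤ absv w * R} = {x | absv x ≤ R} := by
    ext x
    rw [Set.mem_preimage, Set.mem_ofPred_eq, Set.mem_ofPred_eq, mulAut_apply, Units.val_mk0,
      absv_mul, mul_le_mul_iff_right₀ (absv_pos hw)]
  rw [h]
  congr 2
  funext x
  rw [mulAut_apply, Units.val_mk0, map_mul, ← mul_add, map_mul]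

/-- Some ball fits into the unit box; powers of a uniformizer of F rescale both. -/
lemma exists_absv_le_subset_box (b : Module.Basis (Fin 2) F E) : ∃ δ : ℝ, 0 < δ ∧
    ∀ (n : ℤ) (x : E), absv x ≤ δ * (resCard F : ℝ) ^ (2 * n) →
      x ∈ box b ((resCard F : ℝ) ^ n) ((resCard F : ℝ) ^ n) := by
  obtain ⟨δ, hδ, h⟩ := exists_ball_subset
    ((isClopen_box b one_pos one_pos).isOpen.mem_nhds (zero_mem_box b zero_le_one zero_le_one))
  refine ⟨δ, hδ, fun n x hx => ?_⟩
  obtain ⟨ϖ, hϖ⟩ := IsDiscreteValuationRing.exists_irreducible 𝒪[F]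
  have hq := resCard_pos_real (K := F)
  have h0 : ((ϖ : F) ^ n) ≠ 0 := zpow_ne_zero _ (uniformizer_ne_zero hϖ)
  have hy : algebraMap F E ((ϖ : F) ^ n) * x ∈ box b 1 1 := by
    refine h ?_
    rw [Set.mem_ofPred_eq, sub_zero, absv_mul, absv_algebraMap b, absv_uniformizer_zpow hϖ]
    calc ((resCard F : ℝ) ^ (-n)) ^ 2 * absv x
        ≤ ((resCard F : ℝ) ^ (-n)) ^ 2 * (δ * (resCard F : ℝ) ^ (2 * n)) := by gcongr
      _ = δ := by
        rw [← zpow_natCast, ← zpow_mul, mul_left_comm, ← zpow_add₀ hq.ne']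
        simp [mul_comm]
  have hbd : ∀ a : F, absv ((ϖ : F) ^ n * a) ≤ 1 → absv a ≤ (resCard F : ℝ) ^ n := fun a ha => by
    rwa [absv_mul, absv_uniformizer_zpow hϖ, zpow_neg, inv_mul_le_iff₀ (zpow_pos hq _), mul_one]
      at ha
  rw [box, Set.mem_ofPred_eq, repr_algebraMap_mul, repr_algebraMap_mul] at hy
  exact ⟨hbd _ hy.1, hbd _ hy.2⟩

lemma absv_le_of_mem_box (hb : b 0 = 1) {R R' : ℝ} {x : E} (hx : x ∈ box b R R') :
    absv x ≤ max (R ^ 2) (R' ^ 2 * absv (b 1)) := by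
  rw [eq_coords hb x]
  refine (absv_add_le _ _).trans (max_le_max ?_ ?_)
  · rw [absv_algebraMap b]
    exact pow_le_pow_left₀ (absv_nonneg _) hx.1 2
  · rw [absv_mul, absv_algebraMap b]
    exact mul_le_mul_of_nonneg_right (pow_le_pow_left₀ (absv_nonneg _) hx.2 2) (absv_nonneg _)

lemma coords_mem_box (hb : b 0 = 1) {R R' : ℝ} {x y : F} :
    algebraMap F E x + algebraMap F E y * b 1 ∈ box b R R' ↔ absv x ≤ R ∧ absv y ≤ R' := by
  rw [box, Set.mem_ofPred_eq, repr_of_coords hb, repr_of_coords hb]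
  rfl

lemma add_mem_box_iff {R R' : ℝ} {v : E} (hv : v ∈ box b R R') (x : E) :
    x + v ∈ box b R R' ↔ x ∈ box b R R' := by
  have key : ∀ y z : E, y ∈ box b R R' → z ∈ box b R R' → y - z ∈ box b R R' := fun y z hy hz => by
    rw [box, Set.mem_ofPred_eq, map_sub, Finsupp.sub_apply, Finsupp.sub_apply]
    exact ⟨(absv_sub_le _ _).trans (max_le hy.1 hz.1), (absv_sub_le _ _).trans (max_le hy.2 hz.2)⟩
  constructor
  · intro h
    have := key _ _ h hv
    rwa [add_sub_cancel_right] at this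
  · intro h
    have h0 : (0 : E) ∈ box b R R' := by simpa using key _ _ hv hv
    have := key _ _ h (key _ _ h0 hv)
    rwa [zero_sub, sub_neg_eq_add] at this

/-- The integral of a ramified character over large segments parallel to the ground field does not
always vanish. -/
theorem IsRamifiedChar.exists_setIntegral_fiber_ne_zero (hP : IsRamifiedChar P) (hb : b 0 = 1)
    {a : F} (ha : absv a = 1) (hPa : P (algebraMap F E a) ≠ 1) {r : ℝ} (hr0 : 0 < r)
    (hr : ∀ x v, absv v ≤ r * absv x → P (x + v) = P x) {k₀ : ℕ}
    (hk₀ : absv (b 1) ≤ r * ((resCard F : ℝ) ^ k₀) ^ 2) :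
    ∃ k : ℕ, k₀ ≤ k ∧ ∫ x in {x | absv x ≤ (resCard F : ℝ) ^ k}, P (algebraMap F E x + b 1) ∂ν ≠ 0 := by
  -- If all these integrals vanish, then so does, fibre by fibre, a Gauss integral of P against a
  -- character of x₂ alone, contradicting `IsRamifiedChar.exists_setIntegral_ne_zero`.
  by_contra! hJ
  borelize E
  set q : ℝ := (resCard F : ℝ) with hqdef
  have hq1 : 1 < q := one_lt_resCard_real (K := F)
  have hq : 0 < q := by linarith
  obtain ⟨δ, hδ, hbox⟩ := exists_absv_le_subset_box b
  obtain ⟨Ψ₀, hΨ₀, v₀, hv₀⟩ := exists_addChar F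
  set Ψ : AddChar E ℂ := Ψ₀.compAddMonoidHom (b.coord 1).toAddMonoidHom with hΨ
  have hΨa : ∀ x, Ψ x = Ψ₀ (b.repr x 1) := fun x => rfl
  have hΨδ : ∀ x, absv x ≤ δ → Ψ x = 1 := fun x hx => by
    have := hbox 0 x (by simpa using hx)
    rw [hΨa]
    exact hΨ₀ _ (by simpa using this.2)
  have h1 : ∃ n : ℤ, ∀ x : E, absv x ≤ (resCard E : ℝ) ^ (-n) → Ψ x = 1 := by
    obtain ⟨n, hn⟩ := exists_pow_lt_of_lt_one hδ
      (inv_lt_one_of_one_lt₀ (one_lt_resCard_real (K := E)))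
    refine ⟨n, fun x hx => hΨδ x (hx.trans ?_)⟩
    rw [zpow_neg, zpow_natCast, ← inv_pow]
    exact hn.le
  obtain ⟨ρ, v, hρ, H⟩ := hP.exists_setIntegral_ne_zero (μ := Measure.addHaar) h1
    ⟨algebraMap F E 0 + algebraMap F E v₀ * b 1, by rw [hΨa, repr_of_coords hb]; exact hv₀⟩
  set ρ' : ℝ := min δ (ρ / 2) with hρ'
  have hρ'0 : 0 < ρ' := lt_min hδ (by linarith)
  obtain ⟨n, hn⟩ : ∃ n : ℕ, max ρ (absv v) ≤ δ * q ^ (2 * (n : ℤ)) := by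
    obtain ⟨n, hn⟩ := pow_unbounded_of_one_lt (max ρ (absv v) / δ) hq1
    refine ⟨n, ?_⟩
    rw [div_lt_iff₀ hδ, mul_comm] at hn
    refine hn.le.trans (mul_le_mul_of_nonneg_left ?_ hδ.le)
    rw [← zpow_natCast]
    exact zpow_le_zpow_right₀ hq1.le (by omega)
  obtain ⟨i, hi⟩ : ∃ i : ℕ, max ((q ^ k₀) ^ 2) (absv (b 1)) * (q⁻¹) ^ (2 * i) ≤ ρ' := by
    have hM : 0 < max ((q ^ k₀) ^ 2) (absv (b 1)) := lt_max_of_lt_left (by positivity)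
    obtain ⟨i, hi⟩ := exists_pow_lt_of_lt_one (div_pos hρ'0 hM) (inv_lt_one_of_one_lt₀ hq1)
    refine ⟨i, ?_⟩
    rw [lt_div_iff₀ hM, mul_comm] at hi
    refine le_trans (mul_le_mul_of_nonneg_left ?_ hM.le) hi.le
    exact pow_le_pow_of_le_one (by positivity) (inv_lt_one_of_one_lt₀ hq1).le (by omega)
  -- Both boxes are q^{k₀} times longer in x₁ than in x₂. Hence the fibres of B rescale to radius at
  -- least q^{k₀}, and on the low fibres outside S the term x₂ · b 1 is negligible against x₁.
  set B : Set E := box b (q ^ (k₀ + n)) (q ^ n) with hB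
  set S : Set E := box b (q ^ k₀ * q⁻¹ ^ i) (q⁻¹ ^ i) with hS
  have hBcl : IsClopen B := isClopen_box b (by positivity) (by positivity)
  have hScl : IsClopen S := isClopen_box b (by positivity) (by positivity)
  have hBco : IsCompact B := isCompact_box b _ _
  have hbig : ∀ x : E, absv x ≤ max ρ (absv v) → x ∈ B := fun x hx => by
    have := hbox n x (hx.trans hn)
    rw [zpow_natCast] at this
    exact ⟨this.1.trans (pow_le_pow_right₀ hq1.le (by omega)), this.2⟩
  have h0S : (0 : E) ∈ S := zero_mem_box b (by positivity) (by positivity)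
  have hSρ : S ⊆ {x | absv x ≤ ρ'} := fun x hx => by
    refine (absv_le_of_mem_box hb hx).trans (le_trans (le_of_eq ?_) hi)
    rw [max_mul_of_nonneg _ _ (by positivity)]
    ring_nf
  refine H B S ρ' hBcl hBco hScl hρ'0 ((min_le_right _ _).trans_lt (by linarith))
    (fun x hx => hbig x (le_max_of_le_left hx)) (add_mem_box_iff (hbig v (le_max_right _ _))) h0S hSρ
    (fun x hx => hΨδ x (hx.trans (min_le_left _ _)))
    ⟨algebraMap F E a, by rw [absv_algebraMap b, ha, one_pow], hPa, fun x => ?_⟩ ?_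
  · rw [hS, box, Set.mem_ofPred_eq, Set.mem_ofPred_eq, repr_algebraMap_mul, repr_algebraMap_mul,
      absv_mul, absv_mul, ha, one_mul, one_mul]
  have hDm : MeasurableSet (B \ S) := (hBcl.diff hScl).isOpen.measurableSet
  have hDint : IntegrableOn (fun x => P x * Ψ x) (B \ S) Measure.addHaar :=
    hP.integrableOn h1 (hBco.diff hScl.isOpen) fun h => h.2 h0S
  obtain ⟨C, -, hC⟩ := exists_integral_eq_iterated hb (Measure.addHaar : Measure E) ν
  rw [← integral_indicator hDm, hC _ ((integrable_indicator_iff hDm).2 hDint)]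
  refine mul_eq_zero_of_right _ ?_
  refine integral_eq_zero_of_ae (Filter.Eventually.of_forall fun y => ?_)
  have hind : ∀ T : Set F, MeasurableSet T → (∀ x : F,
      algebraMap F E x + algebraMap F E y * b 1 ∈ B \ S ↔ x ∈ T) →
      ∫ x, (B \ S).indicator (fun x => P x * Ψ x) (algebraMap F E x + algebraMap F E y * b 1) ∂ν =
        (∫ x in T, P (algebraMap F E x + algebraMap F E y * b 1) ∂ν) * Ψ₀ y := by
    intro T hT hTx
    rw [← integral_mul_const, ← integral_indicator hT]
    congr 1
    funext x
    by_cases hx : x ∈ T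
    · rw [Set.indicator_of_mem hx, Set.indicator_of_mem ((hTx x).2 hx), hΨa, repr_of_coords hb]
      rfl
    · rw [Set.indicator_of_notMem hx, Set.indicator_of_notMem (mt (hTx x).1 hx)]
  have hmemB : ∀ x, algebraMap F E x + algebraMap F E y * b 1 ∈ B ↔
      absv x ≤ q ^ (k₀ + n) ∧ absv y ≤ q ^ n := fun x => coords_mem_box hb
  have hmemS : ∀ x, algebraMap F E x + algebraMap F E y * b 1 ∈ S ↔
      absv x ≤ q ^ k₀ * q⁻¹ ^ i ∧ absv y ≤ q⁻¹ ^ i := fun x => coords_mem_box hb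
  simp only [Pi.zero_apply]
  rcases lt_or_ge (q ^ n) (absv y) with hy | hy
  · rw [hind ∅ MeasurableSet.empty fun x => by
      simp only [Set.mem_sdiff, hmemB, not_le.2 hy, Set.mem_empty_iff_false]; tauto]
    simp
  rcases lt_or_ge (q⁻¹ ^ i) (absv y) with hy2 | hy2
  -- Intermediate heights |y| = q^j: the fibre is a full segment, a multiple of the integral for k =
  -- k₀ + n - j ≥ k₀.
  · have hy0 : y ≠ 0 := fun h => by
      rw [h, absv_zero] at hy2
      exact absurd hy2 (not_lt.2 (by positivity))
    rw [hind {x | absv x ≤ q ^ (k₀ + n)} (isClopen_absv_le (by positivity)).isOpen.measurableSet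
      fun x => by
        rw [Set.mem_sdiff, hmemB, hmemS, Set.mem_ofPred_eq]
        simp only [not_le.2 hy2, hy, and_true, and_false, not_false_eq_true]]
    obtain ⟨j, hj⟩ : ∃ j : ℤ, absv y = q ^ j := ⟨-ord y, absv_of_ne_zero hy0⟩
    have hjn : j ≤ n := by
      rw [hj, ← zpow_natCast] at hy
      exact (zpow_le_zpow_iff_right₀ hq1).1 hy
    obtain ⟨k, hk⟩ : ∃ k : ℕ, (k₀ : ℤ) + n - j = k := ⟨(k₀ + n - j).toNat, by omega⟩
    have e : q ^ (k₀ + n) = absv y * q ^ k := by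
      rw [hj, ← zpow_natCast, ← zpow_natCast, ← zpow_add₀ hq.ne', ← hk]
      push_cast
      ring_nf
    rw [e, setIntegral_fiber_smul b P (by positivity) hy0, hJ k (by omega), mul_zero, zero_mul]
  -- Low heights: on the rest of the fibre P depends on x₁ only, and multiplication by the unit a
  -- kills the integral.
  · set T : Set F := {x | absv x ≤ q ^ (k₀ + n)} \ {x | absv x ≤ q ^ k₀ * q⁻¹ ^ i} with hT
    have hTm : MeasurableSet T := ((isClopen_absv_le (by positivity)).diff
      (isClopen_absv_le (by positivity))).isOpen.measurableSet
    rw [hind T hTm fun x => by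
      rw [Set.mem_sdiff, hmemB, hmemS, hT, Set.mem_sdiff, Set.mem_ofPred_eq, Set.mem_ofPred_eq]
      simp only [hy, hy2, and_true]]
    have hPx : ∀ x ∈ T, P (algebraMap F E x + algebraMap F E y * b 1) = P (algebraMap F E x) := by
      intro x hx
      refine hr _ _ ?_
      have hx2 : q ^ k₀ * q⁻¹ ^ i < absv x := not_le.1 hx.2
      rw [absv_mul, absv_algebraMap b, absv_algebraMap b]
      calc absv y ^ 2 * absv (b 1) ≤ (q⁻¹ ^ i) ^ 2 * (r * (q ^ k₀) ^ 2) := by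
            have h2 := absv_nonneg (b 1)
            have h3 := absv_nonneg y
            gcongr
        _ = r * (q ^ k₀ * q⁻¹ ^ i) ^ 2 := by ring
        _ ≤ r * absv x ^ 2 := by gcongr
    rw [setIntegral_congr_fun hTm hPx]
    refine mul_eq_zero_of_left (setIntegral_eq_zero_of_dilation (u := a) hTm ha (fun x => ?_)
      (fun x _ => ?_) hPa) _
    · rw [hT, Set.mem_sdiff, Set.mem_sdiff, Set.mem_ofPred_eq, Set.mem_ofPred_eq, Set.mem_ofPred_eq,
        Set.mem_ofPred_eq, absv_mul, ha, one_mul]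
    · rw [map_mul, map_mul]

end FiberIntegral

/-! ### Nonvanishing on `//` when χ|² ≠ 1. -/

section SlashChar

variable {F E : Type*} [Field F] [ValuativeRel F] [TopologicalSpace F]
  [IsNonarchimedeanLocalField F] [Field E] [ValuativeRel E] [TopologicalSpace E]
  [IsNonarchimedeanLocalField E] [Algebra F E] [ValuativeExtension F E]

variable {b : Module.Basis (Fin 2) F E} {d : F} {ϖF : 𝒪[F]} {ϖE : 𝒪[E]} {χ : UnitChar E}
  {η : UnitChar F} {s : ℂ}

variable (χ s) in
/-- The smooth factor of the kernel for `η = χ|`, `t = 2s + 1/2`, as a multiplicative function. -/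
def slashChar (hb : b 0 = 1) (hd : b 1 ^ 2 = algebraMap F E d) (hϖE : Irreducible ϖE) :
    E →*₀ ℂ where
  toFun x := (multChar ϖE (χ ^ 2) (2 * s + 1) (conj b x))⁻¹
  map_zero' := by rw [map_zero, multChar_zero, inv_zero]
  map_one' := by
    have := conj_algebraMap (b := b) hb 1
    rw [map_one] at this
    rw [this, multChar_one, inv_one]
  map_mul' x y := by rw [conj_mul hb hd, multChar_mul hϖE, mul_inv]

lemma slashChar_apply (hb : b 0 = 1) (hd : b 1 ^ 2 = algebraMap F E d) (hϖE : Irreducible ϖE)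
    (x : E) : slashChar χ s hb hd hϖE x = (multChar ϖE (χ ^ 2) (2 * s + 1) (conj b x))⁻¹ := rfl

lemma slashChar_algebraMap (hb : b 0 = 1) (hd : b 1 ^ 2 = algebraMap F E d) (hϖE : Irreducible ϖE)
    {a : F} (ha : absv a = 1) :
    slashChar χ s hb hd hϖE (algebraMap F E a) = (unitExt (resChar (F := F) χ ^ 2) a)⁻¹ := by
  rw [slashChar_apply, conj_algebraMap hb, multChar_of_absv_one _ _ _
    (by rw [absv_algebraMap b, ha, one_pow]), unitExt_algebraMap _ ha]
  rfl

lemma slashChar_exists_add_eq (hb : b 0 = 1) (hd : b 1 ^ 2 = algebraMap F E d)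
    (hϖE : Irreducible ϖE) : ∃ r : ℝ, 0 < r ∧ r < 1 ∧ ∀ x v, absv v ≤ r * absv x →
      slashChar χ s hb hd hϖE (x + v) = slashChar χ s hb hd hϖE x := by
  obtain ⟨r, hr0, hr1, hr⟩ := exists_multChar_add_eq hϖE (χ ^ 2)
  refine ⟨r, hr0, hr1, fun x v h => ?_⟩
  rw [slashChar_apply, slashChar_apply, map_add, hr]
  rwa [absv_conj hb hd, absv_conj hb hd]

lemma exists_unitExt_ne_one {ξ : UnitChar F} (h : ξ ≠ 1) : ∃ a : F, absv a = 1 ∧ unitExt ξ a ≠ 1 := by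
  by_contra! H
  refine h (DFunLike.ext _ _ fun u => ?_)
  have := H _ (absv_unit u)
  rw [unitExt_unit] at this
  exact Circle.ext this

variable [MeasurableSpace E] [BorelSpace E] {μ : Measure E} [μ.IsAddHaarMeasure]

variable (hb : b 0 = 1) (hd : b 1 ^ 2 = algebraMap F E d) (hϖF : Irreducible ϖF)
  (hϖE : Irreducible ϖE) (hχ : multChar ϖE χ 0 (algebraMap F E ϖF) = 1)

include hb hd hϖF hϖE hχ

/-- On the singular hyperplane the distribution does not vanish if `χ|² ≠ 1`. -/
theorem distr_ne_zero_of_resChar_mul_ne_one (hη : resChar χ = η) (hη2 : resChar χ * η ≠ 1)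
    {l : Fˣ} {c : ℂ} (hl1 : absv (l : F) = 1)
    (hl : ∀ z r, (localL z (resChar χ * η) r)⁻¹ = c * (1 - multChar ϖF (resChar χ * η) (z + r) l))
    {T : Distr E} (hT : ∀ φ : testFunctions E, T φ =
      regInt b d ϖF ϖE μ χ η l c s (2 * s + 1 / 2)
        fun x => φ x - φ (algebraMap F E (ϖF : F)⁻¹ * x)) : T ≠ 0 := by
  intro hT0
  borelize F
  have hsq : resChar (F := F) χ ^ 2 ≠ 1 := by rwa [sq, ← hη] at *
  obtain ⟨a, ha, hξa⟩ := exists_unitExt_ne_one hsq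
  set P := slashChar χ s hb hd hϖE with hPdef
  have hPa : P (algebraMap F E a) ≠ 1 := by
    rw [hPdef, slashChar_algebraMap hb hd hϖE ha]
    exact fun h => hξa (inv_eq_one.1 h)
  have hP : IsRamifiedChar P := ⟨slashChar_exists_add_eq hb hd hϖE, algebraMap F E a,
    by rw [absv_algebraMap b, ha, one_pow], hPa⟩
  obtain ⟨r, hr0, -, hr⟩ := slashChar_exists_add_eq (χ := χ) (s := s) hb hd hϖE
  set q : ℝ := (resCard F : ℝ) with hqdef
  have hq1 : 1 < q := one_lt_resCard_real (K := F)
  have hq : 0 < q := by linarith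
  obtain ⟨k₀, hk₀⟩ : ∃ k₀ : ℕ, absv (b 1) ≤ r * (q ^ k₀) ^ 2 := by
    obtain ⟨k, hk⟩ := pow_unbounded_of_one_lt (absv (b 1) / r) hq1
    refine ⟨k, ?_⟩
    rw [div_lt_iff₀ hr0, mul_comm] at hk
    refine hk.le.trans (mul_le_mul_of_nonneg_left ?_ hr0.le)
    rw [← pow_mul]
    exact pow_le_pow_right₀ hq1.le (by omega)
  obtain ⟨k, hk, hJ⟩ := hP.exists_setIntegral_fiber_ne_zero (ν := Measure.addHaar) hb ha hPa hr0 hr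
    hk₀
  set R : ℝ := q ^ k with hR
  have hR0 : 0 < R := by positivity
  have hRk : absv (b 1) ≤ r * R ^ 2 := hk₀.trans (by rw [hR]; gcongr; exact hq1.le)
  -- The indicator of the box |x₁| ≤ R, |x₂| ≤ 1 minus its dilate is supported on Z, where |x₂| = 1
  -- and the kernel is integrable, and on A, where x₂ is negligible against x₁.
  set Z : Set E := {x | absv (b.repr x 0) ≤ R ∧ absv (b.repr x 1) = 1} with hZ
  set A : Set E := {x | absv (b.repr x 0) = R ∧ absv (b.repr x 1) < 1} with hA
  have hlt : IsClopen {x : F | absv x < 1} := by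
    have : {x : F | absv x < 1} = {x | absv x ≤ q⁻¹} := by
      ext x
      exact absv_lt_one_iff
    rw [this]
    exact isClopen_absv_le (inv_pos.2 hq)
  have hZcl : IsClopen Z := ((isClopen_absv_le hR0).preimage (continuous_repr b 0)).inter
    ((isClopen_absv_eq one_pos).preimage (continuous_repr b 1))
  have hAcl : IsClopen A := ((isClopen_absv_eq hR0).preimage (continuous_repr b 0)).inter
    (hlt.preimage (continuous_repr b 1))
  have hZco : IsCompact Z := (isCompact_box b R 1).of_isClosed_subset hZcl.isClosed
    fun x hx => ⟨hx.1, hx.2.le⟩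
  have hAco : IsCompact A := (isCompact_box b R 1).of_isClosed_subset hAcl.isClosed
    fun x hx => ⟨hx.1.le, hx.2.le⟩
  set φZ := indicatorTest Z hZcl hZco with hφZ
  set φA := indicatorTest A hAcl hAco with hφA
  have hZ0 : (0 : E) ∉ Z := fun h => by
    have := h.2
    simp [absv_zero] at this
  have hA0 : (0 : E) ∉ A := fun h => by
    have := h.1
    simp only [map_zero, Finsupp.coe_zero, Pi.zero_apply, absv_zero] at this
    exact hR0.ne this
  have hdec : ∀ x : E, indicatorTest (box b R 1) (isClopen_box b hR0 one_pos)
      (isCompact_box b _ _) x - indicatorTest (box b R 1) (isClopen_box b hR0 one_pos)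
        (isCompact_box b _ _) (algebraMap F E (ϖF : F)⁻¹ * x) = φZ x + φA x := by
    intro x
    classical
    have hv : ∀ i, absv (b.repr (algebraMap F E (ϖF : F)⁻¹ * x) i) = q * absv (b.repr x i) :=
      fun i => by rw [repr_algebraMap_mul, absv_mul, absv_inv, absv_uniformizer hϖF, inv_inv]
    have hm : algebraMap F E (ϖF : F)⁻¹ * x ∈ box b R 1 ↔
        absv (b.repr x 0) < R ∧ absv (b.repr x 1) < 1 := by
      rw [box, Set.mem_ofPred_eq, hv, hv, absv_lt_one_iff, ← le_inv_mul_iff₀ hq,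
        ← le_inv_mul_iff₀ hq, mul_one]
      refine and_congr_left fun _ => ⟨fun h => h.trans_lt ?_, fun h => ?_⟩
      · rw [inv_mul_lt_iff₀ hq]
        exact lt_mul_of_one_lt_left hR0 hq1
      · by_contra h'
        have e : q⁻¹ * R = q ^ ((k : ℤ) - 1) := by
          rw [hR, zpow_sub₀ hq.ne', zpow_natCast, zpow_one]
          field_simp
        rw [not_le, e] at h'
        have := absv_le_zpow_or h'
        rw [sub_add_cancel, zpow_natCast] at this
        exact absurd h (not_lt.2 this)
    have hm1 : x ∈ box b R 1 ↔ absv (b.repr x 0) ≤ R ∧ absv (b.repr x 1) ≤ 1 := Iff.rfl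
    have hmZ : x ∈ Z ↔ absv (b.repr x 0) ≤ R ∧ absv (b.repr x 1) = 1 := Iff.rfl
    have hmA : x ∈ A ↔ absv (b.repr x 0) = R ∧ absv (b.repr x 1) < 1 := Iff.rfl
    rw [hφZ, hφA, indicatorTest_apply, indicatorTest_apply, indicatorTest_apply, indicatorTest_apply]
    simp only [Set.indicator_apply, hm, hm1, hmZ, hmA, Pi.one_apply]
    generalize absv (b.repr x 0) = u
    generalize absv (b.repr x 1) = w
    split_ifs <;> first | (norm_num; done) | (exfalso; grind)
  have hsum := hT (indicatorTest (box b R 1) (isClopen_box b hR0 one_pos) (isCompact_box b _ _))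
  rw [funext hdec, hT0, LinearMap.zero_apply, regInt_add hb hd hϖF hϖE l c
    (testFunctions_isLocallyConstant φZ) (testFunctions_hasCompactSupport φZ)
    (by rw [hφZ, indicatorTest_apply, Set.indicator_of_notMem hZ0])
    (testFunctions_isLocallyConstant φA) (testFunctions_hasCompactSupport φA)
    (by rw [hφA, indicatorTest_apply, Set.indicator_of_notMem hA0])] at hsum
  -- On A the smooth factor depends on x₁ only, and l is a unit; the scaling therefore preserves A
  -- and the two terms of the integrand coincide.
  have hIA : regInt b d ϖF ϖE μ χ η l c s (2 * s + 1 / 2) φA = 0 := by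
    refine mul_eq_zero_of_right _ (integral_eq_zero_of_ae (Filter.Eventually.of_forall fun x => ?_))
    rw [Pi.zero_apply, regIntegrand]
    have hσ : (scaleAut b 1 l).symm x ∈ A ↔ x ∈ A := by
      rw [scaleAut_symm, hA, Set.mem_ofPred_eq, Set.mem_ofPred_eq, repr_scaleAut_zero,
        repr_scaleAut_one, absv_mul, absv_mul, Units.val_inv_eq_inv_val, Units.val_inv_eq_inv_val,
        absv_inv, absv_inv, hl1]
      simp [absv_one]
    rw [hφA, indicatorTest_apply, indicatorTest_apply]
    by_cases hx : x ∈ A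
    swap
    · rw [Set.indicator_of_notMem hx, Set.indicator_of_notMem (mt hσ.1 hx)]
      ring
    have key : ∀ y ∈ A, smoothFactor b d ϖF ϖE χ η s (2 * s + 1 / 2) y =
        P (algebraMap F E (b.repr y 0)) := by
      intro y hy
      have hy0 : y ≠ 0 := fun h => hA0 (h ▸ hy)
      rw [smoothFactor_slash hb hd hϖF hϖE hχ hη hy0, ← slashChar_apply hb hd hϖE]
      conv_lhs => rw [eq_coords hb y]
      refine hr _ _ ?_
      rw [absv_mul, absv_algebraMap b, absv_algebraMap b, hy.1]
      refine le_trans (mul_le_of_le_one_left (absv_nonneg _) ?_) hRk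
      exact pow_le_one₀ (absv_nonneg _) hy.2.le
    have e0 : b.repr ((scaleAut b 1 l).symm x) 0 = b.repr x 0 := by
      rw [scaleAut_symm, repr_scaleAut_zero]
      simp
    rw [Set.indicator_of_mem hx, Set.indicator_of_mem (hσ.2 hx), key x hx, key _ (hσ.2 hx), e0]
    simp
  have hint : Integrable (fun x => kernelFun b d ϖF ϖE χ η s (2 * s + 1 / 2) x * φZ x) μ := by
    refine integrable_kernelFun_of_tsupport hb hd hϖF hϖE hχ (testFunctions_isLocallyConstant φZ)
      (testFunctions_hasCompactSupport φZ) ((tsupport_indicatorTest_subset _ _ _).trans ?_)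
    intro x hx h0
    have := hx.2
    rw [h0, absv_zero] at this
    exact zero_ne_one this
  obtain ⟨C, hC0, hC⟩ := exists_integral_eq_iterated hb μ (Measure.addHaar : Measure F)
  rw [hIA, add_zero, regInt_eq_of_integrable hb hd hϖF hϖE hχ hl hint, localL, if_neg hη2, inv_one,
    one_mul, hC _ hint] at hsum
  set U : Set F := {y | absv y = 1} with hU
  have hUcl : IsClopen U := isClopen_absv_eq one_pos
  set J := ∫ x in {x | absv x ≤ R}, P (algebraMap F E x + b 1) ∂(Measure.addHaar : Measure F)
    with hJdef
  -- At height |y| = 1 the factor κ(y) = P(y)⁻¹ undoes the factor P(y) from rescaling the fibre, so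
  -- every such fibre contributes the same J.
  have inner : ∀ y : F, ∫ x, kernelFun b d ϖF ϖE χ η s (2 * s + 1 / 2)
      (algebraMap F E x + algebraMap F E y * b 1) * φZ (algebraMap F E x + algebraMap F E y * b 1)
        ∂(Measure.addHaar : Measure F) = U.indicator (fun _ => J) y := by
    intro y
    have hmem : ∀ x : F, algebraMap F E x + algebraMap F E y * b 1 ∈ Z ↔ absv x ≤ R ∧ absv y = 1 :=
      fun x => by
        rw [hZ, Set.mem_ofPred_eq, repr_of_coords hb, repr_of_coords hb]
        rfl
    by_cases hy : y ∈ U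
    · have hy1 : absv y = 1 := hy
      have hy0 : y ≠ 0 := fun h => by simp [h, absv_zero] at hy1
      have hJy := setIntegral_fiber_smul (ν := (Measure.addHaar : Measure F)) b P hR0 hy0
      rw [hy1, one_mul, Complex.ofReal_one, one_mul, ← hJdef] at hJy
      have hκ := multChar_ne_zero hϖF (resChar (F := F) χ ^ 2) (4 * s) hy0
      have hκP : multChar ϖF (resChar (F := F) χ ^ 2) (4 * s) y * P (algebraMap F E y) = 1 := by
        rw [hPdef, slashChar_algebraMap hb hd hϖE hy1, ← multChar_of_absv_one ϖF _ (4 * s) hy1]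
        exact mul_inv_cancel₀ hκ
      have hJeq : J = multChar ϖF (resChar (F := F) χ ^ 2) (4 * s) y *
          ∫ x in {x | absv x ≤ R}, P (algebraMap F E x + algebraMap F E y * b 1)
            ∂(Measure.addHaar : Measure F) := by rw [hJy, ← mul_assoc, hκP, one_mul]
      rw [Set.indicator_of_mem hy, hJeq, ← integral_const_mul,
        ← integral_indicator (isClopen_absv_le hR0).isOpen.measurableSet]
      congr 1
      funext x
      rw [hφZ, indicatorTest_apply]
      by_cases hx : absv x ≤ R
      · rw [Set.indicator_of_mem ((hmem x).2 ⟨hx, hy1⟩),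
          Set.indicator_of_mem (show x ∈ {x : F | absv x ≤ R} from hx),
          kernelFun_slash hb hd hϖF hϖE hχ hη, repr_of_coords hb, ← slashChar_apply hb hd hϖE]
        simp only [Pi.one_apply, mul_one]
        exact mul_comm _ _
      · rw [Set.indicator_of_notMem fun h => hx ((hmem x).1 h).1,
          Set.indicator_of_notMem (show x ∉ {x : F | absv x ≤ R} from hx), mul_zero]
    · rw [Set.indicator_of_notMem hy]
      refine integral_eq_zero_of_ae (Filter.Eventually.of_forall fun x => ?_)
      simp only [Pi.zero_apply]
      rw [hφZ, indicatorTest_apply, Set.indicator_of_notMem fun h => hy ((hmem x).1 h).2, mul_zero]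
  rw [integral_congr_ae (Filter.Eventually.of_forall inner),
    integral_indicator hUcl.isOpen.measurableSet, setIntegral_const, Complex.real_smul] at hsum
  have hUpos : 0 < (Measure.addHaar : Measure F).real U :=
    measureReal_pos_of_isOpen_of_isCompact hUcl.isOpen
      ((isCompact_absv_le 1).of_isClosed_subset hUcl.isClosed fun x hx => le_of_eq hx)
      ⟨1, absv_one⟩
  exact mul_ne_zero hC0 (mul_ne_zero (by exact_mod_cast hUpos.ne') hJ) hsum.symm

end SlashChar

/-! ### Half periods. -/

section HalfPeriod

variable (K : Type*) [Field K] [ValuativeRel K] [TopologicalSpace K]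
  [IsNonarchimedeanLocalField K]

/-- Half of the generator of the period lattice. -/
def halfPeriod : ℂ := Real.pi * Complex.I / Real.log (resCard K)

variable {K}

lemma mem_periods_iff_halfPeriod {z : ℂ} : z ∈ periods K ↔ ∃ n : ℤ, z = 2 * n * halfPeriod K := by
  refine exists_congr fun n => ?_
  rw [halfPeriod]
  ring_nf

lemma resCard_cpow_eq_one_iff {z : ℂ} :
    (resCard K : ℂ) ^ z = 1 ↔ ∃ n : ℤ, z = 2 * n * halfPeriod K := by
  rw [← mem_periods_iff, mem_periods_iff_halfPeriod]

lemma resCard_cpow_halfPeriod : (resCard K : ℂ) ^ halfPeriod K = -1 := by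
  rw [resCard_cpow, halfPeriod, mul_div_cancel₀ _ log_resCard_ne_zero, Complex.exp_pi_mul_I]

lemma resCard_cpow_eq_neg_one_iff {z : ℂ} :
    (resCard K : ℂ) ^ z = -1 ↔ ∃ n : ℤ, z = (2 * n + 1) * halfPeriod K := by
  have h : (resCard K : ℂ) ^ z = -1 ↔ (resCard K : ℂ) ^ (z - halfPeriod K) = 1 := by
    rw [Complex.cpow_sub _ _ (resCard_ne_zero K), resCard_cpow_halfPeriod, div_neg, div_one,
      neg_eq_iff_eq_neg]
  rw [h, resCard_cpow_eq_one_iff]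
  refine exists_congr fun n => ⟨fun h => ?_, fun h => ?_⟩
  · linear_combination h
  · linear_combination h

lemma halfPeriod_eq : halfPeriod K = ((Real.pi / Real.log (resCard K) : ℝ) : ℂ) * Complex.I := by
  rw [halfPeriod]
  push_cast
  ring

end HalfPeriod

/-! ### The zero set: equations for it, and its discreteness. -/

section ZeroSet

variable {F E : Type*} [Field F] [ValuativeRel F] [TopologicalSpace F]
  [IsNonarchimedeanLocalField F] [Field E] [ValuativeRel E] [TopologicalSpace E]
  [IsNonarchimedeanLocalField E] [Algebra F E] [ValuativeExtension F E]

variable {χ : UnitChar E} {η : UnitChar F} {s t : ℂ}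

variable (F) in
/-- The condition on `s` for the distribution to vanish, when `χ|² = 1`. -/
def IsZeroExponent (χ : UnitChar E) (s : ℂ) : Prop :=
  (χ ^ 2 ≠ 1 ∧ (resCard F : ℂ) ^ (-(4 * s)) = 1) ∨
  (χ ^ 2 = 1 ∧ resCard E = resCard F ^ 2 ∧ (resCard F : ℂ) ^ (-(4 * s)) = (resCard F : ℂ) ^ 2) ∨
  (χ ^ 2 = 1 ∧ resCard E ≠ resCard F ^ 2 ∧
    ((resCard F : ℂ) ^ (2 * s) = -1 ∨ (resCard F : ℂ) ^ (-2 * s - 1) = 1))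

lemma resCard_cpow_eq_sq_iff :
    (resCard F : ℂ) ^ (-(4 * s)) = (resCard F : ℂ) ^ 2 ↔
      ∃ n : ℤ, 4 * (s + 1 / 2) = 2 * n * halfPeriod F := by
  have h : (resCard F : ℂ) ^ (-(4 * s)) = (resCard F : ℂ) ^ 2 ↔
      (resCard F : ℂ) ^ (4 * (s + 1 / 2)) = 1 := by
    rw [show 4 * (s + 1 / 2) = ((2 : ℕ) : ℂ) - -(4 * s) by push_cast; ring,
      Complex.cpow_sub _ _ (resCard_ne_zero F), Complex.cpow_natCast,
      div_eq_one_iff_eq (resCard_cpow_ne_zero F _), eq_comm]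
  rw [h, resCard_cpow_eq_one_iff]

lemma exists_halfPeriod_neg {w v : ℂ} (h : v = -w) :
    (∃ n : ℤ, v = 2 * n * halfPeriod F) ↔ ∃ n : ℤ, w = 2 * n * halfPeriod F := by
  constructor <;> rintro ⟨n, hn⟩ <;> refine ⟨-n, ?_⟩ <;> push_cast
  · linear_combination -hn + h
  · linear_combination -hn + h

variable (F) in
lemma isZeroExponent_iff : IsZeroExponent F χ s ↔
    (χ ^ 2 ≠ 1 ∧ ∃ n : ℤ, 4 * s = 2 * n * halfPeriod F) ∨
    (χ ^ 2 = 1 ∧ resCard E = resCard F ^ 2 ∧ ∃ n : ℤ, 4 * (s + 1 / 2) = 2 * n * halfPeriod F) ∨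
    (χ ^ 2 = 1 ∧ resCard E ≠ resCard F ^ 2 ∧ ((∃ n : ℤ, 2 * s = (2 * n + 1) * halfPeriod F) ∨
      ∃ n : ℤ, 2 * s + 1 = 2 * n * halfPeriod F)) := by
  rw [IsZeroExponent, resCard_cpow_eq_sq_iff, resCard_cpow_eq_one_iff, resCard_cpow_eq_one_iff,
    resCard_cpow_eq_neg_one_iff, exists_halfPeriod_neg (v := -(4 * s)) (w := 4 * s) rfl,
    exists_halfPeriod_neg (v := -2 * s - 1) (w := 2 * s + 1) (by ring)]

lemma halfPeriod_of_unramified (hq : resCard E = resCard F ^ 2) :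
    halfPeriod E = halfPeriod F / 2 := by
  have := log_resCard_ne_zero (K := F)
  rw [halfPeriod, halfPeriod, hq]
  push_cast
  rw [Real.log_pow]
  push_cast
  field_simp

/-- Trades the list of representatives for equations. The representatives correspond to the residue
class of the integer parametrizing s: modulo 2, or modulo 4 when χ² ≠ 1 and E/F is ramified.
Membership in `//` then fixes t up to periods. -/
lemma mem_zeroSet_iff (hq : resCard E = resCard F ^ 2 ∨ resCard E = resCard F) :
    (χ, s, η, t) ∈ zeroSet F E ↔ resChar χ * η = 1 ∧ resChar χ * η⁻¹ = 1 ∧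
      2 * s - t + 1 / 2 ∈ periods F ∧ IsZeroExponent F χ s := by
  change (_ ∧ _ ∧ ∃ r ∈ zeroReps F χ, _) ↔ _
  refine and_congr_right fun _ => and_congr_right fun _ => ?_
  rw [isZeroExponent_iff, mem_periods_iff_halfPeriod]
  simp only [mem_periods_iff_halfPeriod]
  have e1 : Real.pi * Complex.I / Real.log (resCard F) = halfPeriod F := rfl
  have e2 : Real.pi * Complex.I / Real.log (resCard E) = halfPeriod E := rfl
  have e3 : Real.pi * Complex.I / (2 * Real.log (resCard E)) = halfPeriod E / 2 := by
    rw [← e2]; ring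
  have e4 : 3 * Real.pi * Complex.I / (2 * Real.log (resCard E)) = 3 * halfPeriod E / 2 := by
    rw [← e2]; ring
  by_cases hχ : χ ^ 2 = 1 <;> by_cases hu : resCard E = resCard F ^ 2
  · have hp := halfPeriod_of_unramified hu
    simp only [zeroReps, hχ, hu, ne_eq, not_true_eq_false, if_false, if_true, false_and, true_and,
      or_false, false_or, Set.mem_insert_iff, Set.mem_singleton_iff]
    rw [← hu, e1, e2, hp]
    generalize halfPeriod F = u
    constructor
    · rintro ⟨r, rfl | rfl, ⟨m, hm⟩, n, hn⟩ <;> simp only at hm hn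
      · refine ⟨⟨m - n, ?_⟩, ⟨2 * m, ?_⟩⟩ <;> push_cast
        · linear_combination 2 * hm - hn
        · linear_combination 4 * hm
      · refine ⟨⟨m - n, ?_⟩, ⟨2 * m + 1, ?_⟩⟩ <;> push_cast
        · linear_combination 2 * hm - hn
        · linear_combination 4 * hm
    · rintro ⟨⟨k, hk⟩, j, hj⟩
      rcases Int.even_or_odd' j with ⟨m, rfl | rfl⟩ <;> push_cast at hj
      · refine ⟨_, Or.inl rfl, ⟨m, ?_⟩, m - k, ?_⟩ <;> push_cast
        · linear_combination hj / 4
        · linear_combination hj / 2 - hk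
      · refine ⟨_, Or.inr rfl, ⟨m, ?_⟩, m - k, ?_⟩ <;> push_cast
        · linear_combination hj / 4
        · linear_combination hj / 2 - hk
  · have hqe := hq.resolve_left hu
    have hp : halfPeriod E = halfPeriod F := by rw [halfPeriod, halfPeriod, hqe]
    simp only [zeroReps, hχ, hu, ne_eq, not_true_eq_false, if_false, false_and, true_and,
      false_or, Set.mem_insert_iff, Set.mem_singleton_iff, not_false_eq_true]
    rw [e1, e2, e3, e4, hp]
    generalize halfPeriod F = u
    constructor
    · rintro ⟨r, rfl | rfl | rfl | rfl, ⟨m, hm⟩, n, hn⟩ <;> simp only at hm hn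
      · refine ⟨⟨2 * m - n, ?_⟩, Or.inr ⟨2 * m, ?_⟩⟩ <;> push_cast
        · linear_combination 2 * hm - hn
        · linear_combination 2 * hm
      · refine ⟨⟨2 * m - n + 1, ?_⟩, Or.inr ⟨2 * m + 1, ?_⟩⟩ <;> push_cast
        · linear_combination 2 * hm - hn
        · linear_combination 2 * hm
      · refine ⟨⟨2 * m - n, ?_⟩, Or.inl ⟨2 * m, ?_⟩⟩ <;> push_cast
        · linear_combination 2 * hm - hn
        · linear_combination 2 * hm
      · refine ⟨⟨2 * m - n + 1, ?_⟩, Or.inl ⟨2 * m + 1, ?_⟩⟩ <;> push_cast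
        · linear_combination 2 * hm - hn
        · linear_combination 2 * hm
    · rintro ⟨⟨k, hk⟩, ⟨j, hj⟩ | ⟨j, hj⟩⟩ <;>
        rcases Int.even_or_odd' j with ⟨m, rfl | rfl⟩ <;> push_cast at hj
      · refine ⟨_, Or.inr (Or.inr (Or.inl rfl)), ⟨m, ?_⟩, 2 * m - k, ?_⟩ <;> push_cast
        · linear_combination hj / 2
        · linear_combination hj - hk
      · refine ⟨_, Or.inr (Or.inr (Or.inr rfl)), ⟨m, ?_⟩, 2 * m + 1 - k, ?_⟩ <;> push_cast
        · linear_combination hj / 2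
        · linear_combination hj - hk
      · refine ⟨_, Or.inl rfl, ⟨m, ?_⟩, 2 * m - k, ?_⟩ <;> push_cast
        · linear_combination hj / 2
        · linear_combination hj - hk
      · refine ⟨_, Or.inr (Or.inl rfl), ⟨m, ?_⟩, 2 * m + 1 - k, ?_⟩ <;> push_cast
        · linear_combination hj / 2
        · linear_combination hj - hk
  · have hp := halfPeriod_of_unramified hu
    simp only [zeroReps, hχ, hu, ne_eq, not_false_eq_true, if_true, false_and, true_and,
      or_false, Set.mem_insert_iff, Set.mem_singleton_iff]
    rw [← hu, e1, e2, hp]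
    generalize halfPeriod F = u
    constructor
    · rintro ⟨r, rfl | rfl, ⟨m, hm⟩, n, hn⟩ <;> simp only at hm hn
      · refine ⟨⟨m - n, ?_⟩, ⟨2 * m, ?_⟩⟩ <;> push_cast
        · linear_combination 2 * hm - hn
        · linear_combination 4 * hm
      · refine ⟨⟨m - n, ?_⟩, ⟨2 * m + 1, ?_⟩⟩ <;> push_cast
        · linear_combination 2 * hm - hn
        · linear_combination 4 * hm
    · rintro ⟨⟨k, hk⟩, j, hj⟩
      rcases Int.even_or_odd' j with ⟨m, rfl | rfl⟩ <;> push_cast at hj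
      · refine ⟨_, Or.inl rfl, ⟨m, ?_⟩, m - k, ?_⟩ <;> push_cast
        · linear_combination hj / 4
        · linear_combination hj / 2 - hk
      · refine ⟨_, Or.inr rfl, ⟨m, ?_⟩, m - k, ?_⟩ <;> push_cast
        · linear_combination hj / 4
        · linear_combination hj / 2 - hk
  · have hqe := hq.resolve_left hu
    have hp : halfPeriod E = halfPeriod F := by rw [halfPeriod, halfPeriod, hqe]
    simp only [zeroReps, hχ, hu, ne_eq, not_false_eq_true, if_true, if_false, false_and, true_and,
      or_false, Set.mem_insert_iff, Set.mem_singleton_iff]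
    rw [e1, e2, e3, e4, hp]
    generalize halfPeriod F = u
    constructor
    · rintro ⟨r, rfl | rfl | rfl | rfl, ⟨m, hm⟩, n, hn⟩ <;> simp only at hm hn
      · refine ⟨⟨2 * m - n, ?_⟩, ⟨4 * m, ?_⟩⟩ <;> push_cast
        · linear_combination 2 * hm - hn
        · linear_combination 4 * hm
      · refine ⟨⟨2 * m - n + 1, ?_⟩, ⟨4 * m + 2, ?_⟩⟩ <;> push_cast
        · linear_combination 2 * hm - hn
        · linear_combination 4 * hm
      · refine ⟨⟨2 * m - n, ?_⟩, ⟨4 * m + 1, ?_⟩⟩ <;> push_cast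
        · linear_combination 2 * hm - hn
        · linear_combination 4 * hm
      · refine ⟨⟨2 * m - n + 1, ?_⟩, ⟨4 * m + 3, ?_⟩⟩ <;> push_cast
        · linear_combination 2 * hm - hn
        · linear_combination 4 * hm
    · rintro ⟨⟨k, hk⟩, j, hj⟩
      rcases Int.even_or_odd' j with ⟨i, rfl | rfl⟩ <;>
        rcases Int.even_or_odd' i with ⟨m, rfl | rfl⟩ <;> push_cast at hj
      · refine ⟨_, Or.inl rfl, ⟨m, ?_⟩, 2 * m - k, ?_⟩ <;> push_cast
        · linear_combination hj / 4
        · linear_combination hj / 2 - hk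
      · refine ⟨_, Or.inr (Or.inl rfl), ⟨m, ?_⟩, 2 * m + 1 - k, ?_⟩ <;> push_cast
        · linear_combination hj / 4
        · linear_combination hj / 2 - hk
      · refine ⟨_, Or.inr (Or.inr (Or.inl rfl)), ⟨m, ?_⟩, 2 * m - k, ?_⟩ <;> push_cast
        · linear_combination hj / 4
        · linear_combination hj / 2 - hk
      · refine ⟨_, Or.inr (Or.inr (Or.inr rfl)), ⟨m, ?_⟩, 2 * m + 1 - k, ?_⟩ <;> push_cast
        · linear_combination hj / 4
        · linear_combination hj / 2 - hk

theorem zeroSet_subset_slashSet (hq : resCard E = resCard F ^ 2 ∨ resCard E = resCard F) :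
    zeroSet F E ⊆ slashSet F E := fun ⟨_, _, _, _⟩ h =>
  have h' := (mem_zeroSet_iff hq).1 h
  ⟨h'.2.1, h'.2.2.1⟩

/-- A lattice of imaginary numbers shifted by an integer has no small nonzero elements. -/
lemma eq_zero_of_norm_lt {z : ℂ} {m n : ℤ} (hz : z = m + n * halfPeriod F) (h1 : ‖z‖ < 1)
    (h2 : ‖z‖ < Real.pi / Real.log (resCard F)) : z = 0 := by
  have hu : 0 < Real.pi / Real.log (resCard F) :=
    div_pos Real.pi_pos (Real.log_pos one_lt_resCard_real)
  rw [halfPeriod_eq] at hz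
  generalize Real.pi / Real.log (resCard F) = a at *
  have hre : z.re = m := by rw [hz]; simp
  have him : z.im = n * a := by rw [hz]; simp
  have hm : m = 0 := by
    have := (Complex.abs_re_le_norm z).trans_lt h1
    rw [hre] at this
    exact Int.abs_lt_one_iff.1 (by exact_mod_cast this)
  have hn : n = 0 := by
    have := (Complex.abs_im_le_norm z).trans_lt h2
    rw [him, abs_mul, abs_of_pos hu, mul_lt_iff_lt_one_left hu] at this
    exact Int.abs_lt_one_iff.1 (by exact_mod_cast this)
  rw [hz, hm, hn]
  simp

lemma IsZeroExponent.exists_eq (h : IsZeroExponent F χ s) :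
    ∃ m n : ℤ, 2 * s = m + n * halfPeriod F := by
  rcases (isZeroExponent_iff F).1 h with
    ⟨-, n, h⟩ | ⟨-, -, n, h⟩ | ⟨-, -, ⟨n, h⟩ | ⟨n, h⟩⟩
  · exact ⟨0, n, by push_cast; linear_combination h / 2⟩
  · exact ⟨-1, n, by push_cast; linear_combination h / 2⟩
  · exact ⟨0, 2 * n + 1, by push_cast; linear_combination h⟩
  · exact ⟨-1, 2 * n, by push_cast; linear_combination h⟩

/-- In every case 2s lies in the lattice generated by 1 and the half period, and s determines t up
to periods. The radius ε is half the smaller of the two spacings. -/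
theorem isDiscrete_zeroSet (hq : resCard E = resCard F ^ 2 ∨ resCard E = resCard F) :
    IsDiscrete (zeroSet F E) := by
  have hu : 0 < Real.pi / Real.log (resCard F) :=
    div_pos Real.pi_pos (Real.log_pos one_lt_resCard_real)
  set ε : ℝ := min 1 (Real.pi / Real.log (resCard F)) / 2 with hε
  have hε0 : 0 < ε := div_pos (lt_min one_pos hu) two_pos
  have hε1 : 2 * ε ≤ 1 := by rw [hε, mul_div_cancel₀ _ two_ne_zero]; exact min_le_left _ _
  have hε2 : 2 * ε ≤ Real.pi / Real.log (resCard F) := by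
    rw [hε, mul_div_cancel₀ _ two_ne_zero]; exact min_le_right _ _
  rw [isDiscrete_iff_forall_mem_exists_isOpen]
  rintro ⟨χ, s, η, t⟩ hp
  refine ⟨{χ} ×ˢ Metric.ball s ε ×ˢ {η} ×ˢ Metric.ball t ε, (isOpen_discrete _).prod
    (Metric.isOpen_ball.prod ((isOpen_discrete _).prod Metric.isOpen_ball)), ?_⟩
  ext ⟨χ', s', η', t'⟩
  rw [Set.mem_inter_iff, Set.mem_prod, Set.mem_prod, Set.mem_prod, Set.mem_singleton_iff]
  constructor
  swap
  · intro h
    obtain ⟨rfl, rfl, rfl, rfl⟩ : χ' = χ ∧ s' = s ∧ η' = η ∧ t' = t := by simpa using h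
    exact ⟨⟨rfl, Metric.mem_ball_self hε0, rfl, Metric.mem_ball_self hε0⟩, hp⟩
  · rintro ⟨⟨h1, hs, h3, ht⟩, hp'⟩
    obtain rfl : χ' = χ := h1
    obtain rfl : η' = η := h3
    simp only [Metric.mem_ball, dist_eq_norm] at hs ht
    obtain ⟨-, -, hts, hz⟩ := (mem_zeroSet_iff hq).1 hp
    obtain ⟨-, -, hts', hz'⟩ := (mem_zeroSet_iff hq).1 hp'
    obtain ⟨m, n, hmn⟩ := hz.exists_eq
    obtain ⟨m', n', hmn'⟩ := hz'.exists_eq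
    have hs2 : ‖2 * (s' - s)‖ < 2 * ε := by
      rw [norm_mul, Complex.norm_ofNat]
      linarith
    have es := eq_zero_of_norm_lt (F := F) (z := 2 * (s' - s)) (m := m' - m) (n := n' - n)
      (by push_cast; linear_combination hmn' - hmn) (by linarith) (by linarith)
    obtain rfl : s' = s := by
      rw [mul_eq_zero, or_iff_right two_ne_zero] at es
      exact sub_eq_zero.1 es
    obtain ⟨k, hk⟩ := mem_periods_iff_halfPeriod.1 hts
    obtain ⟨k', hk'⟩ := mem_periods_iff_halfPeriod.1 hts'
    have et := eq_zero_of_norm_lt (F := F) (z := t' - t) (m := 0) (n := 2 * k - 2 * k')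
      (by push_cast; linear_combination hk - hk') (by linarith) (by linarith)
    rw [sub_eq_zero.1 et]
    exact Set.mem_singleton _

end ZeroSet

/-! ### Vanishing of the distribution on `//`. -/

section Vanishing

variable {F E : Type*} [Field F] [ValuativeRel F] [TopologicalSpace F]
  [IsNonarchimedeanLocalField F] [Field E] [ValuativeRel E] [TopologicalSpace E]
  [IsNonarchimedeanLocalField E] [Algebra F E] [ValuativeExtension F E]

lemma multChar_add_of_mem_periods {K : Type*} [Field K] [ValuativeRel K] [TopologicalSpace K]
    [IsNonarchimedeanLocalField K] (ϖ : 𝒪[K]) (ξ : UnitChar K) (s : ℂ) {z : ℂ}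
    (hz : z ∈ periods K) (x : K) : multChar ϖ ξ (s + z) x = multChar ϖ ξ s x := by
  by_cases hx : x = 0
  · simp [hx, multChar_zero]
  have h0 : ((absv x : ℝ) : ℂ) ≠ 0 := by exact_mod_cast (absv_pos hx).ne'
  have h1 : ((absv x : ℝ) : ℂ) ^ z = 1 := by
    obtain ⟨n, hn⟩ := mem_periods_iff_halfPeriod.1 hz
    have h2 : (resCard K : ℂ) ^ (((-ord x : ℤ) : ℂ) * z) = 1 :=
      resCard_cpow_eq_one_iff.2 ⟨-ord x * n, by rw [hn]; push_cast; ring⟩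
    rw [resCard_cpow] at h2
    rw [Complex.cpow_def_of_ne_zero h0, ← Complex.ofReal_log (absv_nonneg x), absv_of_ne_zero hx,
      Real.log_zpow, ← h2]
    congr 1
    push_cast
    ring
  rw [multChar, multChar, Complex.cpow_add _ _ h0, h1, mul_one]

variable {b : Module.Basis (Fin 2) F E} {d : F} {ϖF : 𝒪[F]} {ϖE : 𝒪[E]} {χ : UnitChar E}
  {η : UnitChar F} {s t : ℂ} [MeasurableSpace E]

/-- t enters only through powers of absolute values in F, which are periodic in the exponent. On
`//` this permits the choice t = 2s + 1/2. -/
lemma regInt_add_of_mem_periods (μ : Measure E) (l : Fˣ) (c : ℂ) {z : ℂ} (hz : z ∈ periods F)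
    (φ : E → ℂ) : regInt b d ϖF ϖE μ χ η l c s (t + z) φ = regInt b d ϖF ϖE μ χ η l c s t φ := by
  have h : ∀ w, fiberChar ϖF χ η s (t + z) w = fiberChar ϖF χ η s t w := fun w => by
    rw [fiberChar, fiberChar, ← multChar_add_of_mem_periods _ _ (2 * s + t - 1 / 2) hz]
    congr 1
    ring
  simp only [regInt, regIntegrand, smoothFactor, h]

variable [BorelSpace E] {μ : Measure E} [μ.IsAddHaarMeasure] {l : Fˣ} {c : ℂ}

variable (hb : b 0 = 1) (hd : b 1 ^ 2 = algebraMap F E d) (hϖF : Irreducible ϖF)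
  (hϖE : Irreducible ϖE) (hχ : multChar ϖE χ 0 (algebraMap F E ϖF) = 1)

include hb hd hϖF hϖE hχ

/-- On the set `//` the distribution vanishes exactly at the points of `L`. -/
theorem distr_eq_zero_iff_of_mem_slashSet (hp : (χ, s, η, t) ∈ slashSet F E)
    (hl : ∀ z r, (localL z (resChar χ * η) r)⁻¹ = c * (1 - multChar ϖF (resChar χ * η) (z + r) l))
    (hl1 : resChar χ * η ≠ 1 → absv (l : F) = 1) {T : Distr E}
    (hT0 : ∀ φ : testFunctions E, φ 0 = 0 → T φ = 0)
    (hT : ∀ φ : testFunctions E, T φ = regInt b d ϖF ϖE μ χ η l c s t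
      fun x => φ x - φ (algebraMap F E (ϖF : F)⁻¹ * x)) :
    T = 0 ↔ (χ, s, η, t) ∈ zeroSet F E := by
  obtain ⟨hη', hper⟩ := hp
  have hη : resChar χ = η := mul_inv_eq_one.1 hη'
  have hz : t - (2 * s + 1 / 2) ∈ periods F := by
    obtain ⟨n, hn⟩ := mem_periods_iff_halfPeriod.1 hper
    exact mem_periods_iff_halfPeriod.2 ⟨-n, by push_cast; linear_combination -hn⟩
  obtain ⟨b', hb', hB⟩ := exists_integralBasis b hϖE hϖF
  have hq : resCard E = resCard F ^ 2 ∨ resCard E = resCard F := hB.imp And.left And.left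
  have hreg : ∀ φ, regInt b d ϖF ϖE μ χ η l c s t φ =
      regInt b d ϖF ϖE μ χ η l c s (2 * s + 1 / 2) φ := fun φ => by
    have := regInt_add_of_mem_periods (b := b) (d := d) (ϖF := ϖF) (ϖE := ϖE) (χ := χ) (η := η)
      (s := s) (t := 2 * s + 1 / 2) μ l c hz φ
    rwa [add_sub_cancel] at this
  rw [mem_zeroSet_iff hq]
  by_cases h1 : resChar χ * η = 1
  swap
  · simp only [h1, false_and, iff_false]
    exact distr_ne_zero_of_resChar_mul_ne_one (μ := μ) hb hd hϖF hϖE hχ hη h1 (hl1 h1) hl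
      fun φ => (hT φ).trans (hreg _)
  simp only [h1, hη', hper, true_and]
  -- A multiple of the Dirac mass is tested on the indicator of the integers.
  rw [distr_eq_zero_iff_of_vanishing hT0 integerTest_zero, hT, hreg,
    funext (integerTest_sub_dil b hϖF)]
  by_cases h2 : χ ^ 2 = 1
  · by_cases hu : resCard E = resCard F ^ 2
    · rw [regInt_fundamentalShell_eq_zero_iff_of_unramified hb hd hϖF hϖE hχ hη h1 hl h2 hu]
      simp [IsZeroExponent, h2, hu]
    · rw [regInt_fundamentalShell_eq_zero_iff_of_ramified hb hd hϖF hϖE hχ hη h1 hl h2 hu]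
      simp [IsZeroExponent, h2, hu]
  · rw [regInt_fundamentalShell_eq_zero_iff_of_sq_ne_one hb hd hϖF hϖE hχ hη h1 hl h2]
    simp [IsZeroExponent, h2]

end Vanishing

end

end SymBreak

/-! ### Assembly of the theorem. -/

open SymBreak
theorem theoremB {F E : Type*}
    [Field F] [ValuativeRel F] [TopologicalSpace F] [IsNonarchimedeanLocalField F]
    [Field E] [ValuativeRel E] [TopologicalSpace E] [IsNonarchimedeanLocalField E]
    [Algebra F E] [ValuativeExtension F E]
    [MeasurableSpace E] [BorelSpace E]
    (b : Module.Basis (Fin 2) F E) (hb : b 0 = 1)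
    (d : F) (hd : b 1 ^ 2 = algebraMap F E d)
    (ϖF : 𝒪[F]) (hϖF : Irreducible ϖF) (ϖE : 𝒪[E]) (hϖE : Irreducible ϖE)
    (μ : Measure E) [μ.IsAddHaarMeasure] (hμ : μ (𝒪[E] : Set E) = 1) :
    zeroSet F E ⊆ slashSet F E ∧ IsDiscrete (zeroSet F E) ∧
    ∀ (χ : UnitChar E) (η : UnitChar F), multChar ϖE χ 0 (algebraMap F E ϖF) = 1 →
      (∃! Kt : ℂ → ℂ → Distr E, IsRenormalizedKernel b d ϖF ϖE μ χ η Kt) ∧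
      ∀ Kt : ℂ → ℂ → Distr E, IsRenormalizedKernel b d ϖF ϖE μ χ η Kt →
        ∀ s t : ℂ,
          (Kt s t = 0 ↔ (χ, s, η, t) ∈ zeroSet F E) ∧
          ((χ, s, η, t) ∈ zeroSet F E → Distribution.dsupport (Kt s t) = ∅) ∧
          ((χ, s, η, t) ∈ slashSet F E \ zeroSet F E →
            Distribution.dsupport (Kt s t) = {0}) ∧
          ((χ, s, η, t) ∈ backslashSet F E \ slashSet F E →
            Distribution.dsupport (Kt s t) = Set.range (algebraMap F E)) ∧
          ((χ, s, η, t) ∉ slashSet F E ∪ backslashSet F E →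
            Distribution.dsupport (Kt s t) = Set.univ) := by
  obtain ⟨b', -, hB⟩ := exists_integralBasis b hϖE hϖF
  have hq : resCard E = resCard F ^ 2 ∨ resCard E = resCard F := hB.imp And.left And.left
  refine ⟨zeroSet_subset_slashSet hq, isDiscrete_zeroSet hq, fun χ η hχ => ?_⟩
  obtain ⟨Kt, l, c, hK, hint, hvan, hl, hc0, hl1, hl2, hdil⟩ :=
    exists_renormalization (η := η) (μ := μ) hb hd hϖF hϖE hχ
  refine ⟨⟨Kt, hK, fun Kt' h => h.unique hb hd hϖF hϖE hK⟩, fun Kt' hK' s t => ?_⟩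
  obtain rfl : Kt' = Kt := hK'.unique hb hd hϖF hϖE hK
  have hsubrange : (χ, s, η, t) ∈ backslashSet F E \ slashSet F E →
      Distribution.dsupport (Kt' s t) = Set.range (algebraMap F E) := by
    rintro ⟨h, hn⟩
    refine (dsupport_subset_range hb hd hϖF hϖE hχ (hint s t)
      (normFactor_eq_zero_iff.2 (Or.inr h))).antisymm ?_
    exact range_subset_dsupport hb hd hϖF hϖE (hvan s t) h.1 (hl1 h.1).1 hc0
      fun h0 => hn (inv_localL_eq_zero_iff.1 h0)
  have huniv : (χ, s, η, t) ∉ slashSet F E ∪ backslashSet F E →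
      Distribution.dsupport (Kt' s t) = Set.univ := fun h =>
    dsupport_eq_univ hb hd hϖF hϖE hχ (hint s t) (mt normFactor_eq_zero_iff.1 h)
  have hT0 : (χ, s, η, t) ∈ slashSet F E → ∀ φ : testFunctions E, φ 0 = 0 → Kt' s t φ = 0 :=
    fun h φ h0 => by rw [hvan s t φ h0, inv_localL_eq_zero_iff.2 h, zero_mul]
  have hzero : Kt' s t = 0 ↔ (χ, s, η, t) ∈ zeroSet F E := by
    by_cases h : (χ, s, η, t) ∈ slashSet F E
    · exact distr_eq_zero_iff_of_mem_slashSet hb hd hϖF hϖE hχ h hl hl2 (hT0 h) (hdil h.1 s t)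
    -- Off `//` the support has been found to be F or E, which is nonempty, so the distribution is
    -- not zero.
    · refine iff_of_false (fun h0 => ?_) fun hz => h (zeroSet_subset_slashSet hq hz)
      have hemp : Distribution.dsupport (Kt' s t) = ∅ := by rw [h0]; exact dsupport_zero
      by_cases h' : (χ, s, η, t) ∈ backslashSet F E
      · rw [hsubrange ⟨h', h⟩] at hemp
        exact (Set.range_nonempty _).ne_empty hemp
      · rw [huniv (by rintro (h1 | h1) <;> contradiction)] at hemp
        exact Set.univ_nonempty.ne_empty hemp
  refine ⟨hzero, fun h => ?_, fun h => ?_, hsubrange, huniv⟩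
  · rw [hzero.2 h]
    exact dsupport_zero
  · exact dsupport_eq_singleton (hT0 h.1) fun h0 => h.2 (hzero.1 h0)
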